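/- Let $d\ge 1$, let $T_1<T_2$ be real numbers, let $\Omega\subset\mathbb R^d$ be a nonempty bounded open set and $Q=(T_1,T_2)\times\Omega$. Let $\lambda,\Lambda>0$ and $\max(2,\frac{d+2}{2})<q\le\infty$. Let $A$ be a bounded measurable field of real $d\times d$ matrices on $Q$ with $\lambda|\xi|^2\le A(t,x)\xi\cdot\xi\le\Lambda|\xi|^2$ for all $\xi\in\mathbb R^d$ and a.e. $(t,x)\in Q$, let $B:Q\to\mathbb R^d$ be measurable with $|B|\le\Lambda$ a.e., and let $g\in L^q(Q)$. Let $M$ be such that $|A(t,x)\xi|\le M|\xi|$ for all $\xi$ and a.e. $(t,x)\in Q$; if $A$ is symmetric a.e., $M=\Lambda$ is allowed. A *weak subsolution* (resp. *weak supersolution*) of $$\partial_t u=\nabla_x\cdot(A\nabla_x u)+B\cdot\nabla_x u+g\quad\text{in }Q \qquad (1)$$ is a function $u\in L^\infty((T_1,T_2);L^2(\Omega))$ with $\nabla_x u\in L^2(Q)$, $\partial_t u\in L^2((T_1,T_2);H^{-1}(\Omega))$ and $$-\int_Q u\,\partial_t\varphi+\int_Q A\nabla_x u\cdot\nabla_x\varphi-\int_Q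 (B\cdot\nabla_x u)\,\varphi-\int_Q g\varphi\le 0\quad(\text{resp. }\ge 0)$$ for all nonnegative $\varphi\in C_c^\infty(Q)$; it is a *weak solution* if equality holds for all $\varphi\in C_c^\infty(Q)$. For $\gamma_1,\gamma_2,\gamma_3>0$ and $1\le p\le\frac{d+2}{d}$, the *De Giorgi class* $DG^{\pm}(\gamma_1,\gamma_2,\gamma_3,p)$ is the set of all $u\in L^\infty((T_1,T_2);L^2(\Omega))$, defined at every time of $[T_1,T_2]$ with $u(t,\cdot)\in L^2(\Omega)$, such that $\nabla_x u\in L^2(Q)$ and, for all $k\in\mathbb R$, all $T_1\le s<t\le T_2$, all $0<r<R$ and all $x_0\in\Omega$ with $B_R(x_0)\subset\Omega$, the gradient $\nabla_x(u-k)_\pm$ is in $L^2(Q)$ and $$\int_{B_r(x_0)}(u-k)_\pm^2(t,x)\,dx+\gamma_1\int_s^t\!\!\int_{B_r(x_0)}|\nabla_x(u-k)_\pm|^2\,dx\,d\tau\le\int_{B_R(x_0)}(u-k)_\pm^2(s,x)\,dx+\frac{\gamma_2}{(R-r)^2}\int_s^t\!\!\int_{B_R(x_0)}(u-k)_\pm^2\,dx\,d\tau+\gamma_3\Big(\int_s^t\!\!\int_{B_R(x_0)}(u-k)_\pm^p\,dx\,d\tau\Big)^{1/p}.$$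 Set $\gamma_1=\frac{\lambda}{2}$, $\gamma_2=\frac{5M^2+\Lambda^2\,\mathrm{diam}(\Omega)^2}{\lambda}$ and $p=\frac{q}{q-1}$ ($p=1$ if $q=\infty$), and let $\gamma_3>0$ be any number with $\gamma_3\ge 2\|g\|_{L^q(Q)}$. Then every weak subsolution (resp. weak supersolution) of (1) is, after modification on a null set of $Q$ and with suitable values at the times $T_1,T_2$, continuous on $[T_1,T_2]$ with values in $L^2_{loc}(\Omega)$, and this time-continuous representative belongs to $DG^+(\gamma_1,\gamma_2,\gamma_3,p)$ (resp. $DG^-(\gamma_1,\gamma_2,\gamma_3,p)$). The time-continuous representative of a weak solution belongs to $DG^+(\gamma_1,\gamma_2,\gamma_3,p)\cap DG^-(\gamma_1,\gamma_2,\gamma_3,p)$. -/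

import Mathlib

open MeasureTheory Set Filter Topology
open scoped ENNReal NNReal ContDiff RealInnerProductSpace

noncomputable section

namespace ParabolicDG

/-- The space variable ranges over `ℝ^d` with its Euclidean norm. -/
abbrev Space (d : ℕ) : Type := EuclideanSpace ℝ (Fin d)

/-- The space-time cylinder `Q = (T₁, T₂) × Ω`. -/
def cylinder {d : ℕ} (T₁ T₂ : ℝ) (Ω : Set (Space d)) : Set (ℝ × Space d) :=
  Ioo T₁ T₂ ×ˢ Ω

/-- Lebesgue measure on the cylinder `Q`. -/
def cylMeasure {d : ℕ} (T₁ T₂ : ℝ) (Ω : Set (Space d)) : Measure (ℝ × Space d) :=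
  volume.restrict (cylinder T₁ T₂ Ω)

/-- `φ ∈ C_c^∞(U)`. -/
structure IsTestFunction {X : Type*} [NormedAddCommGroup X] [NormedSpace ℝ X]
    (U : Set X) (φ : X → ℝ) : Prop where
  smooth : ContDiff ℝ ∞ φ
  compact : HasCompactSupport φ
  support_subset : tsupport φ ⊆ U

/-- The time derivative `∂_t φ`. -/
def timeDeriv {d : ℕ} (φ : ℝ × Space d → ℝ) (z : ℝ × Space d) : ℝ :=
  deriv (fun t : ℝ => φ (t, z.2)) z.1

/-- The spatial gradient `∇_x φ`. -/
def spaceGrad {d : ℕ} (φ : ℝ × Space d → ℝ) (z : ℝ × Space d) : Space d :=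
  gradient (fun x : Space d => φ (z.1, x)) z.2

/-! ### The spaces `H^1_0(Ω)` and `H^{-1}(Ω)` -/

theorem IsTestFunction.memLp {d : ℕ} {Ω : Set (Space d)} {φ : Space d → ℝ}
    (h : IsTestFunction Ω φ) : MemLp φ 2 (volume.restrict Ω) :=
  (h.smooth.continuous.memLp_of_hasCompactSupport h.compact).restrict Ω

theorem IsTestFunction.memLp_gradient {d : ℕ} {Ω : Set (Space d)} {φ : Space d → ℝ}
    (h : IsTestFunction Ω φ) : MemLp (gradient φ) 2 (volume.restrict Ω) := by
  have hc : Continuous (gradient φ) :=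
    (InnerProductSpace.toDual ℝ (Space d)).symm.continuous.comp
      (h.smooth.continuous_fderiv (by simp))
  have hs : HasCompactSupport (gradient φ) :=
    (h.compact.fderiv ℝ).comp_left
      (g := fun L => (InnerProductSpace.toDual ℝ (Space d)).symm L) (by simp)
  exact (hc.memLp_of_hasCompactSupport hs).restrict Ω

/-- The Hilbert space `L²(Ω) × L²(Ω; ℝ^d)`, in which `H¹(Ω)` sits isometrically by
`ψ ↦ (ψ, ∇ψ)`. -/
abbrev L2Pair {d : ℕ} (Ω : Set (Space d)) : Type :=
  WithLp 2 (Lp ℝ 2 (volume.restrict Ω) × Lp (Space d) 2 (volume.restrict Ω))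

/-- The pair `(φ, ∇φ)` of a test function. -/
def IsTestFunction.toPair {d : ℕ} {Ω : Set (Space d)} {φ : Space d → ℝ}
    (h : IsTestFunction Ω φ) : L2Pair Ω :=
  WithLp.toLp 2 (h.memLp.toLp φ, h.memLp_gradient.toLp (gradient φ))

/-- `H^1_0(Ω)`, the closure of `C_c^∞(Ω)` for the `H¹` norm
`(‖ψ‖²_{L²} + ‖∇ψ‖²_{L²})^{1/2}`. -/
def H10 {d : ℕ} (Ω : Set (Space d)) : Submodule ℝ (L2Pair Ω) :=
  (Submodule.span ℝ {x : L2Pair Ω | ∃ (φ : Space d → ℝ) (h : IsTestFunction Ω φ),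
    x = h.toPair}).topologicalClosure

/-- A test function as an element of `H^1_0(Ω)`. -/
def IsTestFunction.toH10 {d : ℕ} {Ω : Set (Space d)} {φ : Space d → ℝ}
    (h : IsTestFunction Ω φ) : H10 Ω :=
  ⟨h.toPair, Submodule.le_topologicalClosure _ (Submodule.subset_span ⟨φ, h, rfl⟩)⟩

/-- `H^{-1}(Ω)`, the dual of `H^1_0(Ω)` with the dual norm. -/
abbrev HMinusOne {d : ℕ} (Ω : Set (Space d)) : Type := StrongDual ℝ (H10 Ω)

/-- The time slices of a test function on `Q` are test functions on `Ω`. -/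
theorem IsTestFunction.slice {d : ℕ} {T₁ T₂ : ℝ} {Ω : Set (Space d)} {φ : ℝ × Space d → ℝ}
    (h : IsTestFunction (cylinder T₁ T₂ Ω) φ) (t : ℝ) :
    IsTestFunction Ω (fun x => φ (t, x)) := by
  have hsub : tsupport (fun x => φ (t, x)) ⊆ (fun x => ((t, x) : ℝ × Space d)) ⁻¹' tsupport φ :=
    closure_minimal (fun x hx => subset_tsupport φ hx)
      ((isClosed_tsupport φ).preimage (by fun_prop))
  refine ⟨h.smooth.comp (by fun_prop), ?_, fun x hx => (h.support_subset (hsub hx)).2⟩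
  exact (h.compact.isCompact.image continuous_snd).of_isClosed_subset (isClosed_tsupport _)
    (fun x hx => ⟨(t, x), hsub hx, rfl⟩)

/-! ### Function classes on the cylinder -/

/-- `u ∈ L^∞((T₁, T₂); L²(Ω))`. -/
structure InLinftyL2 {d : ℕ} (T₁ T₂ : ℝ) (Ω : Set (Space d)) (u : ℝ × Space d → ℝ) : Prop where
  measurable : AEStronglyMeasurable u (cylMeasure T₁ T₂ Ω)
  bounded : ∃ C : ℝ≥0, ∀ᵐ t ∂(volume.restrict (Ioo T₁ T₂)),
    eLpNorm (fun x => u (t, x)) 2 (volume.restrict Ω) ≤ C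

/-- `G` is the weak spatial gradient `∇_x w` of `w` on `Q`, and `G ∈ L²(Q)`. -/
structure IsWeakSpaceGrad {d : ℕ} (T₁ T₂ : ℝ) (Ω : Set (Space d)) (w : ℝ × Space d → ℝ)
    (G : ℝ × Space d → Space d) : Prop where
  locallyIntegrable : LocallyIntegrableOn w (cylinder T₁ T₂ Ω) volume
  memLp : MemLp G 2 (cylMeasure T₁ T₂ Ω)
  integral_eq : ∀ φ : ℝ × Space d → ℝ, IsTestFunction (cylinder T₁ T₂ Ω) φ →
    ∫ z, w z • spaceGrad φ z ∂(cylMeasure T₁ T₂ Ω) = -∫ z, φ z • G z ∂(cylMeasure T₁ T₂ Ω)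

/-- `∂_t u ∈ L²((T₁, T₂); H^{-1}(Ω))`: the distribution `φ ↦ -∫_Q u ∂_t φ` on `Q` is given by a
square integrable `f : (T₁, T₂) → H^{-1}(Ω)`. -/
def TimeDerivInL2HMinusOne {d : ℕ} (T₁ T₂ : ℝ) (Ω : Set (Space d)) (u : ℝ × Space d → ℝ) : Prop :=
  ∃ f : ℝ → HMinusOne Ω, MemLp f 2 (volume.restrict (Ioo T₁ T₂)) ∧
    ∀ (φ : ℝ × Space d → ℝ) (hφ : IsTestFunction (cylinder T₁ T₂ Ω) φ),
      -∫ z, u z * timeDeriv φ z ∂(cylMeasure T₁ T₂ Ω) =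
        ∫ t in Ioo T₁ T₂, f t (hφ.slice t).toH10

/-! ### The equation `∂_t u = ∇_x·(A ∇_x u) + B·∇_x u + g` -/

/-- The standing assumptions on the coefficients: `A` is a measurable matrix field with
`0 < λ I ≤ A ≤ Λ I`, `B` is measurable with `|B| ≤ Λ`, and `g ∈ L^q(Q)`. The boundedness of `A`
is not in this list. -/
structure AdmissibleCoefficients {d : ℕ} (T₁ T₂ : ℝ) (Ω : Set (Space d)) (lam Lam : ℝ) (q : ℝ≥0∞)
    (A : ℝ × Space d → Matrix (Fin d) (Fin d) ℝ) (B : ℝ × Space d → Space d)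
    (g : ℝ × Space d → ℝ) : Prop where
  lam_pos : 0 < lam
  Lam_pos : 0 < Lam
  measurable_A : ∀ i j, AEStronglyMeasurable (fun z => A z i j) (cylMeasure T₁ T₂ Ω)
  elliptic : ∀ᵐ z ∂(cylMeasure T₁ T₂ Ω), ∀ ξ : Space d,
    lam * ‖ξ‖ ^ 2 ≤ ⟪(A z).toEuclideanLin ξ, ξ⟫ ∧ ⟪(A z).toEuclideanLin ξ, ξ⟫ ≤ Lam * ‖ξ‖ ^ 2
  measurable_B : AEStronglyMeasurable B (cylMeasure T₁ T₂ Ω)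
  bound_B : ∀ᵐ z ∂(cylMeasure T₁ T₂ Ω), ‖B z‖ ≤ Lam
  memLp_g : MemLp g q (cylMeasure T₁ T₂ Ω)

/-- `M` is a bound of the field `A`: either `|A(z) ξ| ≤ M |ξ|` for all `ξ`, for a.e. `z ∈ Q`, or `A`
is a.e. symmetric and `M` is the upper ellipticity constant `Λ`. -/
def IsMatrixBound {d : ℕ} (T₁ T₂ : ℝ) (Ω : Set (Space d)) (Lam : ℝ)
    (A : ℝ × Space d → Matrix (Fin d) (Fin d) ℝ) (M : ℝ) : Prop :=
  (∀ᵐ z ∂(cylMeasure T₁ T₂ Ω), ∀ ξ : Space d, ‖(A z).toEuclideanLin ξ‖ ≤ M * ‖ξ‖) ∨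
    ((∀ᵐ z ∂(cylMeasure T₁ T₂ Ω), (A z).IsSymm) ∧ M = Lam)

/-- `-∫_Q u ∂_t φ + ∫_Q A G · ∇_x φ - ∫_Q (B · G) φ - ∫_Q g φ`, where `G` stands for `∇_x u`. -/
def weakForm {d : ℕ} (T₁ T₂ : ℝ) (Ω : Set (Space d))
    (A : ℝ × Space d → Matrix (Fin d) (Fin d) ℝ) (B : ℝ × Space d → Space d)
    (g u : ℝ × Space d → ℝ) (G : ℝ × Space d → Space d) (φ : ℝ × Space d → ℝ) : ℝ :=
  -(∫ z, u z * timeDeriv φ z ∂(cylMeasure T₁ T₂ Ω))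
    + (∫ z, ⟪(A z).toEuclideanLin (G z), spaceGrad φ z⟫ ∂(cylMeasure T₁ T₂ Ω))
    - (∫ z, ⟪B z, G z⟫ * φ z ∂(cylMeasure T₁ T₂ Ω))
    - (∫ z, g z * φ z ∂(cylMeasure T₁ T₂ Ω))

/-- Weak subsolutions. -/
def IsWeakSubsolution {d : ℕ} (T₁ T₂ : ℝ) (Ω : Set (Space d))
    (A : ℝ × Space d → Matrix (Fin d) (Fin d) ℝ) (B : ℝ × Space d → Space d)
    (g u : ℝ × Space d → ℝ) : Prop :=
  InLinftyL2 T₁ T₂ Ω u ∧ TimeDerivInL2HMinusOne T₁ T₂ Ω u ∧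
    ∃ G : ℝ × Space d → Space d, IsWeakSpaceGrad T₁ T₂ Ω u G ∧
      ∀ φ : ℝ × Space d → ℝ, IsTestFunction (cylinder T₁ T₂ Ω) φ → (∀ z, 0 ≤ φ z) →
        weakForm T₁ T₂ Ω A B g u G φ ≤ 0

/-- Weak supersolutions. -/
def IsWeakSupersolution {d : ℕ} (T₁ T₂ : ℝ) (Ω : Set (Space d))
    (A : ℝ × Space d → Matrix (Fin d) (Fin d) ℝ) (B : ℝ × Space d → Space d)
    (g u : ℝ × Space d → ℝ) : Prop :=
  InLinftyL2 T₁ T₂ Ω u ∧ TimeDerivInL2HMinusOne T₁ T₂ Ω u ∧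
    ∃ G : ℝ × Space d → Space d, IsWeakSpaceGrad T₁ T₂ Ω u G ∧
      ∀ φ : ℝ × Space d → ℝ, IsTestFunction (cylinder T₁ T₂ Ω) φ → (∀ z, 0 ≤ φ z) →
        0 ≤ weakForm T₁ T₂ Ω A B g u G φ

/-- Weak solutions. -/
def IsWeakSolution {d : ℕ} (T₁ T₂ : ℝ) (Ω : Set (Space d))
    (A : ℝ × Space d → Matrix (Fin d) (Fin d) ℝ) (B : ℝ × Space d → Space d)
    (g u : ℝ × Space d → ℝ) : Prop :=
  InLinftyL2 T₁ T₂ Ω u ∧ TimeDerivInL2HMinusOne T₁ T₂ Ω u ∧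
    ∃ G : ℝ × Space d → Space d, IsWeakSpaceGrad T₁ T₂ Ω u G ∧
      ∀ φ : ℝ × Space d → ℝ, IsTestFunction (cylinder T₁ T₂ Ω) φ →
        weakForm T₁ T₂ Ω A B g u G φ = 0

/-! ### De Giorgi classes -/

/-- The De Giorgi class built on the truncation `a ↦ part a` (`a₊` or `a₋`). The values of
`u` at every time in `[T₁, T₂]`, end points included, enter; each slice `u(t, ·)` is required to
be in `L²(Ω)`, so that the integrals over balls at fixed times are finite. -/
structure InDG {d : ℕ} (part : ℝ → ℝ) (T₁ T₂ : ℝ) (Ω : Set (Space d)) (γ₁ γ₂ γ₃ p : ℝ)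
    (u : ℝ × Space d → ℝ) : Prop where
  γ₁_pos : 0 < γ₁
  γ₂_pos : 0 < γ₂
  γ₃_pos : 0 < γ₃
  one_le_p : 1 ≤ p
  p_le : p ≤ ((d : ℝ) + 2) / d
  inLinftyL2 : InLinftyL2 T₁ T₂ Ω u
  slice_memLp : ∀ t ∈ Icc T₁ T₂, MemLp (fun x => u (t, x)) 2 (volume.restrict Ω)
  hasGrad : ∃ G : ℝ × Space d → Space d, IsWeakSpaceGrad T₁ T₂ Ω u G
  energy : ∀ k : ℝ, ∃ H : ℝ × Space d → Space d,
    IsWeakSpaceGrad T₁ T₂ Ω (fun z => part (u z - k)) H ∧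
    ∀ s t : ℝ, T₁ ≤ s → s < t → t ≤ T₂ →
    ∀ r R : ℝ, 0 < r → r < R → ∀ x₀ ∈ Ω, Metric.ball x₀ R ⊆ Ω →
      (∫ x in Metric.ball x₀ r, part (u (t, x) - k) ^ 2)
        + γ₁ * ∫ z in Ioo s t ×ˢ Metric.ball x₀ r, ‖H z‖ ^ 2
      ≤ (∫ x in Metric.ball x₀ R, part (u (s, x) - k) ^ 2)
        + γ₂ / (R - r) ^ 2 * (∫ z in Ioo s t ×ˢ Metric.ball x₀ R, part (u z - k) ^ 2)
        + γ₃ * (∫ z in Ioo s t ×ˢ Metric.ball x₀ R, part (u z - k) ^ p) ^ (1 / p)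

/-- The De Giorgi sub-class `DG⁺(γ₁, γ₂, γ₃, p)`. -/
def InDGPlus {d : ℕ} (T₁ T₂ : ℝ) (Ω : Set (Space d)) (γ₁ γ₂ γ₃ p : ℝ)
    (u : ℝ × Space d → ℝ) : Prop :=
  InDG (fun a => max a 0) T₁ T₂ Ω γ₁ γ₂ γ₃ p u

/-- The De Giorgi super-class `DG⁻(γ₁, γ₂, γ₃, p)`. -/
def InDGMinus {d : ℕ} (T₁ T₂ : ℝ) (Ω : Set (Space d)) (γ₁ γ₂ γ₃ p : ℝ)
    (u : ℝ × Space d → ℝ) : Prop :=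
  InDG (fun a => max (-a) 0) T₁ T₂ Ω γ₁ γ₂ γ₃ p u

/-- `v` is the representative of the a.e. class of `u` that is continuous in time on `[T₁, T₂]`,
with values in `L²_loc(Ω)`. -/
structure IsTimeContinuousRep {d : ℕ} (T₁ T₂ : ℝ) (Ω : Set (Space d))
    (u v : ℝ × Space d → ℝ) : Prop where
  ae_eq : v =ᵐ[cylMeasure T₁ T₂ Ω] u
  slice_memLp : ∀ t ∈ Icc T₁ T₂, MemLp (fun x => v (t, x)) 2 (volume.restrict Ω)
  continuous : ∀ K ⊆ Ω, IsCompact K → ∀ t₀ ∈ Icc T₁ T₂,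
    Tendsto (fun t => eLpNorm (fun x => v (t, x) - v (t₀, x)) 2 (volume.restrict K))
      (𝓝[Icc T₁ T₂] t₀) (𝓝 0)

end ParabolicDG

end

/-! Formally, the inequality for a subsolution is multiplied by `η² (u-k)₊`, with `η` a cutoff
between `B_r` and `B_R`, and integrated over `(s,t)`. Ellipticity gives coercivity, Young's
inequality absorbs the cross term and the drift into the gradient, and Hölder's inequality treats
the source. A cutoff with `|∇η|² ≤ (5/4)(R-r)⁻²` turns the cross term into `5M²/λ`; the drift leaves
`2Λ²/λ`, which is below `Λ² diam(Ω)²/(λ(R-r)²)` because `2R ≤ diam Ω`. This algebra is in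
`flux_le_of_young` and `truncatedFlux_le`, and is integrated in `deGiorgi_energy`.

The test function is not admissible as it stands, so `u` is mollified in space-time. Translates of a
kernel are nonnegative test functions, hence the mollification `U` satisfies `∂ₜU - div P - f ≤ 0`
pointwise, with mollified flux `P` and source `f` (`divForm_comp_sub_left`). This may be multiplied
by `ψ ϕ(U)` for a nonnegative `C¹` function `ϕ` (`energy_identity`). The mollification is removed in
`energy_inequality_profile`, and `ϕ` tends to the truncation in `energy_inequality_truncation`. The
kernels are supported on one side of time zero, so that the mollified inequality is available up to
one end time. The outcome holds for almost all `s < t`, and time-continuity extends it to all of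
them (`energy_inequality_all_times`).

Time-continuity rests on `∂ₜu ∈ L²(H⁻¹)`. By Riesz representation `∂ₜu = a - div b` with `a, b ∈
L²(Q)` (`TimeDerivInL2HMinusOne.exists_repr`). This is an equation, so differences of mollifications
solve it too, and the energy identity for the square makes them Cauchy in `L²(K)` uniformly in time
(`slice_sq_le`, `eventually_slice_sub_le`). The slices of `u` at almost every time are therefore
locally uniformly continuous in time and extend to `[T₁, T₂]` (`exists_continuous_extension`).

Supersolutions follow from `u ↦ -u`. Membership in a De Giorgi class is proved for an arbitrary
time-continuous representative, so a solution has one representative in both classes. -/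

namespace ParabolicDG

/-! ### Mollification of vector-valued `L²` functions -/

section Mollification

open ContinuousLinearMap
open scoped Convolution

set_option linter.unusedSectionVars false

variable {X : Type*} [NormedAddCommGroup X] [NormedSpace ℝ X] [FiniteDimensional ℝ X]
  [MeasurableSpace X] [BorelSpace X] {μ : Measure X} [μ.IsAddHaarMeasure]
  {E : Type*} [NormedAddCommGroup E] [NormedSpace ℝ E] [CompleteSpace E]

/-- The convolution `z ↦ ∫ k(z - y) w(y) dy` of a kernel with a vector-valued function. -/
noncomputable def mollify (μ : Measure X) (k : X → ℝ) (w : X → E) : X → E :=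
  k ⋆[lsmul ℝ ℝ, μ] w

theorem mollify_apply (k : X → ℝ) (w : X → E) (z : X) :
    mollify μ k w z = ∫ y, k (z - y) • w y ∂μ := by
  simp only [mollify, convolution_eq_swap, lsmul_apply]

theorem mollify_apply' (k : X → ℝ) (w : X → E) (z : X) :
    mollify μ k w z = ∫ y, k y • w (z - y) ∂μ := by
  simp only [mollify, convolution_def, lsmul_apply]

/-- Translations act continuously on `L²`; this is that continuity at the identity. -/
theorem tendsto_eLpNorm_translate_sub [SecondCountableTopology X] {w : X → E}
    (hw : MemLp w 2 μ) :
    Tendsto (fun y : X => eLpNorm (fun z => w (z - y) - w z) 2 μ) (𝓝 0) (𝓝 0) := by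
  have h1 : Continuous fun y : X => (DomAddAct.mk (-y)) +ᵥ (hw.toLp w) := by
    have hc : Continuous fun y : X => DomAddAct.mk (-y) :=
      DomAddAct.continuous_mk.comp continuous_neg
    have : ProperSpace X := FiniteDimensional.proper_real X
    have : Fact ((2 : ℝ≥0∞) ≠ ⊤) := ⟨by norm_num⟩
    exact hc.vadd continuous_const
  have h2 := (h1.tendsto 0)
  rw [neg_zero, DomAddAct.mk_zero, zero_vadd, tendsto_iff_edist_tendsto_0] at h2
  refine h2.congr fun y => ?_
  rw [DomAddAct.mk_vadd_toLp, Lp.edist_toLp_toLp]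
  refine eLpNorm_congr_ae (ae_of_all _ fun z => ?_)
  simp [sub_eq_add_neg, add_comm]

/-- The difference is the `k`-weighted average of `w(· - y) - w`, so its `L²` norm is at most the
largest norm among the translations by points of the support. Tonelli's theorem exchanges the
average with the square integral. -/
theorem eLpNorm_mollify_sub_le [SecondCountableTopology X] {k : X → ℝ} {w : X → E}
    (hk : Continuous k)
    (hkc : HasCompactSupport k) (hk0 : ∀ z, 0 ≤ k z) (hk1 : ∫ z, k z ∂μ = 1) (hw : MemLp w 2 μ)
    {ε : ℝ≥0∞} (hε : ∀ y ∈ tsupport k, eLpNorm (fun z => w (z - y) - w z) 2 μ ≤ ε) :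
    eLpNorm (mollify μ k w - w) 2 μ ≤ ε := by
  have hki : Integrable k μ := hk.integrable_of_hasCompactSupport hkc
  have hwl : LocallyIntegrable w μ := hw.locallyIntegrable (by norm_num)
  have hk1' : ∫⁻ y, ‖k y‖ₑ ∂μ = 1 := by
    rw [← ofReal_integral_norm_eq_lintegral_enorm hki]
    simp [Real.norm_of_nonneg (hk0 _), hk1]
  have hsm : AEStronglyMeasurable (fun p : X × X => w (p.1 - p.2) - w p.1) (μ.prod μ) := by
    have h1 : AEStronglyMeasurable (fun p : X × X => w (p.1 - p.2)) (μ.prod μ) :=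
      hw.1.comp_quasiMeasurePreserving (quasiMeasurePreserving_sub μ μ)
    exact h1.sub hw.1.comp_fst
  have hkm : AEMeasurable (fun y => ‖k y‖ₑ) μ := hki.1.enorm
  have pt : ∀ z, ‖(mollify μ k w - w) z‖ₑ ^ (2 : ℝ) ≤
      ∫⁻ y, ‖k y‖ₑ * ‖w (z - y) - w z‖ₑ ^ (2 : ℝ) ∂μ := by
    intro z
    have e1 : (mollify μ k w - w) z = ∫ y, k y • (w (z - y) - w z) ∂μ := by
      have hi : Integrable (fun y => k y • w (z - y)) μ := by
        have := hkc.convolutionExists_left (lsmul ℝ ℝ : ℝ →L[ℝ] E →L[ℝ] E) hk hwl z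
        exact this
      simp only [smul_sub]
      rw [integral_sub hi (hki.smul_const _), integral_smul_const, hk1, one_smul,
        Pi.sub_apply, mollify_apply']
    have e2 : ‖(mollify μ k w - w) z‖ₑ ≤ ∫⁻ y, ‖k y‖ₑ * ‖w (z - y) - w z‖ₑ ∂μ := by
      rw [e1]
      refine (enorm_integral_le_lintegral_enorm _).trans_eq ?_
      simp_rw [enorm_smul]
    have hm : AEMeasurable (fun y => ‖w (z - y) - w z‖ₑ) μ := by
      have h1 : AEStronglyMeasurable (fun y : X => w (z - y)) μ :=
        hw.1.comp_quasiMeasurePreserving (quasiMeasurePreserving_sub_left μ z)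
      exact (h1.sub aestronglyMeasurable_const).enorm
    -- Cauchy–Schwarz with `k = k^{1/2} k^{1/2}`: since `k` has mass one, the squared mean is at
    -- most the mean of squares.
    have e3 : ∫⁻ y, ‖k y‖ₑ * ‖w (z - y) - w z‖ₑ ∂μ ≤
        (∫⁻ y, ‖k y‖ₑ * ‖w (z - y) - w z‖ₑ ^ (2 : ℝ) ∂μ) ^ (1 / 2 : ℝ) := by
      have key := ENNReal.lintegral_mul_le_Lp_mul_Lq μ Real.HolderConjugate.two_two
        (hkm.pow_const (1 / 2 : ℝ)) ((hkm.pow_const (1 / 2 : ℝ)).mul hm)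
      have h2 : ∀ a : ℝ≥0∞, (a ^ (1 / 2 : ℝ)) ^ (2 : ℝ) = a := fun a => by
        rw [← ENNReal.rpow_mul]; norm_num
      have h3 : ∀ a : ℝ≥0∞, a ^ (1 / 2 : ℝ) * a ^ (1 / 2 : ℝ) = a := fun a => by
        rw [← ENNReal.rpow_add_of_nonneg _ _ (by norm_num) (by norm_num)]; norm_num
      simp only [Pi.mul_apply, ← mul_assoc, h3,
        ENNReal.mul_rpow_of_nonneg _ _ (zero_le_two : (0 : ℝ) ≤ 2), h2] at key
      rw [hk1', ENNReal.one_rpow, one_mul] at key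
      exact key
    calc ‖(mollify μ k w - w) z‖ₑ ^ (2 : ℝ)
        ≤ ((∫⁻ y, ‖k y‖ₑ * ‖w (z - y) - w z‖ₑ ^ (2 : ℝ) ∂μ) ^ (1 / 2 : ℝ)) ^ (2 : ℝ) :=
          ENNReal.rpow_le_rpow (e2.trans e3) zero_le_two
      _ = _ := by rw [← ENNReal.rpow_mul]; norm_num
  rw [eLpNorm_eq_lintegral_rpow_enorm_toReal (by norm_num) (by norm_num)]
  simp only [ENNReal.toReal_ofNat]
  have hb : ∫⁻ z, ‖(mollify μ k w - w) z‖ₑ ^ (2 : ℝ) ∂μ ≤ ε ^ (2 : ℝ) := by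
    calc ∫⁻ z, ‖(mollify μ k w - w) z‖ₑ ^ (2 : ℝ) ∂μ
        ≤ ∫⁻ z, ∫⁻ y, ‖k y‖ₑ * ‖w (z - y) - w z‖ₑ ^ (2 : ℝ) ∂μ ∂μ := lintegral_mono pt
      _ = ∫⁻ y, ∫⁻ z, ‖k y‖ₑ * ‖w (z - y) - w z‖ₑ ^ (2 : ℝ) ∂μ ∂μ := by
          refine lintegral_lintegral_swap ?_
          exact (hkm.comp_snd).mul (hsm.enorm.pow_const _)
      _ ≤ ∫⁻ y, ‖k y‖ₑ * ε ^ (2 : ℝ) ∂μ := by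
          refine lintegral_mono fun y => ?_
          rw [lintegral_const_mul' _ _ enorm_ne_top]
          by_cases hy : y ∈ tsupport k
          · gcongr
            have := hε y hy
            rw [eLpNorm_eq_lintegral_rpow_enorm_toReal (by norm_num) (by norm_num)] at this
            simp only [ENNReal.toReal_ofNat] at this
            calc _ = ((∫⁻ z, ‖w (z - y) - w z‖ₑ ^ (2 : ℝ) ∂μ) ^ (1 / 2 : ℝ)) ^ (2 : ℝ) := by
                  rw [← ENNReal.rpow_mul]; norm_num
              _ ≤ _ := ENNReal.rpow_le_rpow this zero_le_two
          · simp [image_eq_zero_of_notMem_tsupport hy]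
      _ = ε ^ (2 : ℝ) := by
          rw [lintegral_mul_const'' _ hkm, hk1', one_mul]
  calc _ ≤ (ε ^ (2 : ℝ)) ^ (1 / 2 : ℝ) := ENNReal.rpow_le_rpow hb (by norm_num)
    _ = ε := by rw [← ENNReal.rpow_mul]; norm_num

theorem tendsto_eLpNorm_mollify_sub [SecondCountableTopology X] {k : ℕ → X → ℝ} {w : X → E}
    (hk : ∀ n, Continuous (k n))
    (hkc : ∀ n, HasCompactSupport (k n)) (hk0 : ∀ n z, 0 ≤ k n z) (hk1 : ∀ n, ∫ z, k n z ∂μ = 1)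
    (hks : ∀ ε > 0, ∀ᶠ n in atTop, tsupport (k n) ⊆ Metric.ball 0 ε) (hw : MemLp w 2 μ) :
    Tendsto (fun n => eLpNorm (mollify μ (k n) w - w) 2 μ) atTop (𝓝 0) := by
  rw [ENNReal.tendsto_nhds_zero]
  intro ε hε
  have h1 := (ENNReal.tendsto_nhds_zero.1 (tendsto_eLpNorm_translate_sub hw)) ε hε
  obtain ⟨δ, hδ, h2⟩ := Metric.eventually_nhds_iff_ball.1 h1
  filter_upwards [hks δ hδ] with n hn
  exact eLpNorm_mollify_sub_le (hk n) (hkc n) (hk0 n) (hk1 n) hw fun y hy => h2 y (hn hy)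

theorem contDiff_mollify {k : X → ℝ} {w : X → E} (hk : ContDiff ℝ ∞ k)
    (hkc : HasCompactSupport k) (hw : LocallyIntegrable w μ) : ContDiff ℝ ∞ (mollify μ k w) :=
  hkc.contDiff_convolution_left _ (n := ⊤) hk hw

theorem fderiv_mollify {k : X → ℝ} {w : X → E} (hk : ContDiff ℝ ∞ k)
    (hkc : HasCompactSupport k) (hw : LocallyIntegrable w μ) (z v : X) :
    fderiv ℝ (mollify μ k w) z v = ∫ y, fderiv ℝ k (z - y) v • w y ∂μ := by
  have h := hkc.hasFDerivAt_convolution_left (lsmul ℝ ℝ : ℝ →L[ℝ] E →L[ℝ] E)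
    (hk.of_le (by simp)) hw z (μ := μ)
  have h' : fderiv ℝ (mollify μ k w) z = _ := h.fderiv
  rw [h', convolution_eq_swap]
  have hi : Integrable (fun y => ((lsmul ℝ ℝ : ℝ →L[ℝ] E →L[ℝ] E).precompL X)
      (fderiv ℝ k (z - y)) (w y)) μ := by
    have := (hkc.fderiv ℝ).convolutionExists_left ((lsmul ℝ ℝ : ℝ →L[ℝ] E →L[ℝ] E).precompL X)
      (hk.continuous_fderiv (by simp)) hw z
    exact this.integrable_swap
  rw [ContinuousLinearMap.integral_apply hi]
  simp [precompL_apply]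

/-- Makes a difference of two mollifications a single mollification by a signed kernel, to which the
results for one kernel apply. -/
theorem mollify_sub_left {k l : X → ℝ} {w : X → E} (hk : Continuous k) (hl : Continuous l)
    (hkc : HasCompactSupport k) (hlc : HasCompactSupport l) (hw : LocallyIntegrable w μ) (z : X) :
    mollify μ (k - l) w z = mollify μ k w z - mollify μ l w z := by
  have hi : ∀ {k : X → ℝ}, Continuous k → HasCompactSupport k →
      Integrable (fun y => k y • w (z - y)) μ := fun {k} hk hkc =>
    hkc.convolutionExists_left (lsmul ℝ ℝ : ℝ →L[ℝ] E →L[ℝ] E) hk hw z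
  simp only [mollify_apply', Pi.sub_apply, sub_smul]
  exact integral_sub (hi hk hkc) (hi hl hlc)

end Mollification

/-! ### Mollified weak equations and kernels shifted in time -/

section Kernels

variable {d : ℕ}

instance isAddHaarMeasure_volume_prod :
    (volume : Measure (ℝ × Space d)).IsAddHaarMeasure :=
  Measure.prod.instIsAddHaarMeasure (volume : Measure ℝ) (volume : Measure (Space d))

theorem fderiv_time_slice {φ : ℝ × Space d → ℝ} {z : ℝ × Space d}
    (h : DifferentiableAt ℝ φ z) : timeDeriv φ z = fderiv ℝ φ z (1, 0) := by
  have h1 : HasDerivAt (fun t : ℝ => (t, z.2)) ((1 : ℝ), (0 : Space d)) z.1 :=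
    (hasDerivAt_id z.1).prodMk (hasDerivAt_const z.1 z.2)
  exact (h.hasFDerivAt.comp_hasDerivAt z.1 h1).deriv

theorem hasFDerivAt_space_slice {E : Type*} [NormedAddCommGroup E] [NormedSpace ℝ E]
    {φ : ℝ × Space d → E} {z : ℝ × Space d} (h : DifferentiableAt ℝ φ z) :
    HasFDerivAt (fun x => φ (z.1, x))
      ((fderiv ℝ φ z).comp (ContinuousLinearMap.inr ℝ ℝ (Space d))) z.2 := by
  have h1 : HasFDerivAt (fun x : Space d => (z.1, x)) (ContinuousLinearMap.inr ℝ ℝ (Space d))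
      z.2 :=
    (hasFDerivAt_const z.1 z.2).prodMk (hasFDerivAt_id z.2)
  exact h.hasFDerivAt.comp z.2 h1

theorem inner_spaceGrad {φ : ℝ × Space d → ℝ} {z : ℝ × Space d}
    (h : DifferentiableAt ℝ φ z) (v : Space d) : ⟪spaceGrad φ z, v⟫ = fderiv ℝ φ z (0, v) := by
  rw [spaceGrad, gradient, InnerProductSpace.toDual_symm_apply,
    (hasFDerivAt_space_slice h).fderiv]
  rfl

theorem inner_gradient {φ : Space d → ℝ} {x : Space d} (v : Space d) :
    ⟪gradient φ x, v⟫ = fderiv ℝ φ x v := by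
  rw [gradient, InnerProductSpace.toDual_symm_apply]

/-- The spatial divergence of a vector field on space-time. -/
noncomputable def spaceDiv (P : ℝ × Space d → Space d) (z : ℝ × Space d) : ℝ :=
  ∑ i, fderiv ℝ P z (0, EuclideanSpace.single i 1) i

/-- The distribution `∂ₜu - ∇·F - f` evaluated at `φ`. -/
noncomputable def divForm (u : ℝ × Space d → ℝ) (F : ℝ × Space d → Space d)
    (f φ : ℝ × Space d → ℝ) : ℝ :=
  -(∫ z, u z * timeDeriv φ z) + (∫ z, ⟪F z, spaceGrad φ z⟫) - ∫ z, f z * φ z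

theorem fderiv_comp_sub_left {k : ℝ × Space d → ℝ} (hk : ContDiff ℝ ∞ k) (z y v : ℝ × Space d) :
    fderiv ℝ (fun y => k (z - y)) y v = -(fderiv ℝ k (z - y) v) := by
  have h : HasFDerivAt (fun y => k (z - y)) ((fderiv ℝ k (z - y)).comp
      (-(ContinuousLinearMap.id ℝ (ℝ × Space d)))) y := by
    have h2 : HasFDerivAt (fun y : ℝ × Space d => z - y)
      (-(ContinuousLinearMap.id ℝ (ℝ × Space d))) y := (hasFDerivAt_id y).const_sub z
    exact ((hk.differentiable (by simp)) (z - y)).hasFDerivAt.comp y h2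
  rw [h.fderiv]
  simp

theorem continuous_fderiv_apply_sub {k : ℝ × Space d → ℝ} (hk : ContDiff ℝ ∞ k)
    (z v : ℝ × Space d) : Continuous fun y => fderiv ℝ k (z - y) v := by
  have h := hk.continuous_fderiv (by simp)
  fun_prop

theorem hasCompactSupport_comp_sub_left {E : Type*} [Zero E] [TopologicalSpace E]
    {k : ℝ × Space d → E} (hkc : HasCompactSupport k) (z : ℝ × Space d) :
    HasCompactSupport fun y => k (z - y) :=
  hkc.comp_homeomorph (Homeomorph.subLeft z)

theorem integrable_fderiv_smul {E : Type*} [NormedAddCommGroup E] [NormedSpace ℝ E]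
    {k : ℝ × Space d → ℝ} (hk : ContDiff ℝ ∞ k) (hkc : HasCompactSupport k)
    {w : ℝ × Space d → E} (hw : LocallyIntegrable w) (z v : ℝ × Space d) :
    Integrable fun y => fderiv ℝ k (z - y) v • w y := by
  refine hw.integrable_smul_left_of_hasCompactSupport (continuous_fderiv_apply_sub hk z v) ?_
  exact hasCompactSupport_comp_sub_left (hkc.fderiv_apply ℝ v) z

/-- Differentiation falls on the kernel, and the weak gradient identity is needed for the one test
function `y ↦ k(z - y)` only. The conclusion therefore holds at every `z` whose translated kernel
lives inside the cylinder. -/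
theorem spaceGrad_mollify {k : ℝ × Space d → ℝ} (hk : ContDiff ℝ ∞ k) (hkc : HasCompactSupport k)
    {u : ℝ × Space d → ℝ} {G : ℝ × Space d → Space d} (hu : LocallyIntegrable u)
    {z : ℝ × Space d}
    (h : ∫ y, u y • spaceGrad (fun y => k (z - y)) y = -∫ y, k (z - y) • G y) :
    spaceGrad (mollify volume k u) z = mollify volume k G z := by
  have hks : ContDiff ℝ ∞ fun y => k (z - y) := hk.comp (by fun_prop)
  refine ext_inner_right ℝ fun v => ?_
  rw [inner_spaceGrad ((contDiff_mollify hk hkc hu).differentiable (by simp) z),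
    fderiv_mollify hk hkc hu, mollify_apply, ← neg_eq_iff_eq_neg.2 h, inner_neg_left]
  have h1 : ∀ y, fderiv ℝ k (z - y) (0, v) • u y =
      -⟪u y • spaceGrad (fun y => k (z - y)) y, v⟫ := fun y => by
    rw [inner_smul_left, inner_spaceGrad (hks.differentiable (by simp) y),
      fderiv_comp_sub_left hk]
    simp [mul_comm]
  simp_rw [h1, integral_neg, real_inner_comm v]
  rw [integral_inner]
  have h2 : Continuous fun y => spaceGrad (fun y => k (z - y)) y := by
    have h3 : (fun y => spaceGrad (fun y => k (z - y)) y) = fun y =>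
        (InnerProductSpace.toDual ℝ (Space d)).symm
          ((fderiv ℝ (fun y => k (z - y)) y).comp (ContinuousLinearMap.inr ℝ ℝ (Space d))) := by
      funext y
      rw [spaceGrad, gradient, (hasFDerivAt_space_slice (hks.differentiable (by simp) y)).fderiv]
    rw [h3]
    have := hks.continuous_fderiv (by simp)
    fun_prop
  refine hu.integrable_smul_right_of_hasCompactSupport h2 ?_
  have h4 : HasCompactSupport (fderiv ℝ fun y => k (z - y)) :=
    (hasCompactSupport_comp_sub_left hkc z).fderiv ℝ
  refine h4.mono' fun y hy => subset_tsupport _ ?_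
  contrapose! hy
  simp only [Function.mem_support, not_not] at hy ⊢
  refine ext_inner_right ℝ fun v => ?_
  rw [inner_spaceGrad (hks.differentiable (by simp) y), hy]
  simp

/-- Testing the distribution with a translated kernel evaluates the classical expression of the
mollified functions at `z`. Weak equations and inequalities thereby become pointwise ones. -/
theorem divForm_comp_sub_left {k : ℝ × Space d → ℝ} (hk : ContDiff ℝ ∞ k)
    (hkc : HasCompactSupport k) {u f : ℝ × Space d → ℝ} {F : ℝ × Space d → Space d}
    (hu : LocallyIntegrable u) (hF : LocallyIntegrable F) (z : ℝ × Space d) :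
    divForm u F f (fun y => k (z - y)) = timeDeriv (mollify volume k u) z -
      spaceDiv (mollify volume k F) z - mollify volume k f z := by
  have hks : ContDiff ℝ ∞ fun y => k (z - y) := hk.comp (by fun_prop)
  have e1 : -(∫ y, u y * timeDeriv (fun y => k (z - y)) y) =
      timeDeriv (mollify volume k u) z := by
    rw [fderiv_time_slice ((contDiff_mollify hk hkc hu).differentiable (by simp) z),
      fderiv_mollify hk hkc hu, ← integral_neg]
    refine integral_congr_ae (ae_of_all _ fun y => ?_)
    simp only
    rw [fderiv_time_slice (hks.differentiable (by simp) y), fderiv_comp_sub_left hk]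
    simp [mul_comm]
  have e2 : ∫ y, ⟪F y, spaceGrad (fun y => k (z - y)) y⟫ =
      -spaceDiv (mollify volume k F) z := by
    have hi : ∀ i : Fin d, Integrable
        fun y => fderiv ℝ k (z - y) (0, EuclideanSpace.single i 1) • F y := fun i =>
      integrable_fderiv_smul hk hkc hF z _
    rw [spaceDiv, ← Finset.sum_neg_distrib]
    have e3 : ∀ i : Fin d, -((fderiv ℝ (mollify volume k F) z (0, EuclideanSpace.single i 1)) i) =
        ∫ y, -(fderiv ℝ k (z - y) (0, EuclideanSpace.single i 1) * F y i) := fun i => by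
      rw [fderiv_mollify hk hkc hF, integral_neg]
      exact congrArg Neg.neg
        ((EuclideanSpace.proj i : Space d →L[ℝ] ℝ).integral_comp_comm (hi i)).symm
    simp_rw [e3]
    rw [← integral_finsetSum]
    · refine integral_congr_ae (ae_of_all _ fun y => ?_)
      simp only
      rw [real_inner_comm, ← Finset.sum_congr rfl fun i _ => ?_, PiLp.inner_apply]
      have h5 := inner_spaceGrad (hks.differentiable (by simp) y) (EuclideanSpace.single i 1)
      rw [fderiv_comp_sub_left hk] at h5
      rw [← neg_mul, ← h5, EuclideanSpace.inner_single_right]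
      simp [mul_comm]
    · intro i _
      exact ((EuclideanSpace.proj i : Space d →L[ℝ] ℝ).integrable_comp (hi i)).neg
  have e3 : ∫ y, f y * k (z - y) = mollify volume k f z := by
    rw [mollify_apply]
    simp [mul_comm]
  rw [divForm, e1, e2, e3]
  ring

/-- A sequence of mollification kernels that concentrates at the origin and whose supports lie on
one side, selected by the sign of `σ`, of the time `0`. -/
structure IsTimeShiftedMollifier (σ : ℝ) (k : ℕ → ℝ × Space d → ℝ) : Prop where
  smooth : ∀ n, ContDiff ℝ ∞ (k n)
  compact : ∀ n, HasCompactSupport (k n)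
  nonneg : ∀ n z, 0 ≤ k n z
  integral_eq_one : ∀ n, ∫ z, k n z = 1
  shift : ∀ n, ∀ z ∈ tsupport (k n), 0 < σ * z.1
  shrink : ∀ ε > 0, ∀ᶠ n in atTop, tsupport (k n) ⊆ Metric.ball 0 ε

theorem IsTimeShiftedMollifier.comp {σ : ℝ} {k : ℕ → ℝ × Space d → ℝ}
    (h : IsTimeShiftedMollifier σ k) {s : ℕ → ℕ} (hs : Tendsto s atTop atTop) :
    IsTimeShiftedMollifier σ (k ∘ s) :=
  ⟨fun _ => h.smooth _, fun _ => h.compact _, fun _ => h.nonneg _, fun _ => h.integral_eq_one _,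
    fun _ => h.shift _, fun ε hε => hs.eventually (h.shrink ε hε)⟩

theorem exists_isTimeShiftedMollifier {σ : ℝ} (hσ : |σ| = 1) :
    ∃ k : ℕ → ℝ × Space d → ℝ, IsTimeShiftedMollifier σ k := by
  have hσ2 : σ * σ = 1 := by rw [← abs_mul_abs_self, hσ, one_mul]
  let ρ : ℕ → ℝ := fun n => 1 / ((n : ℝ) + 1)
  have hρ : ∀ n, 0 < ρ n := fun n => Nat.one_div_pos_of_nat
  let b : ∀ n, ContDiffBump (0 : ℝ × Space d) := fun n =>
    ⟨ρ n / 2, ρ n, half_pos (hρ n), half_lt_self (hρ n)⟩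
  -- A bump of radius `ρ` centred at time `2σρ` has `σ t ≥ ρ > 0` on its support, which stays within
  -- `3ρ` of the origin.
  let c : ℕ → ℝ × Space d := fun n => (2 * σ * ρ n, 0)
  have hsupp : ∀ n, ∀ z ∈ tsupport (fun z => (b n).normed volume (z - c n)),
      ‖z - c n‖ ≤ ρ n := by
    intro n z hz
    have hcl : IsClosed {z | ‖z - c n‖ ≤ ρ n} := isClosed_le (by fun_prop) continuous_const
    refine closure_minimal (fun y hy => ?_) hcl hz
    have h1 : y - c n ∈ Function.support ((b n).normed volume) := hy
    rw [ContDiffBump.support_normed_eq] at h1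
    exact (mem_ball_zero_iff.1 h1).le
  refine ⟨fun n z => (b n).normed volume (z - c n), fun n => ?_, fun n => ?_, fun n z => ?_,
    fun n => ?_, fun n z hz => ?_, fun ε hε => ?_⟩
  · exact (b n).contDiff_normed.comp (by fun_prop)
  · exact (b n).hasCompactSupport_normed.comp_homeomorph (Homeomorph.subRight (c n))
  · exact (b n).nonneg_normed _
  · rw [integral_sub_right_eq_self (fun z => (b n).normed volume z) (c n)]
    exact (b n).integral_normed
  · have h1 := (norm_fst_le _).trans (hsupp n z hz)
    have h2 : |z.1 - 2 * σ * ρ n| ≤ ρ n := h1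
    have h3 : |σ * (z.1 - 2 * σ * ρ n)| ≤ ρ n := by rwa [abs_mul, hσ, one_mul]
    have h4 := (abs_le.1 h3).1
    have h5 : σ * (z.1 - 2 * σ * ρ n) = σ * z.1 - 2 * ρ n := by linear_combination -2 * ρ n * hσ2
    linarith [hρ n]
  · have ht : Tendsto (fun n => 3 * ρ n) atTop (𝓝 0) := by
      simpa [ρ] using (tendsto_one_div_add_atTop_nhds_zero_nat (𝕜 := ℝ)).const_mul (3 : ℝ)
    filter_upwards [ht.eventually_lt_const hε] with n hn z hz
    rw [mem_ball_zero_iff]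
    have hc : ‖c n‖ = 2 * ρ n := by
      simp [c, Prod.norm_def, hσ, abs_of_pos (hρ n), (hρ n).le]
    calc ‖z‖ = ‖(z - c n) + c n‖ := by rw [sub_add_cancel]
      _ ≤ ‖z - c n‖ + ‖c n‖ := norm_add_le _ _
      _ ≤ ρ n + 2 * ρ n := by rw [hc]; gcongr; exact hsupp n z hz
      _ < ε := by linarith

/-- For `σ = -1` the mollification at time `t` reads only later times, for `σ = 1` only earlier
ones. Hence `[α, β]` may reach `T₁` in the first case and `T₂` in the second; a gap is needed at the
other end only. -/
theorem IsTimeShiftedMollifier.eventually_isTestFunction {σ : ℝ} {k : ℕ → ℝ × Space d → ℝ}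
    (h : IsTimeShiftedMollifier σ k) {T₁ T₂ α β : ℝ} {Ω K : Set (Space d)} (hΩ : IsOpen Ω)
    (hK : IsCompact K) (hKΩ : K ⊆ Ω) (hα : T₁ ≤ α) (hβ : β ≤ T₂)
    (hσ : (σ = -1 ∧ β < T₂) ∨ (σ = 1 ∧ T₁ < α)) :
    ∀ᶠ n in atTop, ∀ t ∈ Icc α β, ∀ x ∈ K,
      IsTestFunction (cylinder T₁ T₂ Ω) fun y => k n ((t, x) - y) := by
  obtain ⟨δ, hδ, hδK⟩ := hK.exists_thickening_subset_open hΩ hKΩ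
  obtain ⟨ε, hε, hεσ⟩ : ∃ ε > 0, (σ = -1 ∧ β + ε ≤ T₂) ∨ (σ = 1 ∧ T₁ + ε ≤ α) := by
    rcases hσ with ⟨h1, h2⟩ | ⟨h1, h2⟩
    · exact ⟨T₂ - β, sub_pos.2 h2, Or.inl ⟨h1, by linarith⟩⟩
    · exact ⟨α - T₁, sub_pos.2 h2, Or.inr ⟨h1, by linarith⟩⟩
  filter_upwards [h.shrink (min δ ε) (lt_min hδ hε)] with n hn t ht x hx
  refine ⟨(h.smooth n).comp (by fun_prop),
    hasCompactSupport_comp_sub_left (h.compact n) (t, x), fun y hy => ?_⟩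
  have hy' : (t, x) - y ∈ tsupport (k n) :=
    closure_minimal (t := (fun y => (t, x) - y) ⁻¹' tsupport (k n))
      (fun y hy => subset_tsupport _ hy)
      ((isClosed_tsupport _).preimage (by fun_prop)) hy
  have h1 := mem_ball_zero_iff.1 (hn hy')
  have h2 := h.shift n _ hy'
  have h3 : |t - y.1| < ε :=
    ((norm_fst_le ((t, x) - y)).trans_lt h1).trans_le (min_le_right _ _)
  have h4 : ‖x - y.2‖ < δ :=
    ((norm_snd_le ((t, x) - y)).trans_lt h1).trans_le (min_le_left _ _)
  have h5 := abs_lt.1 h3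
  simp only [Prod.fst_sub] at h2
  refine ⟨?_, hδK ?_⟩
  · rcases hεσ with ⟨h6, h7⟩ | ⟨h6, h7⟩
    · subst h6
      exact ⟨by linarith [ht.1], by linarith [ht.2]⟩
    · subst h6
      exact ⟨by linarith [ht.1], by linarith [ht.2]⟩
  · rw [Metric.mem_thickening_iff]
    exact ⟨x, hx, by rwa [dist_comm, dist_eq_norm]⟩

end Kernels

/-! ### Energy identity for smooth functions -/

section EnergyIdentity

variable {d : ℕ}

/-- The space-time slab `(s, t) × ℝ^d`. -/
abbrev slab (d : ℕ) (s t : ℝ) : Set (ℝ × Space d) := Ioo s t ×ˢ univ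

theorem restrict_slab (s t : ℝ) : (volume : Measure (ℝ × Space d)).restrict (slab d s t) =
    ((volume : Measure ℝ).restrict (Ioo s t)).prod volume := by
  rw [slab, Measure.volume_eq_prod, ← Measure.prod_restrict, Measure.restrict_univ]

/-- `Φ` is of class `C²` with `Φ' = ϕ`, `Φ'' = χ` and `|χ| ≤ 1`. -/
structure IsC2Profile (Φ ϕ χ : ℝ → ℝ) : Prop where
  hasDerivAt : ∀ a, HasDerivAt Φ (ϕ a) a
  hasDerivAt_deriv : ∀ a, HasDerivAt ϕ (χ a) a
  continuous_deriv2 : Continuous χ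
  bound : ∀ a, |χ a| ≤ 1

theorem IsC2Profile.continuous_deriv {Φ ϕ χ : ℝ → ℝ} (h : IsC2Profile Φ ϕ χ) : Continuous ϕ :=
  continuous_iff_continuousAt.2 fun a => (h.hasDerivAt_deriv a).continuousAt

theorem IsC2Profile.continuous {Φ ϕ χ : ℝ → ℝ} (h : IsC2Profile Φ ϕ χ) : Continuous Φ :=
  continuous_iff_continuousAt.2 fun a => (h.hasDerivAt a).continuousAt

theorem IsC2Profile.contDiff_deriv {Φ ϕ χ : ℝ → ℝ} (h : IsC2Profile Φ ϕ χ) : ContDiff ℝ 1 ϕ := by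
  rw [contDiff_one_iff_deriv]
  refine ⟨fun a => (h.hasDerivAt_deriv a).differentiableAt, ?_⟩
  have : deriv ϕ = χ := funext fun a => (h.hasDerivAt_deriv a).deriv
  rw [this]
  exact h.continuous_deriv2

theorem integrableOn_slab {E : Type*} [NormedAddCommGroup E] {h : ℝ × Space d → E}
    (hc : Continuous h) {K : Set (Space d)} (hK : IsCompact K) (h0 : ∀ z, z.2 ∉ K → h z = 0)
    (s t : ℝ) : IntegrableOn h (slab d s t) := by
  have h1 : IntegrableOn h (Icc s t ×ˢ K) :=
    hc.continuousOn.integrableOn_compact (isCompact_Icc.prod hK)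
  have h2 : IntegrableOn h (Icc s t ×ˢ univ) := by
    refine h1.of_forall_sdiff_eq_zero (measurableSet_Icc.prod .univ) fun z hz => h0 z fun hzK => ?_
    exact hz.2 ⟨hz.1.1, hzK⟩
  exact h2.mono_set (prod_mono Ioo_subset_Icc_self subset_rfl)

theorem continuous_timeDeriv {U : ℝ × Space d → ℝ} (hU : ContDiff ℝ 1 U) :
    Continuous (timeDeriv U) := by
  have : timeDeriv U = fun z => fderiv ℝ U z (1, 0) :=
    funext fun z => fderiv_time_slice (hU.differentiable (by simp) z)
  rw [this]
  have := hU.continuous_fderiv (by simp)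
  fun_prop

theorem continuous_spaceGrad {U : ℝ × Space d → ℝ} (hU : ContDiff ℝ 1 U) :
    Continuous (spaceGrad U) := by
  have : spaceGrad U = fun z => (InnerProductSpace.toDual ℝ (Space d)).symm
      ((fderiv ℝ U z).comp (ContinuousLinearMap.inr ℝ ℝ (Space d))) := by
    funext z
    rw [spaceGrad, gradient, (hasFDerivAt_space_slice (hU.differentiable (by simp) z)).fderiv]
  rw [this]
  have := hU.continuous_fderiv (by simp)
  fun_prop

theorem continuous_spaceDiv {P : ℝ × Space d → Space d} (hP : ContDiff ℝ 1 P) :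
    Continuous (spaceDiv P) := by
  have := hP.continuous_fderiv (by simp)
  unfold spaceDiv
  fun_prop

/-- Fundamental theorem of calculus in time at each fixed `x`, combined with Fubini. -/
theorem integral_slice_sub {Φ ϕ χ : ℝ → ℝ} (h : IsC2Profile Φ ϕ χ) {U : ℝ × Space d → ℝ}
    (hU : ContDiff ℝ 1 U) {ψ : Space d → ℝ} (hψ : Continuous ψ) (hψc : HasCompactSupport ψ)
    {s t : ℝ} (hst : s ≤ t) :
    (∫ x, ψ x * Φ (U (t, x))) - ∫ x, ψ x * Φ (U (s, x)) =
      ∫ z in slab d s t, ψ z.2 * ϕ (U z) * timeDeriv U z := by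
  have hUc := hU.continuous
  have hΦ := h.continuous
  have hϕ := h.continuous_deriv
  have hUt := continuous_timeDeriv hU
  have hi : IntegrableOn (fun z : ℝ × Space d => ψ z.2 * ϕ (U z) * timeDeriv U z)
      (slab d s t) :=
    integrableOn_slab (by fun_prop) hψc.isCompact
      (fun z hz => by simp [image_eq_zero_of_notMem_tsupport hz]) s t
  have hi2 : ∀ τ, Integrable fun x => ψ x * Φ (U (τ, x)) := fun τ =>
    Continuous.integrable_of_hasCompactSupport (by fun_prop) hψc.mul_right
  rw [IntegrableOn, restrict_slab] at hi
  rw [← integral_sub (hi2 t) (hi2 s), restrict_slab, integral_prod_symm _ hi]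
  refine integral_congr_ae (ae_of_all _ fun x => ?_)
  simp only
  rw [← integral_Ioc_eq_integral_Ioo, ← intervalIntegral.integral_of_le hst,
    intervalIntegral.integral_eq_sub_of_hasDerivAt (f := fun τ => ψ x * Φ (U (τ, x)))]
  · intro τ _
    have h1 : HasDerivAt (fun τ => U (τ, x)) (timeDeriv U (τ, x)) τ := by
      have h2 : DifferentiableAt ℝ (fun τ => U (τ, x)) τ :=
        (hU.comp (contDiff_id.prodMk contDiff_const)).differentiable (by simp) τ
      exact h2.hasDerivAt
    have h3 := ((h.hasDerivAt (U (τ, x))).comp τ h1).const_mul (ψ x)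
    simpa [mul_assoc] using h3
  · exact (Continuous.intervalIntegrable (by fun_prop) _ _)

/-- Integration by parts in each coordinate; `h` vanishes off a compact set, so there is no boundary
term. -/
theorem integral_slice_mul_spaceDiv {h : ℝ × Space d → ℝ} (hh : ContDiff ℝ 1 h)
    {P : ℝ × Space d → Space d} (hP : ContDiff ℝ 1 P) {K : Set (Space d)} (hK : IsCompact K)
    (h0 : ∀ z, z.2 ∉ K → h z = 0) (τ : ℝ) :
    ∫ x, h (τ, x) * spaceDiv P (τ, x) = -∫ x, ⟪P (τ, x), spaceGrad h (τ, x)⟫ := by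
  have hhc := hh.continuous
  have hPc := hP.continuous
  have hh' := hh.continuous_fderiv (by simp)
  have hP' := hP.continuous_fderiv (by simp)
  have hz : ∀ x ∉ K, ∀ v, fderiv ℝ h (τ, x) (0, v) = 0 := by
    intro x hx v
    have h1 := hasFDerivAt_space_slice (hh.differentiable (by simp) (τ, x))
    have h2 : (fun y => h (τ, y)) =ᶠ[𝓝 x] fun _ => 0 := by
      filter_upwards [hK.isClosed.isOpen_compl.mem_nhds hx] with y hy using h0 _ hy
    have h3 := h1.unique ((hasFDerivAt_const (0 : ℝ) x).congr_of_eventuallyEq h2)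
    exact congrArg (fun L : Space d →L[ℝ] ℝ => L v) h3
  have hint : ∀ {f : Space d → ℝ}, Continuous f → (∀ x ∉ K, f x = 0) → Integrable f :=
    fun hf h0 => hf.integrable_of_hasCompactSupport (HasCompactSupport.intro hK h0)
  have key : ∀ i : Fin d,
      ∫ x, h (τ, x) * (fderiv ℝ P (τ, x) (0, EuclideanSpace.single i 1)) i =
        -∫ x, fderiv ℝ h (τ, x) (0, EuclideanSpace.single i 1) * P (τ, x) i := by
    intro i
    refine integral_bilinear_hasFDerivAt_right_eq_neg_left_of_integrable
      (B := ContinuousLinearMap.mul ℝ ℝ) (v := EuclideanSpace.single i (1 : ℝ))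
      (f := fun x => h (τ, x)) (g := fun x => P (τ, x) i)
      (f' := fun x => (fderiv ℝ h (τ, x)).comp (ContinuousLinearMap.inr ℝ ℝ (Space d)))
      (g' := fun x => (EuclideanSpace.proj i : Space d →L[ℝ] ℝ).comp
        ((fderiv ℝ P (τ, x)).comp (ContinuousLinearMap.inr ℝ ℝ (Space d)))) ?_ ?_ ?_ ?_ ?_
    · exact hint (by simp; fun_prop) fun x hx => by simp [hz x hx]
    · exact hint (by simp; fun_prop) fun x hx => by simp [h0 (τ, x) hx]
    · exact hint (by simp; fun_prop) fun x hx => by simp [h0 (τ, x) hx]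
    · intro x _
      exact hasFDerivAt_space_slice (hh.differentiable (by simp) (τ, x))
    · intro x _
      exact (EuclideanSpace.proj i : Space d →L[ℝ] ℝ).hasFDerivAt.comp x
        (hasFDerivAt_space_slice (hP.differentiable (by simp) (τ, x)))
  have e1 : ∫ x, h (τ, x) * spaceDiv P (τ, x) =
      ∑ i : Fin d, ∫ x, h (τ, x) * (fderiv ℝ P (τ, x) (0, EuclideanSpace.single i 1)) i := by
    simp only [spaceDiv, Finset.mul_sum]
    exact integral_finsetSum _ fun i _ =>
      hint (by fun_prop) fun x hx => by simp [h0 (τ, x) hx]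
  have e2 : ∫ x, ⟪P (τ, x), spaceGrad h (τ, x)⟫ =
      ∑ i : Fin d, ∫ x, fderiv ℝ h (τ, x) (0, EuclideanSpace.single i 1) * P (τ, x) i := by
    rw [← integral_finsetSum _ fun i _ => hint (by fun_prop) fun x hx => by simp [hz x hx]]
    refine integral_congr_ae (ae_of_all _ fun x => ?_)
    simp only [PiLp.inner_apply]
    refine Finset.sum_congr rfl fun i _ => ?_
    rw [← inner_spaceGrad (hh.differentiable (by simp) (τ, x)),
      EuclideanSpace.inner_single_right]
    simp
  rw [e1, e2, Finset.sum_congr rfl fun i _ => key i, Finset.sum_neg_distrib]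

theorem spaceGrad_eq_zero {h : ℝ × Space d → ℝ} {K : Set (Space d)}
    (hK : IsClosed K) (h0 : ∀ z, z.2 ∉ K → h z = 0) {z : ℝ × Space d} (hz : z.2 ∉ K) :
    spaceGrad h z = 0 := by
  have h2 : (fun y => h (z.1, y)) =ᶠ[𝓝 z.2] fun _ => 0 := by
    filter_upwards [hK.isOpen_compl.mem_nhds hz] with y hy using h0 _ hy
  rw [spaceGrad, gradient, h2.fderiv_eq]
  simp

theorem integral_slab_mul_spaceDiv {h : ℝ × Space d → ℝ} (hh : ContDiff ℝ 1 h)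
    {P : ℝ × Space d → Space d} (hP : ContDiff ℝ 1 P) {K : Set (Space d)} (hK : IsCompact K)
    (h0 : ∀ z, z.2 ∉ K → h z = 0) (s t : ℝ) :
    ∫ z in slab d s t, h z * spaceDiv P z = -∫ z in slab d s t, ⟪P z, spaceGrad h z⟫ := by
  have hhc := hh.continuous
  have hPc := hP.continuous
  have h1 := continuous_spaceDiv hP
  have h2 := continuous_spaceGrad hh
  have i1 := integrableOn_slab (h := fun z => h z * spaceDiv P z) (by fun_prop) hK
    (fun z hz => by simp [h0 z hz]) s t
  have i2 := integrableOn_slab (h := fun z => ⟪P z, spaceGrad h z⟫) (by fun_prop) hK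
    (fun z hz => by
      simp [spaceGrad_eq_zero hK.isClosed h0 hz]) s t
  rw [IntegrableOn, restrict_slab] at i1 i2
  rw [restrict_slab, integral_prod _ i1, integral_prod _ i2, ← integral_neg]
  exact integral_congr_ae (ae_of_all _ fun τ => integral_slice_mul_spaceDiv hh hP hK h0 τ)

theorem gradient_add_spaceGrad {ϕ χ : ℝ → ℝ} (hϕ : ∀ a, HasDerivAt ϕ (χ a) a)
    {U : ℝ × Space d → ℝ} (hU : ContDiff ℝ 1 U) {ψ : Space d → ℝ} (hψ : ContDiff ℝ 1 ψ)
    (z : ℝ × Space d) :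
    spaceGrad (fun z => ψ z.2 * ϕ (U z)) z =
      ϕ (U z) • gradient ψ z.2 + (ψ z.2 * χ (U z)) • spaceGrad U z := by
  have hUz := (hU.differentiable (by simp) z)
  have h1 : HasFDerivAt (fun z : ℝ × Space d => ψ z.2)
      ((fderiv ℝ ψ z.2).comp (ContinuousLinearMap.snd ℝ ℝ (Space d))) z :=
    (hψ.differentiable (by simp) z.2).hasFDerivAt.comp z hasFDerivAt_snd
  have h2 := (hϕ (U z)).comp_hasFDerivAt z hUz.hasFDerivAt
  have h3 : HasFDerivAt (fun z : ℝ × Space d => ψ z.2 * ϕ (U z)) _ z := h1.mul h2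
  refine ext_inner_right ℝ fun v => ?_
  rw [inner_spaceGrad h3.differentiableAt, inner_add_left, inner_smul_left, inner_smul_left,
    inner_spaceGrad hUz, inner_gradient, h3.fderiv]
  simp
  ring

/-- Chain rule in time and integration by parts in space, with test function `ψ ϕ(U)`. The residual
of the equation is kept as the last integral: it vanishes in the proof of time-continuity and has a
sign for subsolutions. -/
theorem energy_identity {Φ ϕ χ : ℝ → ℝ} (h : IsC2Profile Φ ϕ χ) {U f : ℝ × Space d → ℝ}
    (hU : ContDiff ℝ 1 U) {P : ℝ × Space d → Space d} (hP : ContDiff ℝ 1 P) (hf : Continuous f)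
    {ψ : Space d → ℝ} (hψ : ContDiff ℝ 1 ψ) (hψc : HasCompactSupport ψ) {s t : ℝ} (hst : s ≤ t) :
    (∫ x, ψ x * Φ (U (t, x))) - ∫ x, ψ x * Φ (U (s, x)) =
      -(∫ z in slab d s t, ⟪P z, ϕ (U z) • gradient ψ z.2⟫)
      - (∫ z in slab d s t, ⟪P z, (ψ z.2 * χ (U z)) • spaceGrad U z⟫)
      + (∫ z in slab d s t, f z * (ψ z.2 * ϕ (U z)))
      + ∫ z in slab d s t, ψ z.2 * ϕ (U z) * (timeDeriv U z - spaceDiv P z - f z) := by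
  have hUc := hU.continuous
  have hPc := hP.continuous
  have hψ0 := hψ.continuous
  have hϕ := h.continuous_deriv
  have hχ := h.continuous_deriv2
  have h1 := continuous_spaceDiv hP
  have h2 := continuous_spaceGrad hU
  have h3 := continuous_timeDeriv hU
  have h4 : Continuous (gradient ψ) :=
    (InnerProductSpace.toDual ℝ (Space d)).symm.continuous.comp (hψ.continuous_fderiv (by simp))
  have hz : ∀ z : ℝ × Space d, z.2 ∉ tsupport ψ → ψ z.2 = 0 := fun z hz =>
    image_eq_zero_of_notMem_tsupport hz
  have hz' : ∀ z : ℝ × Space d, z.2 ∉ tsupport ψ → gradient ψ z.2 = 0 := fun z hz => by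
    rw [gradient, image_eq_zero_of_notMem_tsupport
      (fun hx => hz (tsupport_fderiv_subset ℝ hx)), map_zero]
  have hint : ∀ {g : ℝ × Space d → ℝ}, Continuous g → (∀ z, z.2 ∉ tsupport ψ → g z = 0) →
      IntegrableOn g (slab d s t) := fun hg h0 =>
    integrableOn_slab hg hψc.isCompact h0 s t
  have hh : ContDiff ℝ 1 fun z : ℝ × Space d => ψ z.2 * ϕ (U z) :=
    (hψ.comp contDiff_snd).mul (h.contDiff_deriv.comp hU)
  have ibp := integral_slab_mul_spaceDiv hh hP hψc.isCompact
    (fun z hz => by simp [image_eq_zero_of_notMem_tsupport hz]) s t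
  have e1 : ∫ z in slab d s t, ⟪P z, spaceGrad (fun z => ψ z.2 * ϕ (U z)) z⟫ =
      (∫ z in slab d s t, ⟪P z, ϕ (U z) • gradient ψ z.2⟫) +
        ∫ z in slab d s t, ⟪P z, (ψ z.2 * χ (U z)) • spaceGrad U z⟫ := by
    rw [← integral_add]
    · refine integral_congr_ae (ae_of_all _ fun z => ?_)
      simp only
      rw [gradient_add_spaceGrad h.hasDerivAt_deriv hU hψ, inner_add_right]
    · exact hint (by fun_prop) fun z h => by simp [hz' z h]
    · exact hint (by fun_prop) fun z h => by simp [hz z h]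
  rw [e1] at ibp
  have i1 := hint (g := fun z => ψ z.2 * ϕ (U z) * timeDeriv U z) (by fun_prop)
    fun z h => by simp [hz z h]
  have i2 := hint (g := fun z => ψ z.2 * ϕ (U z) * spaceDiv P z) (by fun_prop)
    fun z h => by simp [hz z h]
  have i3 := hint (g := fun z => f z * (ψ z.2 * ϕ (U z))) (by fun_prop)
    fun z h => by simp [hz z h]
  have e2 : ∫ z in slab d s t, ψ z.2 * ϕ (U z) * (timeDeriv U z - spaceDiv P z - f z) =
      (∫ z in slab d s t, ψ z.2 * ϕ (U z) * timeDeriv U z) -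
      (∫ z in slab d s t, ψ z.2 * ϕ (U z) * spaceDiv P z) -
      ∫ z in slab d s t, f z * (ψ z.2 * ϕ (U z)) := by
    have i12 : IntegrableOn (fun z => ψ z.2 * ϕ (U z) * timeDeriv U z -
      ψ z.2 * ϕ (U z) * spaceDiv P z) (slab d s t) := i1.sub i2
    rw [← integral_sub i1 i2, ← integral_sub i12 i3]
    refine integral_congr_ae (ae_of_all _ fun z => ?_)
    simp only
    ring
  rw [e2, ibp, integral_slice_sub h hU hψ0 hψc hst]
  ring

end EnergyIdentity

/-! ### Passage to the limit in `L²` pairings -/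

section Limits

set_option linter.unusedSectionVars false

variable {α : Type*} [MeasurableSpace α] {μ : Measure α}
  {F : Type*} [NormedAddCommGroup F] [InnerProductSpace ℝ F]

/-- Joint continuity of the inner product of the Hilbert space `L²`. -/
theorem tendsto_integral_inner {a b : ℕ → α → F} {a' b' : α → F} (ha : ∀ n, MemLp (a n) 2 μ)
    (hb : ∀ n, MemLp (b n) 2 μ) (ha' : MemLp a' 2 μ) (hb' : MemLp b' 2 μ)
    (hla : Tendsto (fun n => eLpNorm (a n - a') 2 μ) atTop (𝓝 0))
    (hlb : Tendsto (fun n => eLpNorm (b n - b') 2 μ) atTop (𝓝 0)) :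
    Tendsto (fun n => ∫ x, ⟪a n x, b n x⟫ ∂μ) atTop (𝓝 (∫ x, ⟪a' x, b' x⟫ ∂μ)) := by
  have key : ∀ {p q : α → F} (hp : MemLp p 2 μ) (hq : MemLp q 2 μ),
      ∫ x, ⟪p x, q x⟫ ∂μ = ⟪hp.toLp p, hq.toLp q⟫ := by
    intro p q hp hq
    rw [L2.inner_def]
    refine integral_congr_ae ?_
    filter_upwards [hp.coeFn_toLp, hq.coeFn_toLp] with x h1 h2
    rw [h1, h2]
  have h1 := (Lp.tendsto_Lp_iff_tendsto_eLpNorm'' a ha a' ha').2 hla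
  have h2 := (Lp.tendsto_Lp_iff_tendsto_eLpNorm'' b hb b' hb').2 hlb
  rw [key ha' hb']
  refine (h1.inner h2).congr fun n => (key (ha n) (hb n)).symm

theorem tendsto_eLpNorm_two_of_lintegral {f : ℕ → α → F}
    (h : Tendsto (fun n => ∫⁻ x, ‖f n x‖ₑ ^ (2 : ℝ) ∂μ) atTop (𝓝 0)) :
    Tendsto (fun n => eLpNorm (f n) 2 μ) atTop (𝓝 0) := by
  have h1 : ∀ n, eLpNorm (f n) 2 μ = (∫⁻ x, ‖f n x‖ₑ ^ (2 : ℝ) ∂μ) ^ (1 / 2 : ℝ) := fun n => by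
    rw [eLpNorm_eq_lintegral_rpow_enorm_toReal (by norm_num) (by norm_num)]
    simp
  simp_rw [h1]
  have := (ENNReal.continuous_rpow_const (y := (1 / 2 : ℝ))).tendsto 0 |>.comp h
  simpa [Function.comp_def] using this

theorem lintegral_sq_eq_eLpNorm (f : α → F) :
    ∫⁻ x, ‖f x‖ₑ ^ (2 : ℝ) ∂μ = eLpNorm f 2 μ ^ (2 : ℝ) := by
  rw [eLpNorm_eq_lintegral_rpow_enorm_toReal (by norm_num) (by norm_num), ← ENNReal.rpow_mul]
  simp

theorem tendsto_eLpNorm_of_dominated {f : ℕ → α → F} {g : α → ℝ}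
    (hf : ∀ n, AEStronglyMeasurable (f n) μ) (hg : MemLp g 2 μ)
    (hb : ∀ n, ∀ᵐ x ∂μ, ‖f n x‖ ≤ g x)
    (hl : ∀ᵐ x ∂μ, Tendsto (fun n => f n x) atTop (𝓝 0)) :
    Tendsto (fun n => eLpNorm (f n) 2 μ) atTop (𝓝 0) := by
  refine tendsto_eLpNorm_two_of_lintegral ?_
  have h := tendsto_lintegral_of_dominated_convergence' (μ := μ)
    (F := fun n x => ‖f n x‖ₑ ^ (2 : ℝ)) (f := fun _ => 0) (fun x => ‖g x‖ₑ ^ (2 : ℝ))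
    (fun n => (hf n).enorm.pow_const _) ?_ ?_ ?_
  · simpa using h
  · intro n
    filter_upwards [hb n] with x hx
    refine ENNReal.rpow_le_rpow ?_ zero_le_two
    rw [enorm_le_iff_norm_le]
    exact hx.trans (le_abs_self _)
  · rw [lintegral_sq_eq_eLpNorm]
    exact ENNReal.rpow_ne_top_of_nonneg zero_le_two hg.2.ne
  · filter_upwards [hl] with x hx
    have h1 : Tendsto (fun n => ‖f n x‖ₑ) atTop (𝓝 0) := by simpa using hx.enorm
    simpa [Function.comp_def] using (ENNReal.continuous_rpow_const (y := (2 : ℝ))).tendsto 0 |>.comp h1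

/-- Write `cₙgₙ - c'g' = cₙ(gₙ - g') + (cₙ - c')g'`. The coefficients are bounded and converge only
almost everywhere, so the second term is handled by dominated convergence with the fixed function
`g'`. -/
theorem tendsto_eLpNorm_smul {c : ℕ → α → ℝ} {c' : α → ℝ} {C : ℝ} {g : ℕ → α → F} {g' : α → F}
    (hc : ∀ n, AEStronglyMeasurable (c n) μ) (hc' : AEStronglyMeasurable c' μ)
    (hcb : ∀ n x, |c n x| ≤ C)
    (hcl : ∀ᵐ x ∂μ, Tendsto (fun n => c n x) atTop (𝓝 (c' x)))
    (hg : ∀ n, MemLp (g n) 2 μ) (hg' : MemLp g' 2 μ)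
    (hgl : Tendsto (fun n => eLpNorm (g n - g') 2 μ) atTop (𝓝 0)) :
    Tendsto (fun n => eLpNorm ((fun x => c n x • g n x) - fun x => c' x • g' x) 2 μ)
      atTop (𝓝 0) := by
  have h1 : Tendsto (fun n => eLpNorm (fun x => c n x • (g n x - g' x)) 2 μ) atTop (𝓝 0) := by
    have h2 : ∀ n, eLpNorm (fun x => c n x • (g n x - g' x)) 2 μ ≤
        ENNReal.ofReal C * eLpNorm (g n - g') 2 μ := fun n => by
      refine eLpNorm_le_mul_eLpNorm_of_ae_le_mul (ae_of_all _ fun x => ?_) 2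
      rw [norm_smul]
      exact mul_le_mul_of_nonneg_right (hcb n x) (norm_nonneg _)
    refine tendsto_of_tendsto_of_tendsto_of_le_of_le tendsto_const_nhds ?_ (fun _ => zero_le)
      h2
    simpa using ENNReal.Tendsto.const_mul hgl (Or.inr ENNReal.ofReal_ne_top)
  have h3 : Tendsto (fun n => eLpNorm (fun x => (c n x - c' x) • g' x) 2 μ) atTop (𝓝 0) := by
    have hcb' : ∀ᵐ x ∂μ, |c' x| ≤ C := by
      filter_upwards [hcl] with x hx
      exact le_of_tendsto hx.abs (Eventually.of_forall fun n => hcb n x)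
    refine tendsto_eLpNorm_of_dominated (g := fun x => 2 * C * ‖g' x‖)
      (fun n => ((hc n).sub hc').smul hg'.1) (hg'.norm.const_mul _) (fun n => ?_) ?_
    · filter_upwards [hcb'] with x hx
      rw [norm_smul]
      refine mul_le_mul_of_nonneg_right ?_ (norm_nonneg _)
      calc ‖c n x - c' x‖ ≤ |c n x| + |c' x| := norm_sub_le _ _
        _ ≤ 2 * C := by linarith [hcb n x]
    · filter_upwards [hcl] with x hx
      have := (hx.sub_const (c' x)).smul_const (g' x)
      simpa using this
  refine tendsto_of_tendsto_of_tendsto_of_le_of_le tendsto_const_nhds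
    (by simpa using h1.add h3) (fun _ => zero_le) fun n => ?_
  have e : ((fun x => c n x • g n x) - fun x => c' x • g' x) =
      (fun x => c n x • (g n x - g' x)) + fun x => (c n x - c' x) • g' x := by
    funext x
    simp only [Pi.sub_apply, Pi.add_apply, smul_sub, sub_smul]
    abel
  rw [e]
  exact eLpNorm_add_le ((hc n).smul ((hg n).1.sub hg'.1)) (((hc n).sub hc').smul hg'.1)
    one_le_two

/-- Along a subsequence the integrals are summable, so the series of the functions is finite almost
everywhere and its terms tend to zero. -/
theorem exists_seq_tendsto_ae_of_lintegral {f : ℕ → α → ℝ≥0∞} (hf : ∀ n, AEMeasurable (f n) μ)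
    (h : Tendsto (fun n => ∫⁻ x, f n x ∂μ) atTop (𝓝 0)) :
    ∃ s : ℕ → ℕ, StrictMono s ∧ ∀ᵐ x ∂μ, Tendsto (fun n => f (s n) x) atTop (𝓝 0) := by
  obtain ⟨s, hs, hs'⟩ := extraction_forall_of_eventually
    (P := fun n k => ∫⁻ x, f k x ∂μ ≤ (2⁻¹ : ℝ≥0∞) ^ n)
    fun n => ENNReal.tendsto_nhds_zero.1 h _ (ENNReal.pow_pos (by simp) n)
  refine ⟨s, hs, ?_⟩
  have h1 : ∫⁻ x, ∑' n, f (s n) x ∂μ ≠ ⊤ := by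
    rw [lintegral_tsum fun n => hf (s n)]
    refine ne_top_of_le_ne_top ?_ (ENNReal.tsum_le_tsum hs')
    rw [ENNReal.tsum_geometric]
    simp
  filter_upwards [ae_lt_top' (AEMeasurable.tsum fun n => hf (s n)) h1] with x hx
  exact ENNReal.tendsto_atTop_zero_of_tsum_ne_top hx.ne

end Limits

/-! ### Cutoffs and kernels with almost everywhere convergence -/

section GoodKernels

variable {d : ℕ}

theorem exists_cutoff {Ω K : Set (Space d)} (hΩ : IsOpen Ω) (hK : IsCompact K) (hKΩ : K ⊆ Ω) :
    ∃ ψ : Space d → ℝ, IsTestFunction Ω ψ ∧ (∀ x, 0 ≤ ψ x) ∧ (∀ x, ψ x ≤ 1) ∧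
      ∀ x ∈ K, ψ x = 1 := by
  obtain ⟨δ, hδ, hδK⟩ := hK.exists_cthickening_subset_open hΩ hKΩ
  obtain ⟨ψ, h1, h2, h3, h4⟩ := exists_contMDiff_support_eq_eq_one_iff
    (modelWithCornersSelf ℝ (Space d)) (n := ⊤)
    (Metric.isOpen_thickening (δ := δ) (E := K)) hK.isClosed (Metric.self_subset_thickening hδ K)
  have hsub : tsupport ψ ⊆ Metric.cthickening δ K := by
    rw [tsupport, h3]
    exact Metric.closure_thickening_subset_cthickening δ K
  refine ⟨ψ, ⟨h1.contDiff, ?_, hsub.trans hδK⟩, fun x => (h2 (mem_range_self x)).1,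
    fun x => (h2 (mem_range_self x)).2, fun x hx => (h4 x).1 hx⟩
  exact hK.cthickening.of_isClosed_subset (isClosed_tsupport _) hsub

/-- Kernels along which the mollifications of `u` converge almost everywhere, and in `L²(ℝ^d)` for
almost every time. -/
structure IsGoodMollifier (σ : ℝ) (k : ℕ → ℝ × Space d → ℝ) (u : ℝ × Space d → ℝ) : Prop
    extends IsTimeShiftedMollifier σ k where
  ae_tendsto : ∀ᵐ z, Tendsto (fun n => mollify volume (k n) u z) atTop (𝓝 (u z))
  ae_slice : ∀ᵐ t : ℝ, Tendsto
    (fun n => eLpNorm (fun x => mollify volume (k n) u (t, x) - u (t, x)) 2 volume) atTop (𝓝 0)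

section

variable {E : Type*} [NormedAddCommGroup E] [NormedSpace ℝ E] [CompleteSpace E]
  {σ : ℝ} {k : ℕ → ℝ × Space d → ℝ} {w : ℝ × Space d → E}

theorem IsTimeShiftedMollifier.tendsto_eLpNorm (hk : IsTimeShiftedMollifier σ k)
    (hw : MemLp w 2) :
    Tendsto (fun n => eLpNorm (mollify volume (k n) w - w) 2) atTop (𝓝 0) :=
  tendsto_eLpNorm_mollify_sub (fun n => (hk.smooth n).continuous) hk.compact hk.nonneg
    hk.integral_eq_one hk.shrink hw

theorem IsTimeShiftedMollifier.contDiff (hk : IsTimeShiftedMollifier σ k)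
    (hw : MemLp w 2) (n : ℕ) : ContDiff ℝ ∞ (mollify volume (k n) w) :=
  contDiff_mollify (hk.smooth n) (hk.compact n) (hw.locallyIntegrable (by norm_num))

theorem eLpNorm_mollify_le {κ : ℝ × Space d → ℝ} (hk : Continuous κ) (hkc : HasCompactSupport κ)
    (hk0 : ∀ z, 0 ≤ κ z) (hk1 : ∫ z, κ z = 1) (hw : MemLp w 2) :
    eLpNorm (mollify volume κ w - w) 2 ≤ 2 * eLpNorm w 2 := by
  refine eLpNorm_mollify_sub_le hk hkc hk0 hk1 hw fun y _ => ?_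
  have h1 : eLpNorm (fun z => w (z - y)) 2 volume = eLpNorm w 2 :=
    eLpNorm_comp_measurePreserving hw.1 (measurePreserving_sub_right volume y)
  have h2 : AEStronglyMeasurable (fun z => w (z - y)) volume :=
    hw.1.comp_measurePreserving (measurePreserving_sub_right volume y)
  refine (eLpNorm_sub_le h2 hw.1 one_le_two).trans_eq ?_
  rw [h1, two_mul]

theorem IsTimeShiftedMollifier.memLp (hk : IsTimeShiftedMollifier σ k)
    (hw : MemLp w 2) (n : ℕ) : MemLp (mollify volume (k n) w) 2 := by
  have h1 : AEStronglyMeasurable (mollify volume (k n) w) volume :=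
    (hk.contDiff hw n).continuous.aestronglyMeasurable
  have h2 : MemLp (mollify volume (k n) w - w) 2 := by
    refine ⟨h1.sub hw.1, (eLpNorm_mollify_le (hk.smooth n).continuous (hk.compact n) (hk.nonneg n)
      (hk.integral_eq_one n) hw).trans_lt ?_⟩
    exact ENNReal.mul_lt_top (by norm_num) hw.2
  simpa using h2.add hw

end

/-- Two successive extractions from the `L²` convergence: one for almost every point and, after
Fubini, one for the squared slice norms as functions of time. -/
theorem exists_isGoodMollifier {σ : ℝ} (hσ : |σ| = 1) {u : ℝ × Space d → ℝ} (hu : MemLp u 2) :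
    ∃ k, IsGoodMollifier σ k u := by
  obtain ⟨k, hk⟩ := exists_isTimeShiftedMollifier (d := d) hσ
  have hm : ∀ n, AEStronglyMeasurable (mollify volume (k n) u - u) volume := fun n =>
    (hk.memLp hu n).1.sub hu.1
  have hl : Tendsto (fun n => ∫⁻ z, ‖(mollify volume (k n) u - u) z‖ₑ ^ (2 : ℝ)) atTop (𝓝 0) := by
    simp_rw [lintegral_sq_eq_eLpNorm]
    simpa [Function.comp_def] using (ENNReal.continuous_rpow_const (y := (2 : ℝ))).tendsto 0 |>.comp
      (hk.tendsto_eLpNorm hu)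
  obtain ⟨s, hs, hs'⟩ := exists_seq_tendsto_ae_of_lintegral (fun n => (hm n).enorm.pow_const _) hl
  have hl2 : Tendsto (fun n => ∫⁻ t : ℝ, ∫⁻ x : Space d,
      ‖(mollify volume (k (s n)) u - u) (t, x)‖ₑ ^ (2 : ℝ)) atTop (𝓝 0) := by
    refine (hl.comp hs.tendsto_atTop).congr fun n => ?_
    simp only [Function.comp_apply, Measure.volume_eq_prod]
    exact lintegral_prod _ ((hm (s n)).enorm.pow_const _)
  obtain ⟨r, hr, hr'⟩ := exists_seq_tendsto_ae_of_lintegral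
    (fun n => ((hm (s n)).enorm.pow_const (2 : ℝ)).lintegral_prod_right') hl2
  refine ⟨k ∘ (s ∘ r), ⟨hk.comp (hs.tendsto_atTop.comp hr.tendsto_atTop), ?_, ?_⟩⟩
  · filter_upwards [hs'] with z hz
    have h1 := hz.comp hr.tendsto_atTop
    have h2 := (ENNReal.continuous_rpow_const (y := (1 / 2 : ℝ))).tendsto 0 |>.comp h1
    rw [tendsto_iff_edist_tendsto_0]
    have h3 : ∀ a : ℝ≥0∞, (a ^ (2 : ℝ)) ^ (1 / 2 : ℝ) = a := fun a => by
      rw [← ENNReal.rpow_mul]; norm_num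
    simp only [Function.comp_def, h3] at h2
    simpa [edist_eq_enorm_sub] using h2
  · filter_upwards [hr'] with t ht
    exact tendsto_eLpNorm_two_of_lintegral ht

end GoodKernels

/-! ### Uniform Cauchy estimate for time slices -/

section TimeContinuity

variable {d : ℕ}

theorem isC2Profile_sq : IsC2Profile (fun a => a ^ 2 / 2) (fun a => a) fun _ => 1 where
  hasDerivAt a := by simpa using (hasDerivAt_pow 2 a).div_const 2
  hasDerivAt_deriv a := hasDerivAt_id a
  continuous_deriv2 := continuous_const
  bound a := by simp

theorem integral_norm_sq_eq {α : Type*} [MeasurableSpace α] {μ : Measure α} {E : Type*}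
    [NormedAddCommGroup E] {g : α → E} (hg : AEStronglyMeasurable g μ) :
    ∫ x, ‖g x‖ ^ 2 ∂μ = (eLpNorm g 2 μ).toReal ^ 2 := by
  have h1 := lintegral_sq_eq_eLpNorm (μ := μ) (fun x => ‖g x‖)
  simp only [enorm_norm, eLpNorm_norm] at h1
  rw [integral_eq_lintegral_of_nonneg_ae (ae_of_all _ fun x => sq_nonneg _)
    ((hg.norm.pow 2))]
  have h2 : ∀ x, ENNReal.ofReal (‖g x‖ ^ 2) = ‖g x‖ₑ ^ (2 : ℝ) := fun x => by
    rw [ENNReal.ofReal_pow (norm_nonneg _), ofReal_norm, ← ENNReal.rpow_natCast]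
    norm_num
  simp_rw [h2]
  rw [h1, ← ENNReal.toReal_rpow]
  norm_num

theorem norm_setIntegral_le_integral {α : Type*} [MeasurableSpace α] {μ : Measure α} {S : Set α}
    {g h : α → ℝ} (hS : MeasurableSet S) (hh : Integrable h μ) (h0 : ∀ x, 0 ≤ h x)
    (hgh : ∀ x ∈ S, |g x| ≤ h x) : |∫ x in S, g x ∂μ| ≤ ∫ x, h x ∂μ := by
  refine (norm_integral_le_of_norm_le (μ := μ.restrict S) (f := g) hh.integrableOn ?_).trans
    (setIntegral_le_integral hh (ae_of_all _ h0))
  exact (ae_restrict_iff' hS).2 (ae_of_all _ hgh)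

theorem measurableSet_slab (s t : ℝ) : MeasurableSet (slab d s t) :=
  measurableSet_Ioo.prod .univ

/-- The energy identity for `a²/2` shows that `∫ ψ U²/2` varies by at most `C N` on `[α, β]`, where
`N` is the sum of the space-time square integrals. Averaging over a second time then bounds the
slice at `t` with no initial value. -/
theorem slice_sq_le {U f : ℝ × Space d → ℝ} {P V : ℝ × Space d → Space d}
    (hU : ContDiff ℝ 1 U) (hP : ContDiff ℝ 1 P) (hf : Continuous f)
    (hU2 : MemLp U 2) (hP2 : MemLp P 2) (hf2 : MemLp f 2) (hV2 : MemLp V 2)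
    {ψ : Space d → ℝ} (hψ : ContDiff ℝ 1 ψ) (hψc : HasCompactSupport ψ) (hψ0 : ∀ x, 0 ≤ ψ x)
    (hψ1 : ∀ x, ψ x ≤ 1) {C : ℝ} (hC1 : 1 ≤ C) (hC : ∀ x, ‖gradient ψ x‖ ≤ C) {α β : ℝ}
    (hgrad : ∀ z ∈ Icc α β ×ˢ tsupport ψ, spaceGrad U z = V z)
    (heq : ∀ z ∈ Icc α β ×ˢ tsupport ψ, timeDeriv U z - spaceDiv P z - f z = 0)
    {t : ℝ} (ht : t ∈ Icc α β) :
    (β - α) * ∫ x, ψ x * U (t, x) ^ 2 ≤ (1 + 2 * C * (β - α)) *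
      ((∫ z, U z ^ 2) + (∫ z, ‖P z‖ ^ 2) + (∫ z, ‖V z‖ ^ 2) + ∫ z, f z ^ 2) := by
  set N := (∫ z, U z ^ 2) + (∫ z, ‖P z‖ ^ 2) + (∫ z, ‖V z‖ ^ 2) + ∫ z, f z ^ 2 with hN
  have hαβ : α ≤ β := ht.1.trans ht.2
  have iU : Integrable fun z => U z ^ 2 := hU2.integrable_sq
  have if' : Integrable fun z => f z ^ 2 := hf2.integrable_sq
  have iP : Integrable fun z => ‖P z‖ ^ 2 := hP2.norm.integrable_sq
  have iV : Integrable fun z => ‖V z‖ ^ 2 := hV2.norm.integrable_sq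
  have nU : 0 ≤ ∫ z, U z ^ 2 := integral_nonneg fun z => sq_nonneg _
  have nP : 0 ≤ ∫ z, ‖P z‖ ^ 2 := integral_nonneg fun z => sq_nonneg _
  have nV : 0 ≤ ∫ z, ‖V z‖ ^ 2 := integral_nonneg fun z => sq_nonneg _
  have nf : 0 ≤ ∫ z, f z ^ 2 := integral_nonneg fun z => sq_nonneg _
  have hz : ∀ z : ℝ × Space d, z.2 ∉ tsupport ψ → ψ z.2 = 0 := fun z hz =>
    image_eq_zero_of_notMem_tsupport hz
  have step : ∀ s t, α ≤ s → s ≤ t → t ≤ β →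
      |(∫ x, ψ x * (U (t, x) ^ 2 / 2)) - ∫ x, ψ x * (U (s, x) ^ 2 / 2)| ≤ C * N := by
    intro s t hs hst ht
    have hslab : ∀ z ∈ slab d s t, z.1 ∈ Icc α β := fun z hz =>
      ⟨hs.trans hz.1.1.le, hz.1.2.le.trans ht⟩
    rw [energy_identity isC2Profile_sq hU hP hf hψ hψc hst]
    have e4 : ∫ z in slab d s t, ψ z.2 * U z * (timeDeriv U z - spaceDiv P z - f z) = 0 := by
      refine setIntegral_eq_zero_of_forall_eq_zero fun z hzs => ?_
      by_cases h : z.2 ∈ tsupport ψ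
      · rw [heq z ⟨hslab z hzs, h⟩, mul_zero]
      · rw [hz z h, zero_mul, zero_mul]
    have b1 : |∫ z in slab d s t, ⟪P z, U z • gradient ψ z.2⟫| ≤
        ∫ z, C * (‖P z‖ ^ 2 + U z ^ 2) / 2 := by
      refine norm_setIntegral_le_integral (measurableSet_slab s t)
        (((iP.add iU).const_mul C).div_const 2) (fun z => by positivity) fun z _ => ?_
      calc |⟪P z, U z • gradient ψ z.2⟫| ≤ ‖P z‖ * ‖U z • gradient ψ z.2‖ :=
            abs_real_inner_le_norm _ _
        _ ≤ ‖P z‖ * (|U z| * C) := by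
            rw [norm_smul]
            gcongr
            exacts [le_rfl, hC _]
        _ ≤ C * (‖P z‖ ^ 2 + U z ^ 2) / 2 := by
            nlinarith [mul_nonneg (zero_le_one.trans hC1) (sq_nonneg (‖P z‖ - |U z|)), sq_abs (U z)]
    have b2 : |∫ z in slab d s t, ⟪P z, (ψ z.2 * 1) • spaceGrad U z⟫| ≤
        ∫ z, (‖P z‖ ^ 2 + ‖V z‖ ^ 2) / 2 := by
      refine norm_setIntegral_le_integral (measurableSet_slab s t)
        ((iP.add iV).div_const 2) (fun z => by positivity) fun z hzs => ?_
      have e : (ψ z.2 * 1) • spaceGrad U z = ψ z.2 • V z := by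
        by_cases h : z.2 ∈ tsupport ψ
        · rw [hgrad z ⟨hslab z hzs, h⟩, mul_one]
        · simp [hz z h]
      rw [e]
      calc |⟪P z, ψ z.2 • V z⟫| ≤ ‖P z‖ * ‖ψ z.2 • V z‖ := abs_real_inner_le_norm _ _
        _ ≤ ‖P z‖ * (1 * ‖V z‖) := by
            rw [norm_smul, Real.norm_of_nonneg (hψ0 _)]
            gcongr
            exact hψ1 _
        _ ≤ (‖P z‖ ^ 2 + ‖V z‖ ^ 2) / 2 := by nlinarith [sq_nonneg (‖P z‖ - ‖V z‖)]
    have b3 : |∫ z in slab d s t, f z * (ψ z.2 * U z)| ≤ ∫ z, (f z ^ 2 + U z ^ 2) / 2 := by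
      refine norm_setIntegral_le_integral (measurableSet_slab s t)
        ((if'.add iU).div_const 2) (fun z => by positivity) fun z _ => ?_
      rw [abs_mul, abs_mul, abs_of_nonneg (hψ0 _)]
      calc |f z| * (ψ z.2 * |U z|) ≤ |f z| * (1 * |U z|) := by gcongr; exact hψ1 _
        _ ≤ (f z ^ 2 + U z ^ 2) / 2 := by
            nlinarith [sq_nonneg (|f z| - |U z|), sq_abs (f z), sq_abs (U z)]
    rw [integral_div, integral_const_mul, integral_add iP iU] at b1
    rw [integral_div, integral_add iP iV] at b2
    rw [integral_div, integral_add if' iU] at b3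
    rw [e4, add_zero, abs_le]
    rw [abs_le] at b1 b2 b3
    have q : ∀ {a : ℝ}, 0 ≤ a → a ≤ C * a := fun ha => le_mul_of_one_le_left ha hC1
    have qU := q nU
    have qP := q nP
    have qV := q nV
    have qf := q nf
    constructor <;> rw [hN] <;> linarith [b1.1, b1.2, b2.1, b2.2, b3.1, b3.2]
  have step2 : ∀ s ∈ Icc α β,
      (∫ x, ψ x * U (t, x) ^ 2) - 2 * C * N ≤ ∫ x, ψ x * U (s, x) ^ 2 := by
    intro s hs
    have e : ∀ τ, ∫ x, ψ x * (U (τ, x) ^ 2 / 2) = (∫ x, ψ x * U (τ, x) ^ 2) / 2 := fun τ => by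
      rw [← integral_div]
      simp_rw [mul_div_assoc]
    rcases le_total s t with h | h
    · have := (abs_le.1 (step s t hs.1 h ht.2)).2
      rw [e, e] at this
      linarith
    · have := (abs_le.1 (step t s ht.1 h hs.2)).1
      rw [e, e] at this
      linarith
  have hUc := hU.continuous
  have hψ' := hψ.continuous
  have iE : Integrable (fun z : ℝ × Space d => ψ z.2 * U z ^ 2) (volume.restrict (slab d α β)) :=
    integrableOn_slab (by fun_prop) hψc.isCompact (fun z h => by simp [hz z h]) α β
  have h1 : ∫ z in slab d α β, ψ z.2 * U z ^ 2 ≤ ∫ z, U z ^ 2 := by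
    refine (setIntegral_mono iE iU.integrableOn fun z => ?_).trans
      (setIntegral_le_integral iU (ae_of_all _ fun z => sq_nonneg _))
    exact mul_le_of_le_one_left (sq_nonneg _) (hψ1 _)
  rw [restrict_slab] at iE h1
  rw [integral_prod _ iE] at h1
  -- Integration in `s` trades the unknown slice at time `s` for the space-time integral of `U²`.
  have h2 : ∫ _ in Ioo α β, ((∫ x, ψ x * U (t, x) ^ 2) - 2 * C * N) ≤
      ∫ s in Ioo α β, ∫ x, ψ x * U (s, x) ^ 2 := by
    refine setIntegral_mono_on (by simp) iE.integral_prod_left measurableSet_Ioo fun s hs => ?_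
    exact step2 s (Ioo_subset_Icc_self hs)
  rw [setIntegral_const, Real.volume_real_Ioo_of_le hαβ, smul_eq_mul] at h2
  have h3 : ∫ z, U z ^ 2 ≤ N := by rw [hN]; linarith
  linarith

theorem tendsto_integral_norm_sq_sub {α : Type*} [MeasurableSpace α] {μ : Measure α} {E : Type*}
    [NormedAddCommGroup E] {w : ℕ → α → E} {w' : α → E} (hw : ∀ n, MemLp (w n) 2 μ)
    (hw' : MemLp w' 2 μ) (h : Tendsto (fun n => eLpNorm (w n - w') 2 μ) atTop (𝓝 0)) :
    Tendsto (fun p : ℕ × ℕ => ∫ x, ‖(w p.1 - w p.2) x‖ ^ 2 ∂μ) atTop (𝓝 0) := by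
  simp_rw [integral_norm_sq_eq ((hw _).1.sub (hw _).1)]
  have h1 : Tendsto (fun p : ℕ × ℕ => eLpNorm (w p.1 - w p.2) 2 μ) atTop (𝓝 0) := by
    rw [← prod_atTop_atTop_eq]
    have h2 := (h.comp tendsto_fst).add (h.comp (tendsto_snd (f := (atTop : Filter ℕ))))
    rw [add_zero] at h2
    refine tendsto_of_tendsto_of_tendsto_of_le_of_le tendsto_const_nhds h2 (fun _ => zero_le)
      fun p => ?_
    have e : w p.1 - w p.2 = (w p.1 - w') - (w p.2 - w') := by abel
    rw [e]
    exact eLpNorm_sub_le ((hw _).1.sub hw'.1) ((hw _).1.sub hw'.1) one_le_two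
  have h2 := (ENNReal.tendsto_toReal ENNReal.zero_ne_top).comp h1
  simpa [Function.comp_def] using h2.pow 2

theorem IsTestFunction.sub {X : Type*} [NormedAddCommGroup X] [NormedSpace ℝ X] {S : Set X}
    {φ φ' : X → ℝ} (h : IsTestFunction S φ) (h' : IsTestFunction S φ') :
    IsTestFunction S (φ - φ') := by
  refine ⟨h.smooth.sub h'.smooth, h.compact.sub h'.compact, ?_⟩
  exact (tsupport_sub φ φ').trans (union_subset h.support_subset h'.support_subset)

/-- `slice_sq_le` is applied with the kernel `k n - k m`. Its right-hand side is made of `L²`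
distances between mollifications, which tend to zero and do not depend on `t`. -/
theorem eventually_slice_sub_le {σ : ℝ} {k : ℕ → ℝ × Space d → ℝ}
    (hk : IsTimeShiftedMollifier σ k) {T₁ T₂ α β : ℝ} {Ω K : Set (Space d)} (hΩ : IsOpen Ω)
    (hK : IsCompact K) (hKΩ : K ⊆ Ω) (hα : T₁ ≤ α) (hβ : β ≤ T₂) (hαβ : α < β)
    (hσ : (σ = -1 ∧ β < T₂) ∨ (σ = 1 ∧ T₁ < α))
    {u f : ℝ × Space d → ℝ} {F G : ℝ × Space d → Space d} (hu : MemLp u 2) (hf : MemLp f 2)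
    (hF : MemLp F 2) (hG : MemLp G 2)
    (hgrad : ∀ φ, IsTestFunction (cylinder T₁ T₂ Ω) φ →
      ∫ y, u y • spaceGrad φ y = -∫ y, φ y • G y)
    (heq : ∀ φ, IsTestFunction (cylinder T₁ T₂ Ω) φ → divForm u F f φ = 0)
    {ε : ℝ} (hε : 0 < ε) :
    ∃ n₀, ∀ n ≥ n₀, ∀ m ≥ n₀, ∀ t ∈ Icc α β,
      eLpNorm (fun x => mollify volume (k n) u (t, x) - mollify volume (k m) u (t, x)) 2
        (volume.restrict K) ≤ ENNReal.ofReal ε := by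
  obtain ⟨ψ, hψ, hψ0, hψ1, hψK⟩ := exists_cutoff hΩ hK hKΩ
  have hψg : Continuous (gradient ψ) :=
    (InnerProductSpace.toDual ℝ (Space d)).symm.continuous.comp
      (hψ.smooth.continuous_fderiv (by simp))
  have hψgc : HasCompactSupport (gradient ψ) :=
    (hψ.compact.fderiv ℝ).comp_left
      (g := fun L => (InnerProductSpace.toDual ℝ (Space d)).symm L) (by simp)
  obtain ⟨C₀, hC₀⟩ := hψgc.exists_bound_of_continuous hψg
  set C := max 1 C₀ with hC
  have hlim := (((tendsto_integral_norm_sq_sub (hk.memLp hu) hu (hk.tendsto_eLpNorm hu)).add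
    (tendsto_integral_norm_sq_sub (hk.memLp hF) hF (hk.tendsto_eLpNorm hF))).add
    (tendsto_integral_norm_sq_sub (hk.memLp hG) hG (hk.tendsto_eLpNorm hG))).add
    (tendsto_integral_norm_sq_sub (hk.memLp hf) hf (hk.tendsto_eLpNorm hf))
  have hlim2 := hlim.const_mul (1 + 2 * C * (β - α))
  simp only [add_zero, mul_zero] at hlim2
  have hε2 : 0 < (β - α) * ε ^ 2 := mul_pos (sub_pos.2 hαβ) (by positivity)
  obtain ⟨⟨n₁, n₂⟩, h₁₂⟩ := eventually_atTop.1 (hlim2.eventually_lt_const hε2)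
  obtain ⟨n₃, h₃⟩ := eventually_atTop.1
    (hk.eventually_isTestFunction hΩ hψ.compact.isCompact hψ.support_subset hα hβ hσ)
  refine ⟨max (max n₁ n₂) n₃, fun n hn m hm t ht => ?_⟩
  have hN := h₁₂ (n, m) ⟨((le_max_left _ _).trans (le_max_left _ _)).trans hn,
    ((le_max_right _ _).trans (le_max_left _ _)).trans hm⟩
  have hn3 := h₃ n ((le_max_right _ _).trans hn)
  have hm3 := h₃ m ((le_max_right _ _).trans hm)
  have loc : ∀ {E : Type} [NormedAddCommGroup E] {w : ℝ × Space d → E},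
      MemLp w 2 → LocallyIntegrable w := fun hw => hw.locallyIntegrable (by norm_num)
  have hsub : ∀ {E : Type} [NormedAddCommGroup E] [NormedSpace ℝ E] [CompleteSpace E]
      {w : ℝ × Space d → E}, MemLp w 2 → mollify volume (k n - k m) w =
        mollify volume (k n) w - mollify volume (k m) w := fun {E} _ _ _ {w} hw =>
    funext fun z => mollify_sub_left (hk.smooth n).continuous (hk.smooth m).continuous
      (hk.compact n) (hk.compact m) (loc hw) z
  have hκ : ContDiff ℝ ∞ (k n - k m) := (hk.smooth n).sub (hk.smooth m)
  have hκc : HasCompactSupport (k n - k m) := (hk.compact n).sub (hk.compact m)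
  have htest : ∀ z ∈ Icc α β ×ˢ tsupport ψ,
      IsTestFunction (cylinder T₁ T₂ Ω) fun y => (k n - k m) (z - y) := fun z hz =>
    (hn3 z.1 hz.1 z.2 hz.2).sub (hm3 z.1 hz.1 z.2 hz.2)
  have key := slice_sq_le (U := mollify volume (k n - k m) u)
    (f := mollify volume (k n - k m) f) (P := mollify volume (k n - k m) F)
    (V := mollify volume (k n - k m) G)
    ((contDiff_mollify hκ hκc (loc hu)).of_le (by simp))
    ((contDiff_mollify hκ hκc (loc hF)).of_le (by simp))
    (contDiff_mollify hκ hκc (loc hf)).continuous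
    (by rw [hsub hu]; exact (hk.memLp hu n).sub (hk.memLp hu m))
    (by rw [hsub hF]; exact (hk.memLp hF n).sub (hk.memLp hF m))
    (by rw [hsub hf]; exact (hk.memLp hf n).sub (hk.memLp hf m))
    (by rw [hsub hG]; exact (hk.memLp hG n).sub (hk.memLp hG m))
    (hψ.smooth.of_le (by simp)) hψ.compact hψ0 hψ1 (le_max_left 1 C₀)
    (fun x => (hC₀ x).trans (le_max_right _ _))
    (fun z hz => spaceGrad_mollify hκ hκc (loc hu) (hgrad _ (htest z hz)))
    (fun z hz => by
      rw [← divForm_comp_sub_left hκ hκc (loc hu) (loc hF)]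
      exact heq _ (htest z hz)) ht
  rw [hsub hu, hsub hF, hsub hG, hsub hf] at key
  simp only [Real.norm_eq_abs, sq_abs] at hN
  have h4 : ∫ x, ψ x * (mollify volume (k n) u - mollify volume (k m) u) (t, x) ^ 2 ≤ ε ^ 2 :=
    le_of_mul_le_mul_left (key.trans hN.le) (sub_pos.2 hαβ)
  have hcont : Continuous fun x =>
      mollify volume (k n) u (t, x) - mollify volume (k m) u (t, x) := by
    have h1 := (hk.contDiff hu n).continuous
    have h2 := (hk.contDiff hu m).continuous
    fun_prop
  have hψc := hψ.smooth.continuous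
  have hint : Integrable fun x =>
      ψ x * (mollify volume (k n) u (t, x) - mollify volume (k m) u (t, x)) ^ 2 :=
    Continuous.integrable_of_hasCompactSupport (by fun_prop) hψ.compact.mul_right
  have h5 : ∫ x in K, ‖mollify volume (k n) u (t, x) - mollify volume (k m) u (t, x)‖ ^ 2 ≤
      ε ^ 2 := by
    refine le_trans ?_ h4
    refine (setIntegral_congr_fun hK.measurableSet fun x hx => ?_).trans_le
      (setIntegral_le_integral hint (ae_of_all _ fun x => mul_nonneg (hψ0 x) (sq_nonneg _)))
    simp [hψK x hx]
  rw [integral_norm_sq_eq hcont.aestronglyMeasurable] at h5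
  have h6 : MemLp (fun x => mollify volume (k n) u (t, x) - mollify volume (k m) u (t, x)) 2
      (volume.restrict K) := by
    obtain ⟨c, hc⟩ := hK.exists_bound_of_continuousOn hcont.continuousOn
    have : IsFiniteMeasure (volume.restrict K) := ⟨by simpa using hK.measure_lt_top⟩
    exact MemLp.of_bound hcont.aestronglyMeasurable c
      ((ae_restrict_iff' hK.measurableSet).2 (ae_of_all _ hc))
  rw [ENNReal.le_ofReal_iff_toReal_le h6.2.ne hε.le]
  exact le_of_sq_le_sq h5 hε.le

end TimeContinuity

/-! ### The time-continuous representative -/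

section Representative

variable {d : ℕ}

/-- An `ε/3` argument: one fixed mollification is uniformly continuous on `[α, β] × K` and is
`ε/3`-close to `u` in `L²(K)` at every time of `S` in `[α, β]`. -/
theorem exists_oscillation_le {σ : ℝ} {k : ℕ → ℝ × Space d → ℝ}
    {T₁ T₂ α β : ℝ} {Ω K : Set (Space d)} (hΩ : IsOpen Ω)
    (hK : IsCompact K) (hKΩ : K ⊆ Ω) (hα : T₁ ≤ α) (hβ : β ≤ T₂) (hαβ : α < β)
    (hσ : (σ = -1 ∧ β < T₂) ∨ (σ = 1 ∧ T₁ < α))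
    {u f : ℝ × Space d → ℝ} {F G : ℝ × Space d → Space d}
    (hk : IsTimeShiftedMollifier σ k) (hu : MemLp u 2) (hf : MemLp f 2)
    (hF : MemLp F 2) (hG : MemLp G 2)
    (hgrad : ∀ φ, IsTestFunction (cylinder T₁ T₂ Ω) φ →
      ∫ y, u y • spaceGrad φ y = -∫ y, φ y • G y)
    (heq : ∀ φ, IsTestFunction (cylinder T₁ T₂ Ω) φ → divForm u F f φ = 0)
    {S : Set ℝ} (hS : ∀ t ∈ S, AEStronglyMeasurable (fun x => u (t, x)) volume)
    (hS' : ∀ t ∈ S, Tendsto (fun n => eLpNorm (fun x => mollify volume (k n) u (t, x) - u (t, x)) 2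
      volume) atTop (𝓝 0)) {ε : ℝ} (hε : 0 < ε) :
    ∃ δ > 0, ∀ t ∈ S ∩ Icc α β, ∀ t' ∈ S ∩ Icc α β, |t - t'| < δ →
      eLpNorm (fun x => u (t, x) - u (t', x)) 2 (volume.restrict K) ≤ ENNReal.ofReal ε := by
  have hε3 : 0 < ε / 3 := by positivity
  obtain ⟨n, hn⟩ := eventually_slice_sub_le hk hΩ hK hKΩ hα hβ hαβ hσ hu hf hF hG hgrad heq hε3
  set U := mollify volume (k n) u with hU
  have hUc : Continuous U := (hk.contDiff hu n).continuous
  have hUm : ∀ t, AEStronglyMeasurable (fun x => U (t, x)) (volume.restrict K) := fun t =>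
    Continuous.aestronglyMeasurable (by fun_prop)
  have h1 : ∀ t ∈ S ∩ Icc α β,
      eLpNorm (fun x => U (t, x) - u (t, x)) 2 (volume.restrict K) ≤ ENNReal.ofReal (ε / 3) := by
    intro t ht
    have hm : ∀ m, AEStronglyMeasurable (fun x => mollify volume (k m) u (t, x))
        (volume.restrict K) := fun m => by
      have := (hk.contDiff hu m).continuous
      exact Continuous.aestronglyMeasurable (by fun_prop)
    have h2 : Tendsto (fun m => ENNReal.ofReal (ε / 3) +
        eLpNorm (fun x => mollify volume (k m) u (t, x) - u (t, x)) 2 volume) atTop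
        (𝓝 (ENNReal.ofReal (ε / 3) + 0)) := (hS' t ht.1).const_add _
    rw [add_zero] at h2
    refine ge_of_tendsto h2 ?_
    filter_upwards [eventually_ge_atTop n] with m hm'
    have e : (fun x => U (t, x) - u (t, x)) =
        (fun x => U (t, x) - mollify volume (k m) u (t, x)) +
          fun x => mollify volume (k m) u (t, x) - u (t, x) := by
      funext x
      simp
    rw [e]
    refine (eLpNorm_add_le ((hUm t).sub (hm m)) ((hm m).sub (hS t ht.1).restrict)
      one_le_two).trans (add_le_add (hn n le_rfl m hm' t ht.2) ?_)
    exact eLpNorm_mono_measure _ Measure.restrict_le_self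
  have hfin : volume K ≠ ⊤ := hK.measure_lt_top.ne
  obtain ⟨η, hη, hηK⟩ : ∃ η : ℝ, 0 < η ∧
      (volume K) ^ (2⁻¹ : ℝ) * ENNReal.ofReal η ≤ ENNReal.ofReal (ε / 3) := by
    set c := ((volume K) ^ (2⁻¹ : ℝ)).toReal with hc
    have hc' : (volume K) ^ (2⁻¹ : ℝ) = ENNReal.ofReal c :=
      (ENNReal.ofReal_toReal (ENNReal.rpow_ne_top_of_nonneg (by norm_num) hfin)).symm
    have hc0 : 0 ≤ c := ENNReal.toReal_nonneg
    -- A uniform bound `η` on `K` becomes an `L²(K)` bound `cη`; the `+ 1` allows `K` to be null.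
    refine ⟨ε / 3 / (c + 1), by positivity, ?_⟩
    rw [hc', ← ENNReal.ofReal_mul hc0]
    refine ENNReal.ofReal_le_ofReal ?_
    rw [mul_div_assoc', div_le_iff₀ (by positivity)]
    nlinarith
  have huc := (isCompact_Icc.prod hK).uniformContinuousOn_of_continuous
    (s := Icc α β ×ˢ K) hUc.continuousOn
  obtain ⟨δ, hδ, hδ'⟩ := Metric.uniformContinuousOn_iff.1 huc η hη
  refine ⟨δ, hδ, fun t ht t' ht' htt => ?_⟩
  have h3 : eLpNorm (fun x => U (t, x) - U (t', x)) 2 (volume.restrict K) ≤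
      ENNReal.ofReal (ε / 3) := by
    refine (eLpNorm_le_of_ae_bound (C := η) ((ae_restrict_iff' hK.measurableSet).2
      (ae_of_all _ fun x hx => ?_))).trans (by simpa using hηK)
    have := hδ' (t, x) ⟨ht.2, hx⟩ (t', x) ⟨ht'.2, hx⟩ (by
        rw [Prod.dist_eq, dist_self]
        exact max_lt htt hδ)
    rw [dist_eq_norm] at this
    exact this.le
  have e : (fun x => u (t, x) - u (t', x)) = ((fun x => U (t, x) - U (t', x)) -
      (fun x => U (t, x) - u (t, x))) + fun x => U (t', x) - u (t', x) := by
    funext x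
    simp
  have m1 := ((hUm t).sub (hUm t'))
  have m2 := ((hUm t).sub (hS t ht.1).restrict)
  have m3 := ((hUm t').sub (hS t' ht'.1).restrict)
  rw [e]
  calc _ ≤ _ := eLpNorm_add_le (m1.sub m2) m3 one_le_two
    _ ≤ _ := add_le_add_left (eLpNorm_sub_le m1 m2 one_le_two) _
    _ ≤ ENNReal.ofReal (ε / 3) + ENNReal.ofReal (ε / 3) + ENNReal.ofReal (ε / 3) :=
        add_le_add (add_le_add h3 (h1 t ht)) (h1 t' ht')
    _ = ENNReal.ofReal ε := by
        rw [← ENNReal.ofReal_add hε3.le hε3.le, ← ENNReal.ofReal_add (by positivity) hε3.le]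
        congr 1
        ring

/-- A continuous weight that is positive exactly on `Ω`. -/
noncomputable def distWeight (Ω : Set (Space d)) (x : Space d) : ℝ :=
  min 1 (Metric.infDist x Ωᶜ)

theorem continuous_distWeight (Ω : Set (Space d)) : Continuous (distWeight Ω) :=
  continuous_const.min (Metric.continuous_infDist_pt _)

theorem distWeight_nonneg (Ω : Set (Space d)) (x : Space d) : 0 ≤ distWeight Ω x :=
  le_min zero_le_one Metric.infDist_nonneg

theorem distWeight_le_one (Ω : Set (Space d)) (x : Space d) : distWeight Ω x ≤ 1 :=
  min_le_left _ _

theorem distWeight_pos {Ω : Set (Space d)} (hΩ : IsOpen Ω) (hne : Ωᶜ.Nonempty) {x : Space d}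
    (hx : x ∈ Ω) : 0 < distWeight Ω x :=
  lt_min zero_lt_one ((hΩ.isClosed_compl.notMem_iff_infDist_pos hne).1 (by simpa using hx))

theorem isCompact_le_distWeight {Ω : Set (Space d)} (hΩb : Bornology.IsBounded Ω) {η : ℝ}
    (hη : 0 < η) : IsCompact {x | η ≤ distWeight Ω x} ∧ {x | η ≤ distWeight Ω x} ⊆ Ω := by
  have hsub : {x | η ≤ distWeight Ω x} ⊆ Ω := by
    intro x hx
    by_contra h
    have h1 : Metric.infDist x Ωᶜ = 0 := Metric.infDist_zero_of_mem h
    have h2 : η ≤ distWeight Ω x := hx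
    have h3 : distWeight Ω x ≤ 0 := h1 ▸ min_le_right _ _
    linarith
  exact ⟨Metric.isCompact_of_isClosed_isBounded
    (isClosed_le continuous_const (continuous_distWeight Ω)) (hΩb.subset hsub), hsub⟩

/-- The space is split at the level `η` of the weight: the weight is at most one on the compact part
and below `η` on the rest. -/
theorem eLpNorm_distWeight_mul_le {Ω : Set (Space d)} {η : ℝ} (hη : 0 ≤ η) {g : Space d → ℝ}
    (hg : AEStronglyMeasurable g volume) :
    eLpNorm (fun x => distWeight Ω x * g x) 2 volume ≤
      eLpNorm g 2 (volume.restrict {x | η ≤ distWeight Ω x}) +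
        ENNReal.ofReal η * eLpNorm g 2 volume := by
  set K := {x | η ≤ distWeight Ω x} with hK
  have hKm : MeasurableSet K :=
    (isClosed_le continuous_const (continuous_distWeight Ω)).measurableSet
  have hWg : AEStronglyMeasurable (fun x => distWeight Ω x * g x) volume :=
    (continuous_distWeight Ω).aestronglyMeasurable.mul hg
  rw [← indicator_self_add_compl K (fun x => distWeight Ω x * g x)]
  refine (eLpNorm_add_le (hWg.indicator hKm) (hWg.indicator hKm.compl) one_le_two).trans
    (add_le_add ?_ ?_)
  · rw [eLpNorm_indicator_eq_eLpNorm_restrict hKm]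
    refine eLpNorm_mono fun x => ?_
    rw [norm_mul, Real.norm_of_nonneg (distWeight_nonneg Ω x)]
    exact mul_le_of_le_one_left (norm_nonneg _) (distWeight_le_one Ω x)
  · refine eLpNorm_le_mul_eLpNorm_of_ae_le_mul (ae_of_all _ fun x => ?_) 2
    by_cases hx : x ∈ K
    · simpa [hx] using mul_nonneg hη (abs_nonneg (g x))
    · have h1 : distWeight Ω x < η := not_le.1 hx
      rw [indicator_of_mem (by simpa using hx), norm_mul,
        Real.norm_of_nonneg (distWeight_nonneg Ω x)]
      exact mul_le_mul_of_nonneg_right h1.le (norm_nonneg _)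

/-- Multiplication by the weight replaces local convergence by convergence in the single complete
space `L²(ℝ^d)`: the slices are controlled on `{η ≤ W}` by the oscillation hypothesis, and elsewhere
by `η` times the uniform bound. The weighted slices are extended by continuity and divided by the
weight. -/
theorem exists_continuous_extension {Ω : Set (Space d)} (hΩ : IsOpen Ω)
    (hΩb : Bornology.IsBounded Ω) (hne : Ωᶜ.Nonempty) {I S : Set ℝ} (hSI : I ⊆ closure S)
    {u : ℝ × Space d → ℝ} {C : ℝ≥0}
    (hSm : ∀ t ∈ S, AEStronglyMeasurable (fun x => u (t, x)) volume)
    (hSC : ∀ t ∈ S, eLpNorm (fun x => u (t, x)) 2 volume ≤ C)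
    (hosc : ∀ t₀ ∈ I, ∀ K ⊆ Ω, IsCompact K → ∀ ε : ℝ, 0 < ε → ∃ δ > 0, ∀ t ∈ S, ∀ t' ∈ S,
      |t - t₀| < δ → |t' - t₀| < δ →
      eLpNorm (fun x => u (t, x) - u (t', x)) 2 (volume.restrict K) ≤ ENNReal.ofReal ε) :
    ∃ v : ℝ × Space d → ℝ, (∀ t ∈ S, ∀ x, v (t, x) = u (t, x)) ∧
      (∀ t ∈ I, MemLp (fun x => v (t, x)) 2 (volume.restrict Ω)) ∧
      ∀ K ⊆ Ω, IsCompact K → ∀ t₀ ∈ I,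
        Tendsto (fun t => eLpNorm (fun x => v (t, x) - v (t₀, x)) 2 (volume.restrict K))
          (𝓝[I] t₀) (𝓝 0) := by
  classical
  set W := distWeight Ω with hW
  have hWc : Continuous W := continuous_distWeight Ω
  have hWpos : ∀ x ∈ Ω, 0 < W x := fun x hx => distWeight_pos hΩ hne hx
  have hmem : ∀ t ∈ S, MemLp (fun x => W x * u (t, x)) 2 volume := fun t ht => by
    refine MemLp.mono (⟨hSm t ht, (hSC t ht).trans_lt ENNReal.coe_lt_top⟩ :
      MemLp (fun x => u (t, x)) 2 volume) (hWc.aestronglyMeasurable.mul (hSm t ht))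
      (ae_of_all _ fun x => ?_)
    rw [norm_mul, Real.norm_of_nonneg (distWeight_nonneg Ω x)]
    exact mul_le_of_le_one_left (norm_nonneg _) (distWeight_le_one Ω x)
  let T : ℝ → Lp ℝ 2 (volume : Measure (Space d)) := fun t =>
    if h : MemLp (fun x => W x * u (t, x)) 2 volume then h.toLp _ else 0
  have hT : ∀ t (ht : t ∈ S), T t = (hmem t ht).toLp _ := fun t ht => dif_pos (hmem t ht)
  have hlim : ∀ t₀ ∈ I, ∃ y, Tendsto T (𝓝[S] t₀) (𝓝 y) := by
    intro t₀ ht₀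
    have hb : (𝓝[S] t₀).NeBot := mem_closure_iff_nhdsWithin_neBot.1 (hSI ht₀)
    rw [← cauchy_map_iff_exists_tendsto, Metric.cauchy_iff]
    refine ⟨hb.map T, fun ε hε => ?_⟩
    obtain ⟨η, hη, hηC⟩ : ∃ η : ℝ, 0 < η ∧ η * (2 * C) ≤ ε / 3 := by
      refine ⟨ε / 3 / (2 * C + 1), by positivity, ?_⟩
      rw [div_mul_eq_mul_div, div_le_iff₀ (by positivity)]
      nlinarith [C.2]
    obtain ⟨hK, hKΩ⟩ := isCompact_le_distWeight hΩb hη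
    obtain ⟨δ, hδ, hδ'⟩ := hosc t₀ ht₀ _ hKΩ hK (ε / 3) (by positivity)
    refine ⟨T '' (S ∩ Metric.ball t₀ δ), image_mem_map ?_, ?_⟩
    · exact inter_mem self_mem_nhdsWithin
        (mem_nhdsWithin_of_mem_nhds (Metric.ball_mem_nhds t₀ hδ))
    · rintro _ ⟨t, ⟨ht, htδ⟩, rfl⟩ _ ⟨t', ⟨ht', htδ'⟩, rfl⟩
      rw [hT t ht, hT t' ht', ← edist_lt_ofReal, Lp.edist_toLp_toLp]
      have e : ((fun x => W x * u (t, x)) - fun x => W x * u (t', x)) =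
          fun x => W x * (u (t, x) - u (t', x)) := by
        funext x
        simp only [Pi.sub_apply]
        ring
      have hfin : ENNReal.ofReal η * eLpNorm (fun x => u (t, x) - u (t', x)) 2 volume ≤
          ENNReal.ofReal (ε / 3) := by
        have h1 : eLpNorm (fun x => u (t, x) - u (t', x)) 2 volume ≤ ENNReal.ofReal (2 * C) := by
          refine (eLpNorm_sub_le (hSm t ht) (hSm t' ht') one_le_two).trans
            ((add_le_add (hSC t ht) (hSC t' ht')).trans_eq ?_)
          rw [← two_mul, ENNReal.ofReal_mul zero_le_two]
          simp
        calc _ ≤ ENNReal.ofReal η * ENNReal.ofReal (2 * C) := by gcongr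
          _ = ENNReal.ofReal (η * (2 * C)) := (ENNReal.ofReal_mul hη.le).symm
          _ ≤ _ := ENNReal.ofReal_le_ofReal hηC
      rw [e]
      refine ((eLpNorm_distWeight_mul_le hη.le ((hSm t ht).sub (hSm t' ht'))).trans
        (add_le_add (hδ' t ht t' ht' htδ htδ') hfin)).trans_lt ?_
      rw [← ENNReal.ofReal_add (by positivity) (by positivity)]
      exact (ENNReal.ofReal_lt_ofReal_iff hε).2 (by linarith)
  have hcont : ContinuousOn (extendFrom S T) I := continuousOn_extendFrom hSI hlim
  have hext : ∀ t ∈ I, t ∈ S → extendFrom S T t = T t := by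
    intro t ht htS
    obtain ⟨y, hy⟩ := hlim t ht
    rw [extendFrom_eq (hSI ht) hy]
    exact tendsto_nhds_unique (hy.mono_left (pure_le_nhdsWithin htS)) (tendsto_pure_nhds T t)
  set e : ℝ → Lp ℝ 2 (volume : Measure (Space d)) := extendFrom S T with he
  -- On `S` the values of `u` are kept verbatim, so `v` agrees with `u` at every point there and
  -- inherits joint measurability once `S` has full measure.
  let v : ℝ × Space d → ℝ := fun z =>
    if z.1 ∈ S then u z else e z.1 z.2 / W z.2
  have hvS : ∀ t ∈ S, ∀ x, v (t, x) = u (t, x) := fun t ht x => if_pos ht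
  have hWv : ∀ t ∈ I, ∀ᵐ x ∂(volume.restrict Ω),
      v (t, x) = e t x / W x := by
    intro t ht
    by_cases htS : t ∈ S
    · rw [hext t ht htS, hT t htS, ae_restrict_iff' hΩ.measurableSet]
      filter_upwards [(hmem t htS).coeFn_toLp] with x hx hxΩ
      rw [hvS t htS, hx, mul_div_cancel_left₀ _ (hWpos x hxΩ).ne']
    · exact ae_of_all _ fun x => if_neg htS
  refine ⟨v, hvS, fun t ht => ?_, fun K hKΩ hK t₀ ht₀ => ?_⟩
  -- Square integrability of `W v` gives none for `v` near the boundary. It comes from the uniform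
  -- bound `C` and Fatou's lemma along times of `S` whose slices converge almost everywhere.
  · obtain ⟨s, hsS, hst⟩ := mem_closure_iff_seq_limit.1 (hSI ht)
    obtain ⟨y, hy⟩ := hlim t ht
    have h1 : Tendsto (fun n => T (s n)) atTop (𝓝 (e t)) := by
      rw [he, extendFrom_eq (hSI ht) hy]
      exact hy.comp (tendsto_nhdsWithin_iff.2 ⟨hst, Eventually.of_forall hsS⟩)
    rw [Lp.tendsto_Lp_iff_tendsto_eLpNorm'] at h1
    obtain ⟨r, -, hr⟩ := (tendstoInMeasure_of_tendsto_eLpNorm (by norm_num)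
      (fun n => Lp.aestronglyMeasurable _) (Lp.aestronglyMeasurable _) h1).exists_seq_tendsto_ae
    have hall : ∀ᵐ x, ∀ n, T (s n) x = W x * u (s n, x) := ae_all_iff.2 fun n => by
      rw [hT _ (hsS n)]
      exact (hmem _ (hsS n)).coeFn_toLp
    have h2 : ∀ᵐ x ∂(volume.restrict Ω), Tendsto (fun n => u (s (r n), x)) atTop
        (𝓝 (v (t, x))) := by
      filter_upwards [ae_restrict_of_ae hr, hWv t ht, ae_restrict_of_ae hall,
        ae_restrict_mem hΩ.measurableSet] with x hx hx2 hx3 hxΩ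
      rw [hx2]
      refine (hx.div_const (W x)).congr fun n => ?_
      rw [hx3, mul_div_cancel_left₀ _ (hWpos x hxΩ).ne']
    refine ⟨?_, ?_⟩
    · refine AEStronglyMeasurable.congr ?_ (EventuallyEq.symm (hWv t ht))
      exact ((Lp.aestronglyMeasurable (e t)).restrict.aemeasurable.div
        hWc.measurable.aemeasurable).aestronglyMeasurable
    · refine (Lp.eLpNorm_lim_le_liminf_eLpNorm (fun n => (hSm _ (hsS (r n))).restrict) _
        h2).trans_lt (lt_of_le_of_lt ?_ (ENNReal.coe_lt_top (r := C)))
      refine liminf_le_of_le (by isBoundedDefault) fun b hb => ?_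
      obtain ⟨n, hn⟩ := hb.exists
      exact hn.trans ((eLpNorm_mono_measure _ Measure.restrict_le_self).trans (hSC _ (hsS _)))
  -- The weight has a positive minimum on a compact subset of `Ω`, so dividing by it costs only the
  -- factor `η⁻¹`.
  · obtain ⟨η, hη, hηK⟩ := hK.exists_forall_le' hWc.continuousOn (a := 0)
      fun x hx => hWpos x (hKΩ hx)
    have h2 : Tendsto (fun t => ENNReal.ofReal η⁻¹ *
        edist (e t) (e t₀)) (𝓝[I] t₀) (𝓝 0) := by
      have := tendsto_iff_edist_tendsto_0.1 (hcont t₀ ht₀)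
      simpa using ENNReal.Tendsto.const_mul this (Or.inr ENNReal.ofReal_ne_top)
    refine tendsto_of_tendsto_of_tendsto_of_le_of_le' tendsto_const_nhds h2
      (Eventually.of_forall fun _ => zero_le) ?_
    filter_upwards [self_mem_nhdsWithin] with t ht
    rw [Lp.edist_def]
    refine (eLpNorm_le_mul_eLpNorm_of_ae_le_mul (g := (e t : Space d → ℝ) - (e t₀ : Space d → ℝ))
      (c := η⁻¹) ?_ 2).trans ?_
    · filter_upwards [ae_restrict_of_ae_restrict_of_subset hKΩ (hWv t ht),
        ae_restrict_of_ae_restrict_of_subset hKΩ (hWv t₀ ht₀),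
        ae_restrict_mem hK.measurableSet] with x hx hx₀ hxK
      rw [hx, hx₀, ← sub_div, div_eq_inv_mul, norm_mul, norm_inv, Pi.sub_apply,
        Real.norm_of_nonneg (distWeight_nonneg Ω x)]
      gcongr
      exact hηK x hxK
    · exact mul_le_mul_right (eLpNorm_mono_measure
        ((e t : Space d → ℝ) - (e t₀ : Space d → ℝ)) Measure.restrict_le_self) _

theorem measurableSet_cylinder {T₁ T₂ : ℝ} {Ω : Set (Space d)} (hΩ : IsOpen Ω) :
    MeasurableSet (cylinder T₁ T₂ Ω) :=
  measurableSet_Ioo.prod hΩ.measurableSet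

/-- The times at which the slice is measurable and bounded and both families of mollifications
converge have full measure, hence are dense, and `exists_continuous_extension` applies to them. -/
theorem exists_isTimeContinuousRep {T₁ T₂ : ℝ} (hT : T₁ < T₂) {Ω : Set (Space d)}
    (hΩ : IsOpen Ω) (hΩb : Bornology.IsBounded Ω) (hne : Ωᶜ.Nonempty)
    {u : ℝ × Space d → ℝ} (huL : InLinftyL2 T₁ T₂ Ω u)
    {f : ℝ × Space d → ℝ} {F G : ℝ × Space d → Space d}
    (hu : MemLp ((cylinder T₁ T₂ Ω).indicator u) 2) (hf : MemLp f 2)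
    (hF : MemLp F 2) (hG : MemLp G 2)
    (hgrad : ∀ φ, IsTestFunction (cylinder T₁ T₂ Ω) φ →
      ∫ y, (cylinder T₁ T₂ Ω).indicator u y • spaceGrad φ y = -∫ y, φ y • G y)
    (heq : ∀ φ, IsTestFunction (cylinder T₁ T₂ Ω) φ →
      divForm ((cylinder T₁ T₂ Ω).indicator u) F f φ = 0) :
    ∃ v, IsTimeContinuousRep T₁ T₂ Ω u v := by
  set w := (cylinder T₁ T₂ Ω).indicator u with hw
  obtain ⟨k, hk⟩ := exists_isGoodMollifier (d := d) (σ := -1) (by simp) hu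
  obtain ⟨l, hl⟩ := exists_isGoodMollifier (d := d) (σ := 1) (by simp) hu
  obtain ⟨C, hC⟩ := huL.bounded
  let D : Set ℝ := {t | AEStronglyMeasurable (fun x => w (t, x)) volume ∧
    (t ∈ Ioo T₁ T₂ → eLpNorm (fun x => w (t, x)) 2 volume ≤ C) ∧
    Tendsto (fun n => eLpNorm (fun x => mollify volume (k n) w (t, x) - w (t, x)) 2 volume)
      atTop (𝓝 0) ∧
    Tendsto (fun n => eLpNorm (fun x => mollify volume (l n) w (t, x) - w (t, x)) 2 volume)
      atTop (𝓝 0)}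
  have hD : ∀ᵐ t, t ∈ D := by
    have h1 : ∀ᵐ t : ℝ, AEStronglyMeasurable (fun x => w (t, x)) volume := by
      have := hu.1
      rw [Measure.volume_eq_prod] at this
      exact this.prodMk_left
    filter_upwards [h1, (ae_restrict_iff' measurableSet_Ioo).1 hC, hk.ae_slice, hl.ae_slice]
      with t h1 h2 h3 h4
    refine ⟨h1, fun ht => ?_, h3, h4⟩
    have e : (fun x => w (t, x)) = Ω.indicator fun x => u (t, x) := by
      funext x
      by_cases hx : x ∈ Ω <;> simp [hw, cylinder, hx, ht.1, ht.2]
    rw [e, eLpNorm_indicator_eq_eLpNorm_restrict hΩ.measurableSet]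
    exact h2 ht
  have hDd : Dense D := Measure.dense_of_ae hD
  set S := Ioo T₁ T₂ ∩ D with hS
  have hSI : Icc T₁ T₂ ⊆ closure S := by
    rw [← closure_Ioo hT.ne]
    exact closure_minimal (hDd.open_subset_closure_inter isOpen_Ioo) isClosed_closure
  obtain ⟨v, hvS, hvm, hvc⟩ := exists_continuous_extension hΩ hΩb hne hSI (u := w) (C := C)
    (fun t ht => ht.2.1) (fun t ht => ht.2.2.1 ht.1) (by
      intro t₀ ht₀ K hKΩ hK ε hε
      -- Near `T₂` the kernels must look into the past (`l`); near every other time, `T₁` included,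
      -- those looking into the future (`k`) serve.
      rcases ht₀.2.eq_or_lt with h | h
      · obtain ⟨δ, hδ, hδ'⟩ := exists_oscillation_le (α := (T₁ + T₂) / 2) (β := T₂) hΩ hK hKΩ
          (by linarith) le_rfl (by linarith) (Or.inr ⟨rfl, by linarith⟩)
          hl.toIsTimeShiftedMollifier hu hf hF hG hgrad heq
          (S := S) (fun t ht => ht.2.1) (fun t ht => ht.2.2.2.2) hε
        refine ⟨min (δ / 2) ((T₂ - T₁) / 2), lt_min (by positivity) (by linarith),
          fun t ht t' ht' h1 h2 => ?_⟩
        rw [lt_min_iff, abs_lt, abs_lt] at h1 h2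
        refine hδ' t ⟨ht, ?_, ht.1.2.le⟩ t' ⟨ht', ?_, ht'.1.2.le⟩ ?_
        · linarith
        · linarith
        · rw [abs_lt]
          constructor <;> linarith
      · obtain ⟨δ, hδ, hδ'⟩ := exists_oscillation_le (α := T₁) (β := (t₀ + T₂) / 2) hΩ hK hKΩ
          le_rfl (by linarith) (by linarith [ht₀.1]) (Or.inl ⟨rfl, by linarith⟩)
          hk.toIsTimeShiftedMollifier hu hf hF hG hgrad heq
          (S := S) (fun t ht => ht.2.1) (fun t ht => ht.2.2.2.1) hε
        refine ⟨min (δ / 2) ((T₂ - t₀) / 2), lt_min (by positivity) (by linarith),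
          fun t ht t' ht' h1 h2 => ?_⟩
        rw [lt_min_iff, abs_lt, abs_lt] at h1 h2
        refine hδ' t ⟨ht, ht.1.1.le, ?_⟩ t' ⟨ht', ht'.1.1.le, ?_⟩ ?_
        · linarith
        · linarith
        · rw [abs_lt]
          constructor <;> linarith)
  refine ⟨v, ?_, hvm, hvc⟩
  have h1 : ∀ᵐ z : ℝ × Space d, z.1 ∈ D := by
    rw [Measure.volume_eq_prod]
    exact Measure.quasiMeasurePreserving_fst.ae hD
  have hQ := measurableSet_cylinder (T₁ := T₁) (T₂ := T₂) hΩ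
  filter_upwards [ae_restrict_of_ae h1, ae_restrict_mem hQ] with z hz hzQ
  rw [hvS z.1 ⟨hzQ.1, hz⟩, hw, indicator_of_mem hzQ]

end Representative

/-! ### Representation of the time derivative in divergence form -/

section DualSpace

variable {d : ℕ}

/-- The bound makes `ℓ` vanish on the kernel of `ι`, so it descends to a bounded functional on the
range. Hahn–Banach extends it to `H`, and Riesz represents it. -/
theorem exists_inner_eq_of_bound {V H : Type*} [AddCommGroup V] [Module ℝ V]
    [NormedAddCommGroup H] [InnerProductSpace ℝ H] [CompleteSpace H] (ι : V →ₗ[ℝ] H)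
    (ℓ : V →ₗ[ℝ] ℝ) {C : ℝ} (h : ∀ v, |ℓ v| ≤ C * ‖ι v‖) : ∃ y : H, ∀ v, ℓ v = ⟪y, ι v⟫ := by
  obtain ⟨s, hs⟩ := ι.rangeRestrict.exists_rightInverse_of_surjective
    (LinearMap.range_eq_top.2 ι.surjective_rangeRestrict)
  have hs' : ∀ y : LinearMap.range ι, ι (s y) = y := fun y =>
    congrArg Subtype.val (LinearMap.congr_fun hs y)
  let L : LinearMap.range ι →L[ℝ] ℝ := (ℓ ∘ₗ s).mkContinuous C fun y => by
    have := h (s y)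
    rwa [hs'] at this
  obtain ⟨g, hg, -⟩ := exists_extension_norm_eq (LinearMap.range ι) L
  refine ⟨(InnerProductSpace.toDual ℝ H).symm g, fun v => ?_⟩
  rw [InnerProductSpace.toDual_symm_apply]
  have h1 : g (ι v) = ℓ (s ⟨ι v, v, rfl⟩) := hg ⟨ι v, v, rfl⟩
  have h2 := h (v - s ⟨ι v, v, rfl⟩)
  rw [map_sub, map_sub, hs', sub_self, norm_zero, mul_zero] at h2
  rw [h1]
  exact sub_eq_zero.1 (abs_eq_zero.1 (le_antisymm h2 (abs_nonneg _)))

theorem hasCompactSupport_spaceGrad {φ : ℝ × Space d → ℝ} (hφ : Differentiable ℝ φ)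
    (hc : HasCompactSupport φ) : HasCompactSupport (spaceGrad φ) := by
  refine HasCompactSupport.intro hc.isCompact fun z hz => ?_
  refine ext_inner_right ℝ fun v => ?_
  rw [inner_spaceGrad (hφ z), image_eq_zero_of_notMem_tsupport
    (fun h => hz (tsupport_fderiv_subset ℝ h))]
  simp

theorem hasCompactSupport_timeDeriv {φ : ℝ × Space d → ℝ} (hφ : Differentiable ℝ φ)
    (hc : HasCompactSupport φ) : HasCompactSupport (timeDeriv φ) := by
  refine HasCompactSupport.intro hc.isCompact fun z hz => ?_
  rw [fderiv_time_slice (hφ z), image_eq_zero_of_notMem_tsupport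
    (fun h => hz (tsupport_fderiv_subset ℝ h))]
  simp

section

variable {S : Set (ℝ × Space d)} {φ φ' : ℝ × Space d → ℝ}

theorem IsTestFunction.differentiable {X : Type*} [NormedAddCommGroup X] [NormedSpace ℝ X]
    {S : Set X} {φ : X → ℝ} (h : IsTestFunction S φ) : Differentiable ℝ φ :=
  h.smooth.differentiable (by simp)

theorem IsTestFunction.continuous_spaceGrad (h : IsTestFunction S φ) :
    Continuous (spaceGrad φ) :=
  ParabolicDG.continuous_spaceGrad (h.smooth.of_le (by simp))

theorem IsTestFunction.memLp_spaceGrad (h : IsTestFunction S φ) (p : ℝ≥0∞) :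
    MemLp (spaceGrad φ) p :=
  h.continuous_spaceGrad.memLp_of_hasCompactSupport
    (hasCompactSupport_spaceGrad h.differentiable h.compact)

theorem IsTestFunction.memLp_timeDeriv (h : IsTestFunction S φ) (p : ℝ≥0∞) :
    MemLp (timeDeriv φ) p :=
  (continuous_timeDeriv (h.smooth.of_le (by simp))).memLp_of_hasCompactSupport
    (hasCompactSupport_timeDeriv h.differentiable h.compact)

theorem IsTestFunction.memLp_volume (h : IsTestFunction S φ) (p : ℝ≥0∞) : MemLp φ p :=
  h.smooth.continuous.memLp_of_hasCompactSupport h.compact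

theorem IsTestFunction.add (h : IsTestFunction S φ) (h' : IsTestFunction S φ') :
    IsTestFunction S (φ + φ') :=
  ⟨h.smooth.add h'.smooth, h.compact.add h'.compact,
    (tsupport_add φ φ').trans (union_subset h.support_subset h'.support_subset)⟩

theorem IsTestFunction.const_smul (h : IsTestFunction S φ) (c : ℝ) : IsTestFunction S (c • φ) :=
  ⟨h.smooth.const_smul c, h.compact.smul_left (f := fun _ => c),
    (closure_mono (Function.support_const_smul_subset c φ)).trans h.support_subset⟩

theorem isTestFunction_zero : IsTestFunction S (0 : ℝ × Space d → ℝ) :=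
  ⟨contDiff_const, HasCompactSupport.zero, by simp [tsupport]⟩

theorem spaceGrad_add {z : ℝ × Space d} (h : DifferentiableAt ℝ φ z)
    (h' : DifferentiableAt ℝ φ' z) : spaceGrad (φ + φ') z = spaceGrad φ z + spaceGrad φ' z := by
  refine ext_inner_right ℝ fun v => ?_
  rw [inner_spaceGrad (h.add h'), inner_add_left, inner_spaceGrad h, inner_spaceGrad h',
    fderiv_add h h']
  rfl

theorem spaceGrad_const_smul {z : ℝ × Space d} (h : DifferentiableAt ℝ φ z) (c : ℝ) :
    spaceGrad (c • φ) z = c • spaceGrad φ z := by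
  refine ext_inner_right ℝ fun v => ?_
  rw [inner_spaceGrad (h.const_smul c), real_inner_smul_left, inner_spaceGrad h,
    fderiv_const_smul h]
  rfl

theorem timeDeriv_add {z : ℝ × Space d} (h : DifferentiableAt ℝ φ z)
    (h' : DifferentiableAt ℝ φ' z) : timeDeriv (φ + φ') z = timeDeriv φ z + timeDeriv φ' z := by
  rw [fderiv_time_slice (h.add h'), fderiv_time_slice h, fderiv_time_slice h', fderiv_add h h']
  rfl

theorem timeDeriv_const_smul {z : ℝ × Space d} (h : DifferentiableAt ℝ φ z) (c : ℝ) :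
    timeDeriv (c • φ) z = c * timeDeriv φ z := by
  rw [fderiv_time_slice (h.const_smul c), fderiv_time_slice h, fderiv_const_smul h]
  rfl

end

theorem cylMeasure_eq_prod (T₁ T₂ : ℝ) (Ω : Set (Space d)) : cylMeasure T₁ T₂ Ω =
    (volume.restrict (Ioo T₁ T₂)).prod (volume.restrict Ω) := by
  rw [cylMeasure, cylinder, Measure.volume_eq_prod, Measure.prod_restrict]

theorem norm_toLp_sq {α : Type*} [MeasurableSpace α] {μ : Measure α} {E : Type*}
    [NormedAddCommGroup E] {g : α → E} (hg : MemLp g 2 μ) :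
    ‖hg.toLp g‖ ^ 2 = ∫ x, ‖g x‖ ^ 2 ∂μ := by
  rw [Lp.norm_toLp, integral_norm_sq_eq hg.1]

theorem norm_toLp_pair_sq {α : Type*} [MeasurableSpace α] {μ : Measure α} {g : α → ℝ}
    {w : α → Space d} (hg : MemLp g 2 μ) (hw : MemLp w 2 μ) :
    ‖(WithLp.toLp 2 (hg.toLp g, hw.toLp w) : WithLp 2 (Lp ℝ 2 μ × Lp (Space d) 2 μ))‖ ^ 2 =
      (∫ x, g x ^ 2 ∂μ) + ∫ x, ‖w x‖ ^ 2 ∂μ := by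
  rw [WithLp.prod_norm_sq_eq_of_L2]
  refine congrArg₂ (· + ·) ((norm_toLp_sq hg).trans ?_) (norm_toLp_sq hw)
  simp

theorem integral_mul_le_sqrt_mul_sqrt {α : Type*} [MeasurableSpace α] {μ : Measure α}
    {f g : α → ℝ} (hf0 : ∀ x, 0 ≤ f x) (hg0 : ∀ x, 0 ≤ g x) (hf : MemLp f 2 μ)
    (hg : MemLp g 2 μ) :
    ∫ x, f x * g x ∂μ ≤ √(∫ x, f x ^ 2 ∂μ) * √(∫ x, g x ^ 2 ∂μ) := by
  have h := integral_mul_le_Lp_mul_Lq_of_nonneg (μ := μ) Real.HolderConjugate.two_two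
    (ae_of_all _ hf0) (ae_of_all _ hg0) (by simpa using hf) (by simpa using hg)
  simpa [Real.sqrt_eq_rpow] using h

theorem IsTestFunction.norm_toH10_sq {Ω : Set (Space d)} {φ : Space d → ℝ}
    (h : IsTestFunction Ω φ) :
    ‖h.toH10‖ ^ 2 = ∫ x in Ω, (φ x ^ 2 + ‖gradient φ x‖ ^ 2) := by
  have h2 : Integrable (fun x => ‖gradient φ x‖ ^ 2) (volume.restrict Ω) :=
    h.memLp_gradient.norm.integrable_sq
  rw [integral_add h.memLp.integrable_sq h2]
  exact norm_toLp_pair_sq h.memLp h.memLp_gradient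

/-- Cauchy–Schwarz in time applied to `n N`; Fubini turns the integral of `N²` into the space-time
norm of `(φ, ∇φ)`. -/
theorem abs_integral_le_of_slice_bound {T₁ T₂ : ℝ} {Ω : Set (Space d)} {n N F : ℝ → ℝ}
    (hn : MemLp n 2 (volume.restrict (Ioo T₁ T₂))) (hn0 : ∀ t, 0 ≤ n t) (hN0 : ∀ t, 0 ≤ N t)
    (hF : ∀ t, ‖F t‖ ≤ n t * N t) {φ : ℝ × Space d → ℝ}
    (hφ : IsTestFunction (cylinder T₁ T₂ Ω) φ)
    (hN : ∀ t, N t ^ 2 = ∫ x in Ω, (φ (t, x) ^ 2 + ‖spaceGrad φ (t, x)‖ ^ 2)) :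
    |∫ t in Ioo T₁ T₂, F t| ≤ √(∫ t in Ioo T₁ T₂, n t ^ 2) *
      √((∫ z, φ z ^ 2 ∂(cylMeasure T₁ T₂ Ω)) +
        ∫ z, ‖spaceGrad φ z‖ ^ 2 ∂(cylMeasure T₁ T₂ Ω)) := by
  have i1 : Integrable (fun z => φ z ^ 2) (cylMeasure T₁ T₂ Ω) :=
    ((hφ.memLp_volume 2).restrict _).integrable_sq
  have i2 : Integrable (fun z => ‖spaceGrad φ z‖ ^ 2) (cylMeasure T₁ T₂ Ω) :=
    ((hφ.memLp_spaceGrad 2).restrict _).norm.integrable_sq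
  have i3 : Integrable (fun z => φ z ^ 2 + ‖spaceGrad φ z‖ ^ 2) (cylMeasure T₁ T₂ Ω) :=
    i1.add i2
  rw [← integral_add i1 i2]
  rw [cylMeasure_eq_prod] at i3 ⊢
  have i4 := i3.integral_prod_left
  rw [integral_prod _ i3]
  simp_rw [← hN] at i4 ⊢
  -- Measurability of `N` is read off from `N = √(N²)`, where `N²` is a partial integral of an
  -- integrable function.
  have hNm : AEStronglyMeasurable N (volume.restrict (Ioo T₁ T₂)) := by
    have := Real.continuous_sqrt.comp_aestronglyMeasurable i4.1
    simpa [Real.sqrt_sq (hN0 _)] using this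
  have hN2 : MemLp N 2 (volume.restrict (Ioo T₁ T₂)) :=
    (memLp_two_iff_integrable_sq hNm).2 i4
  refine le_trans ?_ (integral_mul_le_sqrt_mul_sqrt hn0 hN0 hn hN2)
  -- No measurability of `F` enters: if `F` is not integrable, its integral is zero by convention
  -- and the bound persists.
  exact norm_integral_le_of_norm_le (hn.integrable_mul hN2) (ae_of_all _ hF)

theorem memLp_norm_dual {α : Type*} [MeasurableSpace α] {μ : Measure α} {E : Type*}
    [NormedAddCommGroup E] [NormedSpace ℝ E] {f : α → StrongDual ℝ E} {p : ℝ≥0∞}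
    (hf : MemLp f p μ) : MemLp (fun t => ‖f t‖) p μ :=
  hf.norm

theorem abs_integral_dual_le {T₁ T₂ : ℝ} {Ω : Set (Space d)} {f : ℝ → HMinusOne Ω}
    (hf : MemLp f 2 (volume.restrict (Ioo T₁ T₂))) {φ : ℝ × Space d → ℝ}
    (hφ : IsTestFunction (cylinder T₁ T₂ Ω) φ) :
    |∫ t in Ioo T₁ T₂, f t (hφ.slice t).toH10| ≤ √(∫ t in Ioo T₁ T₂, ‖f t‖ ^ 2) *
      √((∫ z, φ z ^ 2 ∂(cylMeasure T₁ T₂ Ω)) +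
        ∫ z, ‖spaceGrad φ z‖ ^ 2 ∂(cylMeasure T₁ T₂ Ω)) :=
  abs_integral_le_of_slice_bound (n := fun t => ‖f t‖) (N := fun t => ‖(hφ.slice t).toH10‖)
    (memLp_norm_dual hf) (fun t => (f t).opNorm_nonneg) (fun _ => norm_nonneg _)
    (fun t => (f t).le_opNorm _) hφ fun t => (hφ.slice t).norm_toH10_sq

/-- On test functions the distribution `∂ₜu` is bounded by the `L²(Q)` norm of the pair `(φ, ∇φ)`,
so it is pairing with some `(a, b)`. In other words `∂ₜu = a - div b`, the divergence form which the
mollification argument needs. -/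
theorem TimeDerivInL2HMinusOne.exists_repr {T₁ T₂ : ℝ} {Ω : Set (Space d)}
    {u : ℝ × Space d → ℝ} (h : TimeDerivInL2HMinusOne T₁ T₂ Ω u)
    (hu : MemLp u 2 (cylMeasure T₁ T₂ Ω)) :
    ∃ (a : ℝ × Space d → ℝ) (b : ℝ × Space d → Space d), MemLp a 2 (cylMeasure T₁ T₂ Ω) ∧
      MemLp b 2 (cylMeasure T₁ T₂ Ω) ∧ ∀ φ, IsTestFunction (cylinder T₁ T₂ Ω) φ →
        -∫ z, u z * timeDeriv φ z ∂(cylMeasure T₁ T₂ Ω) =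
          (∫ z, a z * φ z ∂(cylMeasure T₁ T₂ Ω)) +
            ∫ z, ⟪b z, spaceGrad φ z⟫ ∂(cylMeasure T₁ T₂ Ω) := by
  obtain ⟨f, hf, hfu⟩ := h
  set Q := cylinder T₁ T₂ Ω
  set μ := cylMeasure T₁ T₂ Ω
  let V : Submodule ℝ (ℝ × Space d → ℝ) :=
    { carrier := {φ | IsTestFunction Q φ}
      add_mem' := fun h h' => IsTestFunction.add h h'
      zero_mem' := isTestFunction_zero
      smul_mem' := fun c _ h => IsTestFunction.const_smul h c }
  have hV : ∀ φ : V, IsTestFunction Q (φ : ℝ × Space d → ℝ) := fun φ => φ.2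
  have m1 : ∀ φ : V, MemLp (φ : ℝ × Space d → ℝ) 2 μ := fun φ => ((hV φ).memLp_volume 2).restrict _
  have m2 : ∀ φ : V, MemLp (spaceGrad (φ : ℝ × Space d → ℝ)) 2 μ := fun φ =>
    ((hV φ).memLp_spaceGrad 2).restrict _
  have m3 : ∀ φ : V, MemLp (timeDeriv (φ : ℝ × Space d → ℝ)) 2 μ := fun φ =>
    ((hV φ).memLp_timeDeriv 2).restrict _
  let ι : V →ₗ[ℝ] WithLp 2 (Lp ℝ 2 μ × Lp (Space d) 2 μ) :=
    { toFun := fun φ => WithLp.toLp 2 ((m1 φ).toLp _, (m2 φ).toLp _)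
      map_add' := fun φ φ' => by
        rw [← WithLp.toLp_add, Prod.mk_add_mk, ← MemLp.toLp_add, ← MemLp.toLp_add]
        congr 2
        refine MemLp.toLp_congr _ _ (ae_of_all _ fun z => ?_)
        exact spaceGrad_add ((hV φ).differentiable z) ((hV φ').differentiable z)
      map_smul' := fun c φ => by
        rw [RingHom.id_apply, ← WithLp.toLp_smul, Prod.smul_mk, ← MemLp.toLp_const_smul,
          ← MemLp.toLp_const_smul]
        congr 2
        refine MemLp.toLp_congr _ _ (ae_of_all _ fun z => ?_)
        exact spaceGrad_const_smul ((hV φ).differentiable z) c }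
  let ℓ : V →ₗ[ℝ] ℝ :=
    { toFun := fun φ => -∫ z, u z * timeDeriv (φ : ℝ × Space d → ℝ) z ∂μ
      map_add' := fun φ φ' => by
        have i : ∀ φ : V, Integrable (fun z => u z * timeDeriv (φ : ℝ × Space d → ℝ) z) μ :=
          fun φ => hu.integrable_mul (m3 φ)
        rw [← neg_add, ← integral_add (i φ) (i φ')]
        congr 1
        refine integral_congr_ae (ae_of_all _ fun z => ?_)
        simp only [Submodule.coe_add]
        rw [timeDeriv_add ((hV φ).differentiable z) ((hV φ').differentiable z), mul_add]
      map_smul' := fun c φ => by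
        rw [RingHom.id_apply, smul_eq_mul, mul_neg, ← integral_const_mul]
        congr 1
        refine integral_congr_ae (ae_of_all _ fun z => ?_)
        simp only [Submodule.coe_smul]
        rw [timeDeriv_const_smul ((hV φ).differentiable z)]
        ring }
  have hbound : ∀ φ : V, |ℓ φ| ≤ √(∫ t in Ioo T₁ T₂, ‖f t‖ ^ 2) * ‖ι φ‖ := by
    intro φ
    have h1 := abs_integral_dual_le hf (hV φ)
    rw [← hfu _ (hV φ)] at h1
    refine h1.trans_eq ?_
    congr 1
    rw [← Real.sqrt_sq (norm_nonneg (ι φ))]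
    exact congrArg Real.sqrt (norm_toLp_pair_sq (m1 φ) (m2 φ)).symm
  obtain ⟨y, hy⟩ := exists_inner_eq_of_bound ι ℓ hbound
  refine ⟨y.fst, y.snd, Lp.memLp _, Lp.memLp _, fun φ hφ => ?_⟩
  have h1 : -∫ z, u z * timeDeriv φ z ∂μ = _ := hy ⟨φ, hφ⟩
  rw [h1, WithLp.prod_inner_apply, L2.inner_def, L2.inner_def]
  congr 1
  · refine integral_congr_ae ?_
    filter_upwards [(m1 ⟨φ, hφ⟩).coeFn_toLp] with z hz
    exact (congrArg (fun c : ℝ => ⟪(y.fst : ℝ × Space d → ℝ) z, c⟫) hz).trans (mul_comm _ _)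
  · refine integral_congr_ae ?_
    filter_upwards [(m2 ⟨φ, hφ⟩).coeFn_toLp] with z hz
    exact congrArg (fun c : Space d => ⟪(y.snd : ℝ × Space d → Space d) z, c⟫) hz

end DualSpace

/-! ### Energy inequality for smooth profiles of a subsolution -/

section ProfileLimits

variable {d : ℕ}

theorem real_inner_eq_mul (x y : ℝ) : ⟪x, y⟫ = x * y := by simp [mul_comm]

theorem IsC2Profile.abs_deriv_sub_le {Φ ϕ χ : ℝ → ℝ} (h : IsC2Profile Φ ϕ χ) (a b : ℝ) :
    |ϕ a - ϕ b| ≤ |a - b| := by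
  have := convex_univ.norm_image_sub_le_of_norm_hasDerivWithin_le (f := ϕ) (f' := χ) (C := 1)
    (fun x _ => (h.hasDerivAt_deriv x).hasDerivWithinAt) (fun x _ => h.bound x)
    (mem_univ b) (mem_univ a)
  simpa using this

theorem IsC2Profile.abs_deriv_le {Φ ϕ χ : ℝ → ℝ} (h : IsC2Profile Φ ϕ χ) (a : ℝ) :
    |ϕ a| ≤ |ϕ 0| + |a| := by
  have h1 := h.abs_deriv_sub_le a 0
  rw [sub_zero] at h1
  linarith [abs_sub_abs_le_abs_sub (ϕ a) (ϕ 0)]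

/-- Mean value inequality, where `ϕ` grows at most linearly because it is 1-Lipschitz. -/
theorem IsC2Profile.abs_sub_le {Φ ϕ χ : ℝ → ℝ} (h : IsC2Profile Φ ϕ χ) (a b : ℝ) :
    |Φ a - Φ b| ≤ (|ϕ 0| + |a| + |b|) * |a - b| := by
  refine (convex_uIcc b a).norm_image_sub_le_of_norm_hasDerivWithin_le (f := Φ) (f' := ϕ)
    (fun x _ => (h.hasDerivAt x).hasDerivWithinAt) (fun x hx => ?_) left_mem_uIcc right_mem_uIcc
  refine (h.abs_deriv_le x).trans ?_
  rw [add_assoc]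
  gcongr
  have h1 := abs_nonneg a
  have h2 := abs_nonneg b
  rcases mem_uIcc.1 hx with ⟨h3, h4⟩ | ⟨h3, h4⟩
  · rw [abs_le]
    constructor <;> linarith [neg_abs_le b, le_abs_self a]
  · rw [abs_le]
    constructor <;> linarith [neg_abs_le a, le_abs_self b]

theorem tendsto_eLpNorm_of_norm_sub_le {α E E' : Type*} [MeasurableSpace α] {μ : Measure α}
    [NormedAddCommGroup E] [NormedAddCommGroup E'] {g : ℕ → α → E} {g' : α → E} {w : ℕ → α → E'}
    {w' : α → E'} {C : ℝ} (hb : ∀ n x, ‖g n x - g' x‖ ≤ C * ‖w n x - w' x‖)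
    (hw : Tendsto (fun n => eLpNorm (w n - w') 2 μ) atTop (𝓝 0)) :
    Tendsto (fun n => eLpNorm (g n - g') 2 μ) atTop (𝓝 0) := by
  refine tendsto_of_tendsto_of_tendsto_of_le_of_le tendsto_const_nhds
    (by simpa using ENNReal.Tendsto.const_mul hw (Or.inr (ENNReal.ofReal_ne_top (r := C))))
    (fun _ => zero_le) fun n => ?_
  exact eLpNorm_le_mul_eLpNorm_of_ae_le_mul (ae_of_all _ fun x => hb n x) 2

/-- By `IsC2Profile.abs_sub_le` the error is at most the pairing of `|Uₙ - u|` with `ψ(c + |Uₙ| +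
|u|)`. The first factor tends to zero in `L²` and the second converges there. -/
theorem tendsto_integral_profile {Φ ϕ χ : ℝ → ℝ} (h : IsC2Profile Φ ϕ χ) {ψ : Space d → ℝ}
    (hψ : Continuous ψ) (hψc : HasCompactSupport ψ) (hψ0 : ∀ x, 0 ≤ ψ x) (hψ1 : ∀ x, ψ x ≤ 1)
    {U : ℕ → Space d → ℝ} {u : Space d → ℝ} (hU : ∀ n, MemLp (U n) 2) (hu : MemLp u 2)
    (hl : Tendsto (fun n => eLpNorm (U n - u) 2) atTop (𝓝 0)) :
    Tendsto (fun n => ∫ x, ψ x * Φ (U n x)) atTop (𝓝 (∫ x, ψ x * Φ (u x))) := by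
  set c := |ϕ 0|
  have hψ2 : MemLp ψ 2 := hψ.memLp_of_hasCompactSupport hψc
  have hψm := hψ.aestronglyMeasurable (μ := (volume : Measure (Space d)))
  have hmul : ∀ {v : Space d → ℝ}, MemLp v 2 → MemLp (fun x => ψ x * v x) 2 := fun {v} hv => by
    refine hv.mono (hψm.mul hv.1) (ae_of_all _ fun x => ?_)
    rw [norm_mul, Real.norm_of_nonneg (hψ0 x)]
    exact mul_le_of_le_one_left (norm_nonneg _) (hψ1 x)
  have hB : ∀ {v w : Space d → ℝ}, MemLp v 2 → MemLp w 2 →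
      MemLp (fun x => ψ x * (c + |v x| + |w x|)) 2 := fun {v w} hv hw => by
    have := ((hψ2.const_mul c).add (hmul hv.abs)).add (hmul hw.abs)
    refine this.ae_eq (ae_of_all _ fun x => ?_)
    simp only [Pi.add_apply, Pi.abs_apply]
    ring
  have hΦi : ∀ {v : Space d → ℝ}, MemLp v 2 → Integrable fun x => ψ x * Φ (v x) := by
    intro v hv
    have i1 : Integrable fun x => |Φ 0| * ψ x + |v x| * (ψ x * (c + |v x| + |v x|)) :=
      ((hψ.integrable_of_hasCompactSupport hψc).const_mul _).add
        (hv.abs.integrable_mul (hB hv hv))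
    refine i1.mono' (hψm.mul (h.continuous.comp_aestronglyMeasurable hv.1))
      (ae_of_all _ fun x => ?_)
    rw [norm_mul, Real.norm_of_nonneg (hψ0 x), Real.norm_eq_abs]
    have h1 := h.abs_sub_le (v x) 0
    rw [abs_zero, add_zero, sub_zero] at h1
    have h2 : |Φ (v x)| ≤ |Φ 0| + (c + |v x|) * |v x| := by
      linarith [abs_sub_abs_le_abs_sub (Φ (v x)) (Φ 0)]
    have h3 := mul_le_mul_of_nonneg_left h2 (hψ0 x)
    have h4 : 0 ≤ |v x| * (ψ x * |v x|) := by have := hψ0 x; positivity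
    nlinarith
  rw [tendsto_iff_norm_sub_tendsto_zero]
  have key := tendsto_integral_inner (μ := (volume : Measure (Space d)))
    (a := fun n x => |U n x - u x|) (a' := fun _ => 0)
    (b := fun n x => ψ x * (c + |U n x| + |u x|)) (b' := fun x => ψ x * (c + |u x| + |u x|))
    (fun n => ((hU n).sub hu).abs) (fun n => hB (hU n) hu) MemLp.zero' (hB hu hu)
    (tendsto_eLpNorm_of_norm_sub_le (C := 1) (fun n x => by simp) hl)
    (tendsto_eLpNorm_of_norm_sub_le (C := 1) (fun n x => by
      have e : ψ x * (c + |U n x| + |u x|) - ψ x * (c + |u x| + |u x|) =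
        ψ x * (|U n x| - |u x|) := by ring
      rw [e, norm_mul, Real.norm_of_nonneg (hψ0 x)]
      exact mul_le_mul (hψ1 x) (abs_abs_sub_abs_le_abs_sub _ _) (norm_nonneg _) zero_le_one) hl)
  simp only [inner_zero_left, integral_zero] at key
  refine squeeze_zero (fun _ => norm_nonneg _) (fun n => ?_) key
  rw [← integral_sub (hΦi (hU n)) (hΦi hu)]
  have i2 : Integrable fun x => ⟪|U n x - u x|, ψ x * (c + |U n x| + |u x|)⟫ := by
    simp only [real_inner_eq_mul]
    exact ((hU n).sub hu).abs.integrable_mul (hB (hU n) hu)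
  refine norm_integral_le_of_norm_le i2 (ae_of_all _ fun x => ?_)
  rw [← mul_sub, norm_mul, Real.norm_of_nonneg (hψ0 x), real_inner_eq_mul]
  have := mul_le_mul_of_nonneg_left (h.abs_sub_le (U n x) (u x)) (hψ0 x)
  exact this.trans_eq (by ring)

theorem memLp_slab {E : Type*} [NormedAddCommGroup E] {g : ℝ × Space d → E}
    (hc : Continuous g) {K : Set (Space d)} (hK : IsCompact K) (h0 : ∀ z, z.2 ∉ K → g z = 0)
    (s t : ℝ) : MemLp g 2 (volume.restrict (slab d s t)) := by
  have h1 : IntegrableOn (fun z => ‖g z‖ ^ 2) (slab d s t) :=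
    integrableOn_slab (hc.norm.pow 2) hK (fun z hz => by simp [h0 z hz]) s t
  have h2 := (memLp_two_iff_integrable_sq (μ := volume.restrict (slab d s t))
    hc.norm.aestronglyMeasurable).2 h1
  exact (memLp_norm_iff hc.aestronglyMeasurable).1 h2

/-- Limit of `energy_identity` along the mollifications. Convergence in `L²` handles the terms in
`ϕ`, which is Lipschitz; the term in `χ`, merely continuous and bounded, needs almost everywhere
convergence. The slice terms need convergence at the two times `s` and `t`. -/
theorem energy_inequality_profile {k : ℕ → ℝ × Space d → ℝ} {T₁ T₂ : ℝ} {Ω : Set (Space d)}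
    (hΩ : IsOpen Ω) {u f : ℝ × Space d → ℝ} {F G : ℝ × Space d → Space d}
    (hk : IsGoodMollifier (-1) k u) (hu : MemLp u 2) (hf : MemLp f 2)
    (hF : MemLp F 2) (hG : MemLp G 2)
    (hgrad : ∀ φ, IsTestFunction (cylinder T₁ T₂ Ω) φ →
      ∫ y, u y • spaceGrad φ y = -∫ y, φ y • G y)
    (hsub : ∀ φ, IsTestFunction (cylinder T₁ T₂ Ω) φ → (∀ z, 0 ≤ φ z) → divForm u F f φ ≤ 0)
    {Φ ϕ χ : ℝ → ℝ} (h : IsC2Profile Φ ϕ χ) (hϕ0 : ∀ a, 0 ≤ ϕ a) {ψ : Space d → ℝ}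
    (hψ : IsTestFunction Ω ψ) (hψ0 : ∀ x, 0 ≤ ψ x) (hψ1 : ∀ x, ψ x ≤ 1) {s t : ℝ}
    (hs : T₁ ≤ s) (hst : s < t) (ht : t < T₂)
    (hus : MemLp (fun x => u (s, x)) 2 volume) (hut : MemLp (fun x => u (t, x)) 2 volume)
    (hls : Tendsto (fun n => eLpNorm (fun x => mollify volume (k n) u (s, x) - u (s, x)) 2 volume)
      atTop (𝓝 0))
    (hlt : Tendsto (fun n => eLpNorm (fun x => mollify volume (k n) u (t, x) - u (t, x)) 2 volume)
      atTop (𝓝 0)) :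
    (∫ x, ψ x * Φ (u (t, x))) - ∫ x, ψ x * Φ (u (s, x)) ≤
      -(∫ z in slab d s t, ⟪F z, ϕ (u z) • gradient ψ z.2⟫)
      - (∫ z in slab d s t, ⟪F z, (ψ z.2 * χ (u z)) • G z⟫)
      + ∫ z in slab d s t, f z * (ψ z.2 * ϕ (u z)) := by
  have hkm := hk.toIsTimeShiftedMollifier
  set μ := (volume : Measure (ℝ × Space d)).restrict (slab d s t) with hμ
  have loc : ∀ {E : Type} [NormedAddCommGroup E] {w : ℝ × Space d → E},
      MemLp w 2 → LocallyIntegrable w := fun hw => hw.locallyIntegrable (by norm_num)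
  have hψc := hψ.smooth.continuous
  have hψg : Continuous (gradient ψ) :=
    (InnerProductSpace.toDual ℝ (Space d)).symm.continuous.comp
      (hψ.smooth.continuous_fderiv (by simp))
  have hψgc : HasCompactSupport (gradient ψ) :=
    (hψ.compact.fderiv ℝ).comp_left
      (g := fun L => (InnerProductSpace.toDual ℝ (Space d)).symm L) (by simp)
  obtain ⟨C, hC⟩ := hψgc.exists_bound_of_continuous hψg
  have hϕc := h.continuous_deriv
  have hχc := h.continuous_deriv2
  have lim : ∀ {E : Type} [NormedAddCommGroup E] [NormedSpace ℝ E] [CompleteSpace E]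
      {w : ℝ × Space d → E}, MemLp w 2 →
      Tendsto (fun n => eLpNorm (mollify volume (k n) w - w) 2 μ) atTop (𝓝 0) := fun hw =>
    tendsto_of_tendsto_of_tendsto_of_le_of_le tendsto_const_nhds (hkm.tendsto_eLpNorm hw)
      (fun _ => zero_le) fun n => eLpNorm_mono_measure _ Measure.restrict_le_self
  have hUc : ∀ n, Continuous (mollify volume (k n) u) := fun n => (hkm.contDiff hu n).continuous
  have hsliceU : ∀ τ, MemLp (fun x => u (τ, x)) 2 volume →
      Tendsto (fun n => eLpNorm (fun x => mollify volume (k n) u (τ, x) - u (τ, x)) 2 volume)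
        atTop (𝓝 0) →
      Tendsto (fun n => ∫ x, ψ x * Φ (mollify volume (k n) u (τ, x))) atTop
        (𝓝 (∫ x, ψ x * Φ (u (τ, x)))) := by
    intro τ hτ hlτ
    -- The slices of the mollifications are known to be in `L²` only for large indices, so the
    -- sequence is shifted.
    obtain ⟨N, hN⟩ := eventually_atTop.1
      (ENNReal.tendsto_nhds_zero.1 hlτ 1 one_pos)
    have hUm : ∀ n, MemLp (fun x => mollify volume (k (n + N)) u (τ, x)) 2 volume := fun n => by
      have hm : AEStronglyMeasurable (fun x => mollify volume (k (n + N)) u (τ, x)) volume := by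
        have := hUc (n + N)
        exact Continuous.aestronglyMeasurable (by fun_prop)
      have h1 : MemLp (fun x => mollify volume (k (n + N)) u (τ, x) - u (τ, x)) 2 volume :=
        ⟨hm.sub hτ.1, (hN _ (Nat.le_add_left _ _)).trans_lt ENNReal.one_lt_top⟩
      refine (h1.add hτ).ae_eq (ae_of_all _ fun x => ?_)
      simp
    have := tendsto_integral_profile h hψc hψ.compact hψ0 hψ1 hUm hτ
      (hlτ.comp (tendsto_add_atTop_nat N))
    exact (tendsto_add_atTop_iff_nat N).1 this
  have hUr : ∀ n, MemLp (mollify volume (k n) u) 2 μ := fun n => (hkm.memLp hu n).restrict _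
  have mϕψ : ∀ {v : ℝ × Space d → ℝ}, MemLp v 2 μ →
      MemLp (fun z => ψ z.2 * ϕ (v z)) 2 μ := fun {v} hv => by
    have h1 : MemLp (fun z : ℝ × Space d => ψ z.2) 2 μ := memLp_slab (by fun_prop)
      hψ.compact.isCompact (fun z hz => by simp [image_eq_zero_of_notMem_tsupport hz]) s t
    refine ((h1.const_mul |ϕ 0|).add hv.abs).mono
      (h1.1.mul (hϕc.comp_aestronglyMeasurable hv.1)) (ae_of_all _ fun z => ?_)
    have h2 := h.abs_deriv_le (v z)
    have h3 := hψ0 z.2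
    rw [norm_mul, Real.norm_of_nonneg h3, Real.norm_eq_abs, Real.norm_eq_abs]
    refine le_trans ?_ (le_abs_self _)
    simp only [Pi.add_apply, Pi.abs_apply]
    nlinarith [abs_nonneg (v z), hψ1 z.2]
  have mϕg : ∀ {v : ℝ × Space d → ℝ}, MemLp v 2 μ →
      MemLp (fun z => ϕ (v z) • gradient ψ z.2) 2 μ := fun {v} hv => by
    have h1 : MemLp (fun z : ℝ × Space d => gradient ψ z.2) 2 μ := memLp_slab (by fun_prop)
      hψgc.isCompact (fun z hz => by simp [image_eq_zero_of_notMem_tsupport hz]) s t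
    refine ((h1.norm.const_mul |ϕ 0|).add (hv.abs.const_mul C)).mono
      ((hϕc.comp_aestronglyMeasurable hv.1).smul h1.1) (ae_of_all _ fun z => ?_)
    have h2 := h.abs_deriv_le (v z)
    rw [norm_smul, Real.norm_eq_abs, Real.norm_eq_abs]
    refine le_trans ?_ (le_abs_self _)
    simp only [Pi.add_apply, Pi.abs_apply]
    nlinarith [abs_nonneg (v z), hC z.2, norm_nonneg (gradient ψ z.2)]
  have L1 := tendsto_integral_inner (μ := μ) (a := fun n => mollify volume (k n) F) (a' := F)
    (b := fun n z => ϕ (mollify volume (k n) u z) • gradient ψ z.2)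
    (b' := fun z => ϕ (u z) • gradient ψ z.2)
    (fun n => (hkm.memLp hF n).restrict _) (fun n => mϕg (hUr n)) (hF.restrict _)
    (mϕg (hu.restrict _)) (lim hF)
    (tendsto_eLpNorm_of_norm_sub_le (C := C) (fun n z => by
      rw [← sub_smul, norm_smul, mul_comm]
      exact mul_le_mul (hC _) (h.abs_deriv_sub_le _ _) (norm_nonneg _)
        ((norm_nonneg _).trans (hC z.2))) (lim hu))
  have L3 := tendsto_integral_inner (μ := μ) (a := fun n => mollify volume (k n) f) (a' := f)
    (b := fun n z => ψ z.2 * ϕ (mollify volume (k n) u z))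
    (b' := fun z => ψ z.2 * ϕ (u z))
    (fun n => (hkm.memLp hf n).restrict _) (fun n => mϕψ (hUr n)) (hf.restrict _)
    (mϕψ (hu.restrict _)) (lim hf)
    (tendsto_eLpNorm_of_norm_sub_le (C := 1) (fun n z => by
      rw [← mul_sub, norm_mul, Real.norm_of_nonneg (hψ0 _)]
      exact mul_le_mul (hψ1 _) (h.abs_deriv_sub_le _ _) (norm_nonneg _) zero_le_one) (lim hu))
  have hψχ : ∀ a x, |ψ x * χ a| ≤ 1 := fun a x => by
    rw [abs_mul, abs_of_nonneg (hψ0 x)]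
    exact mul_le_one₀ (hψ1 x) (abs_nonneg _) (h.bound a)
  have mχ : ∀ {v : ℝ × Space d → ℝ}, MemLp v 2 μ →
      AEStronglyMeasurable (fun z => ψ z.2 * χ (v z)) μ := fun hv =>
    (Continuous.aestronglyMeasurable (by fun_prop)).mul (hχc.comp_aestronglyMeasurable hv.1)
  have mχG : ∀ {v : ℝ × Space d → ℝ} {w : ℝ × Space d → Space d}, MemLp v 2 μ → MemLp w 2 μ →
      MemLp (fun z => (ψ z.2 * χ (v z)) • w z) 2 μ := fun {v w} hv hw =>
    hw.mono ((mχ hv).smul hw.1) (ae_of_all _ fun z => by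
      rw [norm_smul]
      exact mul_le_of_le_one_left (norm_nonneg _) (hψχ _ _))
  have L2 := tendsto_integral_inner (μ := μ) (a := fun n => mollify volume (k n) F) (a' := F)
    (b := fun n z => (ψ z.2 * χ (mollify volume (k n) u z)) • mollify volume (k n) G z)
    (b' := fun z => (ψ z.2 * χ (u z)) • G z)
    (fun n => (hkm.memLp hF n).restrict _)
    (fun n => mχG (hUr n) ((hkm.memLp hG n).restrict _)) (hF.restrict _)
    (mχG (hu.restrict _) (hG.restrict _)) (lim hF)
    (tendsto_eLpNorm_smul (C := 1) (fun n => mχ (hUr n)) (mχ (hu.restrict _))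
      (fun n z => hψχ _ _) (by
        filter_upwards [ae_restrict_of_ae hk.ae_tendsto] with z hz
        exact ((hχc.tendsto _).comp hz).const_mul _)
      (fun n => (hkm.memLp hG n).restrict _) (hG.restrict _) (lim hG))
  have L := ((hsliceU t hut hlt).sub (hsliceU s hus hls))
  have L3' : Tendsto (fun n => ∫ z, mollify volume (k n) f z *
      (ψ z.2 * ϕ (mollify volume (k n) u z)) ∂μ) atTop
      (𝓝 (∫ z, f z * (ψ z.2 * ϕ (u z)) ∂μ)) := by
    simpa only [real_inner_eq_mul] using L3
  have R := (L1.neg.sub L2).add L3'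
  refine le_of_tendsto_of_tendsto L R ?_
  filter_upwards [hkm.eventually_isTestFunction hΩ hψ.compact.isCompact hψ.support_subset hs
    ht.le (Or.inl ⟨rfl, ht⟩)] with n hn
  have hslab : ∀ z ∈ slab d s t, z.1 ∈ Icc s t := fun z hz => Ioo_subset_Icc_self hz.1
  rw [energy_identity h ((hkm.contDiff hu n).of_le (by simp))
    ((hkm.contDiff hF n).of_le (by simp)) (hkm.contDiff hf n).continuous
    (hψ.smooth.of_le (by simp)) hψ.compact hst.le]
  have e2 : ∫ z in slab d s t, ⟪mollify volume (k n) F z,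
      (ψ z.2 * χ (mollify volume (k n) u z)) • spaceGrad (mollify volume (k n) u) z⟫ =
      ∫ z in slab d s t, ⟪mollify volume (k n) F z,
      (ψ z.2 * χ (mollify volume (k n) u z)) • mollify volume (k n) G z⟫ := by
    refine setIntegral_congr_fun (measurableSet_slab s t) fun z hz => ?_
    by_cases hzψ : z.2 ∈ tsupport ψ
    · rw [spaceGrad_mollify (hkm.smooth n) (hkm.compact n) (loc hu)
        (hgrad _ (hn z.1 (hslab z hz) z.2 hzψ))]
    · simp [image_eq_zero_of_notMem_tsupport hzψ]
  -- The subsolution property enters here: at each point the residual is `divForm` on a nonnegative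
  -- translated kernel, multiplied by `ψ ϕ(U) ≥ 0`.
  have e4 : ∫ z in slab d s t, ψ z.2 * ϕ (mollify volume (k n) u z) *
      (timeDeriv (mollify volume (k n) u) z - spaceDiv (mollify volume (k n) F) z -
        mollify volume (k n) f z) ≤ 0 := by
    refine setIntegral_nonpos (measurableSet_slab s t) fun z hz => ?_
    by_cases hzψ : z.2 ∈ tsupport ψ
    · rw [← divForm_comp_sub_left (hkm.smooth n) (hkm.compact n) (loc hu) (loc hF)]
      exact mul_nonpos_of_nonneg_of_nonpos (mul_nonneg (hψ0 _) (hϕ0 _))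
        (hsub _ (hn z.1 (hslab z hz) z.2 hzψ) fun y => hkm.nonneg n _)
    · simp [image_eq_zero_of_notMem_tsupport hzψ]
  rw [e2]
  linarith

end ProfileLimits

/-! ### Smooth approximation of the truncation -/

section Truncation

/-- `χ n` is the linear ramp from `0` at `k` to `1` at `k + 1/(n+1)`, and `ϕ n`, `Φ n` are its
iterated primitives. As `χ n k = 0` for all `n`, the limit is the indicator of the open half-line at
every point, so nothing about the gradient on `{u = k}` has to be known. -/
theorem exists_truncation_profile (k : ℝ) :
    ∃ Φ ϕ χ : ℕ → ℝ → ℝ, (∀ n, IsC2Profile (Φ n) (ϕ n) (χ n)) ∧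
      (∀ n a, 0 ≤ ϕ n a ∧ ϕ n a ≤ max (a - k) 0) ∧
      (∀ n a, 0 ≤ Φ n a ∧ Φ n a ≤ max (a - k) 0 ^ 2) ∧
      (∀ a, Tendsto (fun n => χ n a) atTop (𝓝 ((Ioi k).indicator 1 a))) ∧
      (∀ a, Tendsto (fun n => ϕ n a) atTop (𝓝 (max (a - k) 0))) ∧
      ∀ a, Tendsto (fun n => Φ n a) atTop (𝓝 (max (a - k) 0 ^ 2 / 2)) := by
  set χ : ℕ → ℝ → ℝ := fun n a => max 0 (min 1 ((n + 1 : ℝ) * (a - k))) with hχ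
  set ϕ : ℕ → ℝ → ℝ := fun n a => ∫ b in k..a, χ n b with hϕ
  set Φ : ℕ → ℝ → ℝ := fun n a => ∫ b in k..a, ϕ n b with hΦ
  have χc : ∀ n, Continuous (χ n) := fun n => by fun_prop
  have χ0 : ∀ n a, 0 ≤ χ n a := fun n a => le_max_left _ _
  have χ1 : ∀ n a, χ n a ≤ 1 := fun n a => max_le zero_le_one (min_le_left _ _)
  have χk : ∀ n a, a ≤ k → χ n a = 0 := fun n a ha => by
    refine max_eq_left ((min_le_right _ _).trans ?_)
    have : (0 : ℝ) ≤ n + 1 := by positivity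
    nlinarith
  have ϕd : ∀ n a, HasDerivAt (ϕ n) (χ n a) a := fun n a =>
    intervalIntegral.integral_hasDerivAt_right ((χc n).intervalIntegrable _ _)
      ((χc n).stronglyMeasurableAtFilter _ _) (χc n).continuousAt
  have ϕc : ∀ n, Continuous (ϕ n) := fun n =>
    continuous_iff_continuousAt.2 fun a => (ϕd n a).continuousAt
  have Φd : ∀ n a, HasDerivAt (Φ n) (ϕ n a) a := fun n a =>
    intervalIntegral.integral_hasDerivAt_right ((ϕc n).intervalIntegrable _ _)
      ((ϕc n).stronglyMeasurableAtFilter _ _) (ϕc n).continuousAt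
  have zero_int : ∀ {h : ℝ → ℝ}, (∀ a ≤ k, h a = 0) → ∀ a ≤ k, ∫ b in k..a, h b = 0 := by
    intro h hh a ha
    rw [intervalIntegral.integral_congr (g := fun _ => (0 : ℝ))]
    · simp
    · intro b hb
      rw [uIcc_of_ge ha] at hb
      exact hh b hb.2
  have ϕk : ∀ n a, a ≤ k → ϕ n a = 0 := fun n => zero_int (χk n)
  have Φk : ∀ n a, a ≤ k → Φ n a = 0 := fun n => zero_int (ϕk n)
  have ϕb : ∀ n a, 0 ≤ ϕ n a ∧ ϕ n a ≤ max (a - k) 0 := fun n a => by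
    rcases le_total a k with h | h
    · rw [ϕk n a h]
      exact ⟨le_rfl, le_max_right _ _⟩
    · refine ⟨intervalIntegral.integral_nonneg h fun b _ => χ0 n b, ?_⟩
      refine le_trans ?_ (le_max_left _ _)
      have := intervalIntegral.integral_mono_on (g := fun _ => (1 : ℝ)) h ((χc n).intervalIntegrable _ _)
        (continuous_const.intervalIntegrable (μ := volume) _ _) fun b _ => χ1 n b
      simpa using this
  have mc : Continuous fun a : ℝ => max (a - k) 0 := by fun_prop
  have Φb : ∀ n a, 0 ≤ Φ n a ∧ Φ n a ≤ max (a - k) 0 ^ 2 := fun n a => by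
    rcases le_total a k with h | h
    · rw [Φk n a h]
      exact ⟨le_rfl, sq_nonneg _⟩
    · refine ⟨intervalIntegral.integral_nonneg h fun b _ => (ϕb n b).1, ?_⟩
      have := intervalIntegral.integral_mono_on (g := fun _ => a - k) h
        ((ϕc n).intervalIntegrable _ _)
        (continuous_const.intervalIntegrable (μ := volume) _ _) fun b hb => (ϕb n b).2.trans
          (max_le (sub_le_sub_right hb.2 k) (sub_nonneg.2 h))
      refine this.trans_eq ?_
      rw [max_eq_left (sub_nonneg.2 h), intervalIntegral.integral_const, smul_eq_mul, sq]
  have χl : ∀ a, Tendsto (fun n => χ n a) atTop (𝓝 ((Ioi k).indicator 1 a)) := fun a => by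
    by_cases h : k < a
    · rw [indicator_of_mem (mem_Ioi.2 h), Pi.one_apply]
      obtain ⟨N, hN⟩ := exists_nat_gt (1 / (a - k))
      refine tendsto_const_nhds.congr' ?_
      filter_upwards [eventually_ge_atTop N] with n hn
      have h1 : 0 < a - k := sub_pos.2 h
      have h2 : (N : ℝ) ≤ n := by exact_mod_cast hn
      rw [div_lt_iff₀ h1] at hN
      have h3 : 1 ≤ (n + 1 : ℝ) * (a - k) := by nlinarith
      simp [hχ, min_eq_left h3]
    · rw [indicator_of_notMem (by simpa using h)]
      simp only [χk _ a (not_lt.1 h)]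
      exact tendsto_const_nhds
  have ϕl : ∀ a, Tendsto (fun n => ϕ n a) atTop (𝓝 (max (a - k) 0)) := fun a => by
    rcases le_total a k with h | h
    · simp only [ϕk _ a h, max_eq_right (sub_nonpos.2 h)]
      exact tendsto_const_nhds
    · have e : max (a - k) 0 = ∫ b in k..a, (Ioi k).indicator (1 : ℝ → ℝ) b := by
        rw [max_eq_left (sub_nonneg.2 h), intervalIntegral.integral_of_le h,
          setIntegral_congr_fun (g := fun _ => (1 : ℝ)) measurableSet_Ioc fun b hb => by
            simp [hb.1]]
        simp [h]
      rw [e]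
      refine intervalIntegral.tendsto_integral_filter_of_dominated_convergence (fun _ => 1)
        (Eventually.of_forall fun n => (χc n).aestronglyMeasurable)
        (Eventually.of_forall fun n => ae_of_all _ fun b _ => ?_) intervalIntegrable_const
        (ae_of_all _ fun b _ => χl b)
      rw [Real.norm_of_nonneg (χ0 n b)]
      exact χ1 n b
  refine ⟨Φ, ϕ, χ, fun n => ⟨Φd n, ϕd n, χc n, fun a => ?_⟩, ϕb, Φb, χl, ϕl, fun a => ?_⟩
  · rw [abs_of_nonneg (χ0 n a)]
    exact χ1 n a
  · rcases le_total a k with h | h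
    · simp only [Φk _ a h, max_eq_right (sub_nonpos.2 h)]
      simp
    · have e : max (a - k) 0 ^ 2 / 2 = ∫ b in k..a, max (b - k) 0 := by
        rw [max_eq_left (sub_nonneg.2 h),
          intervalIntegral.integral_congr (g := fun b => b - k) fun b hb => by
            rw [uIcc_of_le h] at hb
            exact max_eq_left (sub_nonneg.2 hb.1)]
        simp
        ring
      rw [e]
      refine intervalIntegral.tendsto_integral_filter_of_dominated_convergence
        (fun b => max (b - k) 0)
        (Eventually.of_forall fun n => (ϕc n).aestronglyMeasurable)
        (Eventually.of_forall fun n => ae_of_all _ fun b _ => ?_) (mc.intervalIntegrable _ _)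
        (ae_of_all _ fun b _ => ϕl b)
      rw [Real.norm_of_nonneg (ϕb n b).1]
      exact (ϕb n b).2

end Truncation

/-! ### Weak chain rule -/

section ChainRule

variable {d : ℕ}

theorem spaceGrad_eq_zero_of_notMem_tsupport {φ : ℝ × Space d → ℝ} (hφ : Differentiable ℝ φ)
    {z : ℝ × Space d} (hz : z ∉ tsupport φ) : spaceGrad φ z = 0 := by
  refine ext_inner_right ℝ fun v => ?_
  rw [inner_spaceGrad (hφ z), image_eq_zero_of_notMem_tsupport
    (fun h => hz (tsupport_fderiv_subset ℝ h))]
  simp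

theorem spaceDiv_smul_const {ϕ χ : ℝ → ℝ} (hϕ : ∀ a, HasDerivAt ϕ (χ a) a)
    {U : ℝ × Space d → ℝ} {z : ℝ × Space d} (hU : DifferentiableAt ℝ U z) (v : Space d) :
    spaceDiv (fun z => ϕ (U z) • v) z = ⟪v, χ (U z) • spaceGrad U z⟫ := by
  have h1 : HasFDerivAt (fun z => ϕ (U z) • v) ((χ (U z) • fderiv ℝ U z).smulRight v) z :=
    ((hϕ (U z)).comp_hasFDerivAt z hU.hasFDerivAt).smul_const v
  rw [spaceDiv, h1.fderiv, PiLp.inner_apply]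
  refine Finset.sum_congr rfl fun i _ => ?_
  have h2 := inner_spaceGrad hU (EuclideanSpace.single i 1)
  rw [EuclideanSpace.inner_single_right] at h2
  simp only [ContinuousLinearMap.smulRight_apply, smul_apply, ← h2]
  simp

/-- The classical chain rule for mollifications, integrated by parts against `φ`, then passed to the
limit. Pairing with a fixed vector `v` reduces the vector identity to scalar ones. -/
theorem weak_chain_rule {T₁ T₂ : ℝ} {Ω : Set (Space d)} (hΩ : IsOpen Ω)
    {u : ℝ × Space d → ℝ} {G : ℝ × Space d → Space d} (hu : MemLp u 2) (hG : MemLp G 2)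
    (hgrad : ∀ φ, IsTestFunction (cylinder T₁ T₂ Ω) φ →
      ∫ y, u y • spaceGrad φ y = -∫ y, φ y • G y)
    {Φ ϕ χ : ℝ → ℝ} (h : IsC2Profile Φ ϕ χ) {φ : ℝ × Space d → ℝ}
    (hφ : IsTestFunction (cylinder T₁ T₂ Ω) φ) (v : Space d) :
    ∫ z, ⟪ϕ (u z) • v, spaceGrad φ z⟫ = -∫ z, ⟪φ z • v, χ (u z) • G z⟫ := by
  obtain ⟨k, hk⟩ := exists_isGoodMollifier (d := d) (σ := -1) (by simp) hu
  have hkm := hk.toIsTimeShiftedMollifier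
  set K := tsupport φ with hK
  have hKc : IsCompact K := hφ.compact.isCompact
  -- The kernels look into the future, so the support of `φ` must stay away from `T₂`; compactness
  -- gives the gap.
  obtain ⟨β, hβ, hKβ⟩ : ∃ β < T₂, ∀ z ∈ K, z.1 ≤ β := by
    rcases K.eq_empty_or_nonempty with h0 | hne
    · exact ⟨T₂ - 1, by linarith, by simp [h0]⟩
    · obtain ⟨m, hm, hmax⟩ := hKc.exists_isMaxOn hne continuous_fst.continuousOn
      exact ⟨m.1, (hφ.support_subset hm).1.2, fun z hz => hmax hz⟩
  have hK2 : IsCompact (Prod.snd '' K) := hKc.image continuous_snd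
  have hK2Ω : Prod.snd '' K ⊆ Ω := by
    rintro _ ⟨z, hz, rfl⟩
    exact (hφ.support_subset hz).2
  -- On the support of `φ` the measure is finite, so the constant coming from `ϕ 0` is in `L²`.
  set μ := (volume : Measure (ℝ × Space d)).restrict K
  have : IsFiniteMeasure μ := ⟨by simpa [μ] using hKc.measure_lt_top⟩
  have hg0 : ∀ z ∉ K, spaceGrad φ z = 0 := fun z hz =>
    spaceGrad_eq_zero_of_notMem_tsupport hφ.differentiable hz
  have hφ0 : ∀ z ∉ K, φ z = 0 := fun z hz => image_eq_zero_of_notMem_tsupport hz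
  have loc : LocallyIntegrable u := hu.locallyIntegrable (by norm_num)
  have hϕc := h.continuous_deriv
  have hχc := h.continuous_deriv2
  have lim : ∀ {E : Type} [NormedAddCommGroup E] [NormedSpace ℝ E] [CompleteSpace E]
      {w : ℝ × Space d → E}, MemLp w 2 →
      Tendsto (fun n => eLpNorm (mollify volume (k n) w - w) 2 μ) atTop (𝓝 0) := fun hw =>
    tendsto_of_tendsto_of_tendsto_of_le_of_le tendsto_const_nhds (hkm.tendsto_eLpNorm hw)
      (fun _ => zero_le) fun n => eLpNorm_mono_measure _ Measure.restrict_le_self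
  have hUr : ∀ n, MemLp (mollify volume (k n) u) 2 μ := fun n => (hkm.memLp hu n).restrict _
  have mϕ : ∀ {w : ℝ × Space d → ℝ}, MemLp w 2 μ → MemLp (fun z => ϕ (w z) • v) 2 μ := by
    intro w hw
    refine ((memLp_const (|ϕ 0| * ‖v‖)).add (hw.norm.const_mul ‖v‖)).mono
      ((hϕc.comp_aestronglyMeasurable hw.1).smul_const v) (ae_of_all _ fun z => ?_)
    rw [norm_smul, Real.norm_eq_abs, Real.norm_eq_abs]
    refine le_trans ?_ (le_abs_self _)
    simp only [Pi.add_apply, Real.norm_eq_abs]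
    nlinarith [h.abs_deriv_le (w z), norm_nonneg v]
  have mχ : ∀ {w : ℝ × Space d → ℝ}, MemLp w 2 μ →
      AEStronglyMeasurable (fun z => χ (w z)) μ := fun hw => hχc.comp_aestronglyMeasurable hw.1
  have mχG : ∀ {w : ℝ × Space d → ℝ} {W : ℝ × Space d → Space d}, MemLp w 2 μ → MemLp W 2 μ →
      MemLp (fun z => χ (w z) • W z) 2 μ := fun {w W} hw hW =>
    hW.mono ((mχ hw).smul hW.1) (ae_of_all _ fun z => by
      rw [norm_smul]
      exact mul_le_of_le_one_left (norm_nonneg _) (h.bound _))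
  have mφv : MemLp (fun z => φ z • v) 2 μ := by
    have h1 := (hφ.memLp_volume 2).restrict K
    refine (h1.const_mul ‖v‖).mono (h1.1.smul_const v) (ae_of_all _ fun z => ?_)
    rw [norm_smul, norm_mul, norm_norm, mul_comm]
  have zero_lim : ∀ {E : Type} [NormedAddCommGroup E] {w : ℝ × Space d → E},
      Tendsto (fun _ : ℕ => eLpNorm (w - w) 2 μ) atTop (𝓝 0) := by
    simp
  have L1 := tendsto_integral_inner (μ := μ)
    (a := fun n z => ϕ (mollify volume (k n) u z) • v) (a' := fun z => ϕ (u z) • v)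
    (b := fun _ => spaceGrad φ) (b' := spaceGrad φ) (fun n => mϕ (hUr n))
    (fun n => (hφ.memLp_spaceGrad 2).restrict _) (mϕ (hu.restrict _))
    ((hφ.memLp_spaceGrad 2).restrict _)
    (tendsto_eLpNorm_of_norm_sub_le (C := ‖v‖) (fun n z => by
      rw [← sub_smul, norm_smul, mul_comm]
      exact mul_le_mul_of_nonneg_left (h.abs_deriv_sub_le _ _) (norm_nonneg _)) (lim hu))
    zero_lim
  have L2 := tendsto_integral_inner (μ := μ) (a := fun _ z => φ z • v) (a' := fun z => φ z • v)
    (b := fun n z => χ (mollify volume (k n) u z) • mollify volume (k n) G z)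
    (b' := fun z => χ (u z) • G z) (fun _ => mφv)
    (fun n => mχG (hUr n) ((hkm.memLp hG n).restrict _)) mφv
    (mχG (hu.restrict _) (hG.restrict _)) zero_lim
    (tendsto_eLpNorm_smul (C := 1) (fun n => mχ (hUr n)) (mχ (hu.restrict _))
      (fun n z => h.bound _) (by
        filter_upwards [ae_restrict_of_ae hk.ae_tendsto] with z hz
        exact (hχc.tendsto _).comp hz)
      (fun n => (hkm.memLp hG n).restrict _) (hG.restrict _) (lim hG))
  have e1 : ∀ w : ℝ × Space d → ℝ, ∫ z, ⟪ϕ (w z) • v, spaceGrad φ z⟫ ∂μ =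
      ∫ z, ⟪ϕ (w z) • v, spaceGrad φ z⟫ := fun w =>
    setIntegral_eq_integral_of_forall_compl_eq_zero fun z hz => by simp [hg0 z hz]
  have e2 : ∀ W : ℝ × Space d → Space d, ∫ z, ⟪φ z • v, W z⟫ ∂μ = ∫ z, ⟪φ z • v, W z⟫ := fun W =>
    setIntegral_eq_integral_of_forall_compl_eq_zero fun z hz => by simp [hφ0 z hz]
  simp only [e1] at L1
  rw [e2 fun z => χ (u z) • G z] at L2
  refine tendsto_nhds_unique (L1.congr' ?_) L2.neg
  filter_upwards [hkm.eventually_isTestFunction hΩ hK2 hK2Ω le_rfl hβ.le (Or.inl ⟨rfl, hβ⟩)]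
    with n hn
  have hUs : ContDiff ℝ 1 (mollify volume (k n) u) := (hkm.contDiff hu n).of_le (by simp)
  have hslab : ∀ z ∉ slab d T₁ T₂, z ∉ K := fun z hz hzK =>
    hz ⟨(hφ.support_subset hzK).1, mem_univ _⟩
  have ibp := integral_slab_mul_spaceDiv (h := φ) (hφ.smooth.of_le (by simp))
    (P := fun z => ϕ (mollify volume (k n) u z) • v)
    ((h.contDiff_deriv.comp hUs).smul contDiff_const) hK2
    (fun z hz => hφ0 z fun hzK => hz ⟨z, hzK, rfl⟩) T₁ T₂
  rw [setIntegral_eq_integral_of_forall_compl_eq_zero fun z hz => by simp [hφ0 z (hslab z hz)],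
    setIntegral_eq_integral_of_forall_compl_eq_zero fun z hz => by simp [hg0 z (hslab z hz)]]
    at ibp
  rw [← neg_eq_iff_eq_neg.2 ibp, e2 fun z => χ (mollify volume (k n) u z) •
    mollify volume (k n) G z]
  refine congrArg Neg.neg (integral_congr_ae (ae_of_all _ fun z => ?_))
  simp only
  by_cases hz : z ∈ K
  · rw [spaceDiv_smul_const h.hasDerivAt_deriv (hUs.differentiable (by simp) z),
      spaceGrad_mollify (hkm.smooth n) (hkm.compact n) loc
        (hgrad _ (hn z.1 ⟨(hφ.support_subset hz).1.1.le, hKβ z hz⟩ z.2 ⟨z, hz, rfl⟩)),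
      real_inner_smul_left]
  · simp [hφ0 z hz]

end ChainRule

/-! ### Energy inequality for the truncation at almost every pair of times -/

section TruncatedEnergy

variable {d : ℕ}

theorem max_sub_le (a k : ℝ) : max (a - k) 0 ≤ |a| + |k| :=
  max_le (by linarith [le_abs_self a, neg_abs_le k]) (by positivity)

theorem abs_indicator_Ioi_le (k a : ℝ) : |(Ioi k).indicator (1 : ℝ → ℝ) a| ≤ 1 := by
  by_cases h : a ∈ Ioi k <;> simp [h]

theorem measurable_indicator_Ioi (k : ℝ) : Measurable ((Ioi k).indicator (1 : ℝ → ℝ)) :=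
  measurable_one.indicator measurableSet_Ioi

theorem IsTestFunction.gradient_bound {Ω : Set (Space d)} {ψ : Space d → ℝ}
    (hψ : IsTestFunction Ω ψ) : Continuous (gradient ψ) ∧ HasCompactSupport (gradient ψ) ∧
      ∃ C, ∀ x, ‖gradient ψ x‖ ≤ C := by
  have h1 : Continuous (gradient ψ) :=
    (InnerProductSpace.toDual ℝ (Space d)).symm.continuous.comp
      (hψ.smooth.continuous_fderiv (by simp))
  have h2 : HasCompactSupport (gradient ψ) :=
    (hψ.compact.fderiv ℝ).comp_left
      (g := fun L => (InnerProductSpace.toDual ℝ (Space d)).symm L) (by simp)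
  exact ⟨h1, h2, h2.exists_bound_of_continuous h1⟩

/-- Dominated convergence in `weak_chain_rule` along the profiles of `exists_truncation_profile`. -/
theorem weak_chain_rule_truncation {T₁ T₂ : ℝ} {Ω : Set (Space d)} (hΩ : IsOpen Ω)
    {u : ℝ × Space d → ℝ} {G : ℝ × Space d → Space d} (hu : MemLp u 2) (hG : MemLp G 2)
    (hgrad : ∀ φ, IsTestFunction (cylinder T₁ T₂ Ω) φ →
      ∫ y, u y • spaceGrad φ y = -∫ y, φ y • G y) (k : ℝ) {φ : ℝ × Space d → ℝ}
    (hφ : IsTestFunction (cylinder T₁ T₂ Ω) φ) (v : Space d) :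
    ∫ z, ⟪max (u z - k) 0 • v, spaceGrad φ z⟫ =
      -∫ z, ⟪φ z • v, (Ioi k).indicator (1 : ℝ → ℝ) (u z) • G z⟫ := by
  obtain ⟨Φ, ϕ, χ, h, hϕ, -, hχl, hϕl, -⟩ := exists_truncation_profile k
  have ig := memLp_one_iff_integrable.1 (hφ.memLp_spaceGrad 1)
  have iug := (hu.abs.integrable_mul (hφ.memLp_spaceGrad 2).norm)
  have iφG := ((hφ.memLp_volume 2).norm.integrable_mul hG.norm)
  have L1 : Tendsto (fun n => ∫ z, ⟪ϕ n (u z) • v, spaceGrad φ z⟫) atTop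
      (𝓝 (∫ z, ⟪max (u z - k) 0 • v, spaceGrad φ z⟫)) := by
    refine tendsto_integral_of_dominated_convergence
      (fun z => ‖v‖ * (|u z| * ‖spaceGrad φ z‖ + |k| * ‖spaceGrad φ z‖)) (fun n => ?_)
      ((iug.add (ig.norm.const_mul _)).const_mul _) (fun n => ae_of_all _ fun z => ?_)
      (ae_of_all _ fun z => ?_)
    · exact (((h n).continuous_deriv.comp_aestronglyMeasurable hu.1).smul_const v).inner ig.1
    · refine (norm_inner_le_norm _ _).trans ?_
      rw [norm_smul, Real.norm_of_nonneg (hϕ n _).1]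
      have h1 := (hϕ n (u z)).2.trans (max_sub_le (u z) k)
      calc ϕ n (u z) * ‖v‖ * ‖spaceGrad φ z‖ ≤ (|u z| + |k|) * ‖v‖ * ‖spaceGrad φ z‖ := by gcongr
        _ = _ := by ring
    · exact ((hϕl (u z)).smul_const v).inner tendsto_const_nhds
  have L2 : Tendsto (fun n => ∫ z, ⟪φ z • v, χ n (u z) • G z⟫) atTop
      (𝓝 (∫ z, ⟪φ z • v, (Ioi k).indicator (1 : ℝ → ℝ) (u z) • G z⟫)) := by
    refine tendsto_integral_of_dominated_convergence
      (fun z => ‖v‖ * (‖φ z‖ * ‖G z‖)) (fun n => ?_)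
      (iφG.const_mul _) (fun n => ae_of_all _ fun z => ?_)
      (ae_of_all _ fun z => ?_)
    · exact (((hφ.memLp_volume 2).1.smul_const v)).inner
        (((h n).continuous_deriv2.comp_aestronglyMeasurable hu.1).smul hG.1)
    · refine (norm_inner_le_norm _ _).trans ?_
      rw [norm_smul, norm_smul]
      calc ‖φ z‖ * ‖v‖ * (‖χ n (u z)‖ * ‖G z‖) ≤ ‖φ z‖ * ‖v‖ * (1 * ‖G z‖) := by
            gcongr
            exact (h n).bound _
        _ = _ := by ring
    · exact tendsto_const_nhds.inner ((hχl (u z)).smul_const _)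
  refine tendsto_nhds_unique (L1.congr fun n => ?_) L2.neg
  exact weak_chain_rule hΩ hu hG hgrad (h n) hφ v

/-- The density of the right-hand side of the energy inequality for `(u - k)₊`. -/
noncomputable def truncatedFlux (u f : ℝ × Space d → ℝ) (F G : ℝ × Space d → Space d)
    (ψ : Space d → ℝ) (k : ℝ) (z : ℝ × Space d) : ℝ :=
  -⟪F z, max (u z - k) 0 • gradient ψ z.2⟫
    - ⟪F z, (ψ z.2 * (Ioi k).indicator (1 : ℝ → ℝ) (u z)) • G z⟫
    + f z * (ψ z.2 * max (u z - k) 0)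

section

variable {u f : ℝ × Space d → ℝ} {F G : ℝ × Space d → Space d}
  {Ω : Set (Space d)} {ψ : Space d → ℝ}

/-- The values `p` and `c` stand for `ϕ n (u z)` and `χ n (u z)`, or for their limits. One set of
integrable majorants thus gives both the dominated convergence and the integrability of the limiting
flux. -/
theorem exists_flux_bounds (hψ : IsTestFunction Ω ψ) (k s t : ℝ)
    (hu : MemLp u 2) (hf : MemLp f 2) (hF : MemLp F 2) (hG : MemLp G 2)
    (hψ0 : ∀ x, 0 ≤ ψ x) (hψ1 : ∀ x, ψ x ≤ 1) :
    ∃ b₁ b₂ b₃ : ℝ × Space d → ℝ, IntegrableOn b₁ (slab d s t) ∧ IntegrableOn b₂ (slab d s t) ∧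
      IntegrableOn b₃ (slab d s t) ∧ ∀ z, ∀ p ∈ Icc 0 (max (u z - k) 0), ∀ c : ℝ, |c| ≤ 1 →
      ‖⟪F z, p • gradient ψ z.2⟫‖ ≤ b₁ z ∧ ‖⟪F z, (ψ z.2 * c) • G z⟫‖ ≤ b₂ z ∧
      ‖f z * (ψ z.2 * p)‖ ≤ b₃ z := by
  obtain ⟨hψg, hψgc, C, hC⟩ := hψ.gradient_bound
  have hψc := hψ.smooth.continuous
  set μ := (volume : Measure (ℝ × Space d)).restrict (slab d s t)
  have m1 : MemLp (fun z : ℝ × Space d => gradient ψ z.2) 2 μ := memLp_slab (by fun_prop)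
    hψgc.isCompact (fun z hz => by simp [image_eq_zero_of_notMem_tsupport hz]) s t
  have m2 : MemLp (fun z : ℝ × Space d => ψ z.2) 2 μ := memLp_slab (by fun_prop)
    hψ.compact.isCompact (fun z hz => by simp [image_eq_zero_of_notMem_tsupport hz]) s t
  have i1 : Integrable (fun z => ‖F z‖ * (C * |u z| + |k| * ‖gradient ψ z.2‖)) μ :=
    (hF.restrict _).norm.integrable_mul
      (((hu.restrict _).abs.const_mul C).add (m1.norm.const_mul |k|))
  have i2 : Integrable (fun z => ‖F z‖ * ‖G z‖) μ :=
    (hF.restrict _).norm.integrable_mul (hG.restrict _).norm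
  have i3 : Integrable (fun z => ‖f z‖ * (|u z| + |k| * ψ z.2)) μ :=
    (hf.restrict _).norm.integrable_mul ((hu.restrict _).abs.add (m2.const_mul |k|))
  refine ⟨_, _, _, i1, i2, i3, fun z p hp c hc => ⟨?_, ?_, ?_⟩⟩
  · refine (norm_inner_le_norm _ _).trans ?_
    rw [norm_smul, Real.norm_of_nonneg hp.1]
    gcongr
    have h1 := hp.2.trans (max_sub_le (u z) k)
    nlinarith [hC z.2, norm_nonneg (gradient ψ z.2), abs_nonneg (u z)]
  · refine (norm_inner_le_norm _ _).trans ?_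
    rw [norm_smul, norm_mul, Real.norm_of_nonneg (hψ0 _)]
    gcongr
    exact mul_le_of_le_one_left (norm_nonneg _) (mul_le_one₀ (hψ1 _) (norm_nonneg _) hc)
  · rw [norm_mul, norm_mul, Real.norm_of_nonneg (hψ0 _), Real.norm_of_nonneg hp.1]
    gcongr
    have h1 := hp.2.trans (max_sub_le (u z) k)
    nlinarith [hψ0 z.2, hψ1 z.2, abs_nonneg (u z)]

theorem integrableOn_flux (hψ : IsTestFunction Ω ψ) (k s t : ℝ)
    (hu : MemLp u 2) (hf : MemLp f 2) (hF : MemLp F 2) (hG : MemLp G 2)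
    (hψ0 : ∀ x, 0 ≤ ψ x) (hψ1 : ∀ x, ψ x ≤ 1) :
    IntegrableOn (fun z => ⟪F z, max (u z - k) 0 • gradient ψ z.2⟫) (slab d s t) ∧
    IntegrableOn (fun z => ⟪F z, (ψ z.2 * (Ioi k).indicator (1 : ℝ → ℝ) (u z)) • G z⟫)
      (slab d s t) ∧
    IntegrableOn (fun z => f z * (ψ z.2 * max (u z - k) 0)) (slab d s t) := by
  obtain ⟨b₁, b₂, b₃, i1, i2, i3, hb⟩ := exists_flux_bounds hψ k s t hu hf hF hG hψ0 hψ1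
  have hψc := hψ.smooth.continuous
  have hψg := hψ.gradient_bound.1
  have hb' := fun z => hb z _ ⟨le_max_right _ _, le_rfl⟩ _ (abs_indicator_Ioi_le k (u z))
  have mw : AEStronglyMeasurable (fun z => max (u z - k) 0) volume :=
    (show Continuous fun a : ℝ => max (a - k) 0 by fun_prop).comp_aestronglyMeasurable hu.1
  have mi : AEStronglyMeasurable (fun z => (Ioi k).indicator (1 : ℝ → ℝ) (u z)) volume :=
    ((measurable_indicator_Ioi k).comp_aemeasurable hu.1.aemeasurable).aestronglyMeasurable
  have mψ : AEStronglyMeasurable (fun z : ℝ × Space d => ψ z.2) volume :=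
    Continuous.aestronglyMeasurable (by fun_prop)
  have mg : AEStronglyMeasurable (fun z : ℝ × Space d => gradient ψ z.2) volume :=
    Continuous.aestronglyMeasurable (by fun_prop)
  exact ⟨i1.mono' (hF.1.inner (mw.smul mg)).restrict (ae_of_all _ fun z => (hb' z).1),
    i2.mono' (hF.1.inner ((mψ.mul mi).smul hG.1)).restrict (ae_of_all _ fun z => (hb' z).2.1),
    i3.mono' (hf.1.mul (mψ.mul mw)).restrict (ae_of_all _ fun z => (hb' z).2.2)⟩

theorem integrableOn_truncatedFlux (hψ : IsTestFunction Ω ψ) (k s t : ℝ)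
    (hu : MemLp u 2) (hf : MemLp f 2) (hF : MemLp F 2)
    (hG : MemLp G 2) (hψ0 : ∀ x, 0 ≤ ψ x) (hψ1 : ∀ x, ψ x ≤ 1) :
    IntegrableOn (truncatedFlux u f F G ψ k) (slab d s t) := by
  obtain ⟨i1, i2, i3⟩ := integrableOn_flux hψ k s t hu hf hF hG hψ0 hψ1
  exact (i1.neg.sub i2).add i3

end

theorem integrable_mul_truncation_sq {ψ : Space d → ℝ} (hψ : Continuous ψ)
    (hψc : HasCompactSupport ψ) {w : Space d → ℝ}
    (hw : MemLp w 2) (k : ℝ) : Integrable fun x => 2 * (w x ^ 2 + k ^ 2 * ψ x) :=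
  (hw.integrable_sq.add ((hψ.integrable_of_hasCompactSupport hψc).const_mul _)).const_mul 2

/-- Dominated convergence in all terms of `energy_inequality_profile` as the profiles approach the
truncation. -/
theorem energy_inequality_truncation {κ : ℕ → ℝ × Space d → ℝ} {T₁ T₂ : ℝ} {Ω : Set (Space d)}
    (hΩ : IsOpen Ω) {u f : ℝ × Space d → ℝ} {F G : ℝ × Space d → Space d}
    (hκ : IsGoodMollifier (-1) κ u) (hu : MemLp u 2) (hf : MemLp f 2)
    (hF : MemLp F 2) (hG : MemLp G 2)
    (hgrad : ∀ φ, IsTestFunction (cylinder T₁ T₂ Ω) φ →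
      ∫ y, u y • spaceGrad φ y = -∫ y, φ y • G y)
    (hsub : ∀ φ, IsTestFunction (cylinder T₁ T₂ Ω) φ → (∀ z, 0 ≤ φ z) → divForm u F f φ ≤ 0)
    (k : ℝ) {ψ : Space d → ℝ}
    (hψ : IsTestFunction Ω ψ) (hψ0 : ∀ x, 0 ≤ ψ x) (hψ1 : ∀ x, ψ x ≤ 1) {s t : ℝ}
    (hs : T₁ ≤ s) (hst : s < t) (ht : t < T₂)
    (hus : MemLp (fun x => u (s, x)) 2 volume) (hut : MemLp (fun x => u (t, x)) 2 volume)
    (hls : Tendsto (fun n => eLpNorm (fun x => mollify volume (κ n) u (s, x) - u (s, x)) 2 volume)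
      atTop (𝓝 0))
    (hlt : Tendsto (fun n => eLpNorm (fun x => mollify volume (κ n) u (t, x) - u (t, x)) 2 volume)
      atTop (𝓝 0)) :
    (∫ x, ψ x * (max (u (t, x) - k) 0 ^ 2 / 2)) - ∫ x, ψ x * (max (u (s, x) - k) 0 ^ 2 / 2) ≤
      ∫ z in slab d s t, truncatedFlux u f F G ψ k z := by
  obtain ⟨Φ, ϕ, χ, h, hϕ, hΦ, hχl, hϕl, hΦl⟩ := exists_truncation_profile k
  obtain ⟨i1, i2, i3⟩ := integrableOn_flux hψ k s t hu hf hF hG hψ0 hψ1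
  obtain ⟨b₁, b₂, b₃, j1, j2, j3, hb⟩ := exists_flux_bounds hψ k s t hu hf hF hG hψ0 hψ1
  have hb' := fun n z => hb z (ϕ n (u z)) (hϕ n (u z)) (χ n (u z)) ((h n).bound _)
  have hψc := hψ.smooth.continuous
  have hψg := hψ.gradient_bound.1
  have mψ : AEStronglyMeasurable (fun z : ℝ × Space d => ψ z.2) volume :=
    Continuous.aestronglyMeasurable (by fun_prop)
  have mg : AEStronglyMeasurable (fun z : ℝ × Space d => gradient ψ z.2) volume :=
    Continuous.aestronglyMeasurable (by fun_prop)
  have mϕ := fun n => (h n).continuous_deriv.comp_aestronglyMeasurable hu.1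
  have mχ := fun n => (h n).continuous_deriv2.comp_aestronglyMeasurable hu.1
  have L1 := tendsto_integral_of_dominated_convergence (μ := volume.restrict (slab d s t))
    (F := fun n z => ⟪F z, ϕ n (u z) • gradient ψ z.2⟫) b₁
    (fun n => (hF.1.inner ((mϕ n).smul mg)).restrict) j1 (fun n => ae_of_all _ fun z => (hb' n z).1)
    (ae_of_all _ fun z => tendsto_const_nhds.inner ((hϕl (u z)).smul_const _))
  have L2 := tendsto_integral_of_dominated_convergence (μ := volume.restrict (slab d s t))
    (F := fun n z => ⟪F z, (ψ z.2 * χ n (u z)) • G z⟫) b₂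
    (fun n => (hF.1.inner ((mψ.mul (mχ n)).smul hG.1)).restrict) j2
    (fun n => ae_of_all _ fun z => (hb' n z).2.1)
    (ae_of_all _ fun z => tendsto_const_nhds.inner (((hχl (u z)).const_mul _).smul_const _))
  have L3 := tendsto_integral_of_dominated_convergence (μ := volume.restrict (slab d s t))
    (F := fun n z => f z * (ψ z.2 * ϕ n (u z))) b₃
    (fun n => (hf.1.mul (mψ.mul (mϕ n))).restrict) j3
    (fun n => ae_of_all _ fun z => (hb' n z).2.2)
    (ae_of_all _ fun z => ((hϕl (u z)).const_mul _).const_mul _)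
  have LE : ∀ τ, MemLp (fun x => u (τ, x)) 2 volume →
      Tendsto (fun n => ∫ x, ψ x * Φ n (u (τ, x))) atTop
        (𝓝 (∫ x, ψ x * (max (u (τ, x) - k) 0 ^ 2 / 2))) := fun τ hτ => by
    refine tendsto_integral_of_dominated_convergence _
      (fun n => hψc.aestronglyMeasurable.mul ((h n).continuous.comp_aestronglyMeasurable hτ.1))
      (integrable_mul_truncation_sq hψc hψ.compact hτ k)
      (fun n => ae_of_all _ fun x => ?_) (ae_of_all _ fun x => (hΦl _).const_mul _)
    rw [norm_mul, Real.norm_of_nonneg (hψ0 x), Real.norm_of_nonneg (hΦ n _).1]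
    have h1 := (hΦ n (u (τ, x))).2
    have h2 : max (u (τ, x) - k) 0 ^ 2 ≤ 2 * (u (τ, x) ^ 2 + k ^ 2) := by
      have h3 := max_sub_le (u (τ, x)) k
      have h4 : 0 ≤ max (u (τ, x) - k) 0 := le_max_right _ _
      nlinarith [sq_nonneg (|u (τ, x)| - |k|), sq_abs (u (τ, x)), sq_abs k]
    nlinarith [hψ0 x, hψ1 x, sq_nonneg (u (τ, x)),
      mul_le_mul_of_nonneg_left (h1.trans h2) (hψ0 x)]
  have key := le_of_tendsto_of_tendsto' ((LE t hut).sub (LE s hus)) ((L1.neg.sub L2).add L3)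
    fun n => energy_inequality_profile hΩ hκ hu hf hF hG hgrad hsub (h n) (fun a => (hϕ n a).1)
      hψ hψ0 hψ1 hs hst ht hus hut hls hlt
  refine key.trans_eq ?_
  unfold truncatedFlux
  exact ((integral_add (i1.neg.sub i2) i3).trans (congrArg (· + _)
    ((integral_sub i1.neg i2).trans (congrArg (· - _) (integral_neg _))))).symm

end TruncatedEnergy

/-! ### Extension of the energy inequality to all times -/

section AllTimes

variable {d : ℕ}

theorem abs_toReal_eLpNorm_sub_le {α E : Type*} [MeasurableSpace α] {μ : Measure α}
    [NormedAddCommGroup E] {g g' : α → E} (hg : MemLp g 2 μ) (hg' : MemLp g' 2 μ) :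
    |(eLpNorm g 2 μ).toReal - (eLpNorm g' 2 μ).toReal| ≤ (eLpNorm (g - g') 2 μ).toReal := by
  have h := abs_norm_sub_norm_le (hg.toLp g) (hg'.toLp g')
  rwa [← MemLp.toLp_sub, Lp.norm_toLp, Lp.norm_toLp, Lp.norm_toLp] at h

theorem abs_max_sub_max_le (a b k : ℝ) : |max (a - k) 0 - max (b - k) 0| ≤ |a - b| := by
  have := abs_max_sub_max_le_abs (a - k) (b - k) 0
  rwa [sub_sub_sub_cancel_right] at this

/-- The integral is half the squared `L²` norm of `√ψ (v-k)₊` over the support of `ψ`, a compact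
subset of `Ω`, and this function depends on `v` in a 1-Lipschitz way. -/
theorem tendsto_integral_mul_truncation_sq {T₁ T₂ : ℝ} {Ω : Set (Space d)}
    {v : ℝ × Space d → ℝ} {ψ : Space d → ℝ} (hψ : IsTestFunction Ω ψ) (hψ0 : ∀ x, 0 ≤ ψ x)
    (hψ1 : ∀ x, ψ x ≤ 1)
    (hv : ∀ t ∈ Icc T₁ T₂, MemLp (fun x => v (t, x)) 2 (volume.restrict Ω))
    (hc : ∀ K ⊆ Ω, IsCompact K → ∀ t₀ ∈ Icc T₁ T₂,
      Tendsto (fun t => eLpNorm (fun x => v (t, x) - v (t₀, x)) 2 (volume.restrict K))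
        (𝓝[Icc T₁ T₂] t₀) (𝓝 0)) (k : ℝ) {t₀ : ℝ} (ht₀ : t₀ ∈ Icc T₁ T₂) :
    Tendsto (fun t => ∫ x, ψ x * (max (v (t, x) - k) 0 ^ 2 / 2)) (𝓝[Icc T₁ T₂] t₀)
      (𝓝 (∫ x, ψ x * (max (v (t₀, x) - k) 0 ^ 2 / 2))) := by
  set K := tsupport ψ with hK
  have hKc : IsCompact K := hψ.compact.isCompact
  set μ := (volume : Measure (Space d)).restrict K
  have : IsFiniteMeasure μ := ⟨by simpa [μ] using hKc.measure_lt_top⟩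
  have hψc := hψ.smooth.continuous
  set w : ℝ → Space d → ℝ := fun t x => √(ψ x) * max (v (t, x) - k) 0 with hw
  have hvK : ∀ t ∈ Icc T₁ T₂, MemLp (fun x => v (t, x)) 2 μ := fun t ht =>
    (hv t ht).mono_measure (Measure.restrict_mono_set _ hψ.support_subset)
  have hψs : ∀ x, √(ψ x) ≤ 1 := fun x => Real.sqrt_le_one.2 (hψ1 x)
  have hwm : ∀ t ∈ Icc T₁ T₂, MemLp (w t) 2 μ := fun t ht => by
    refine ((hvK t ht).norm.add (memLp_const |k|)).mono ?_ (ae_of_all _ fun x => ?_)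
    · exact (Continuous.aestronglyMeasurable (by fun_prop)).mul
        ((show Continuous fun a : ℝ => max (a - k) 0 by fun_prop).comp_aestronglyMeasurable
          (hvK t ht).1)
    · rw [norm_mul, Real.norm_of_nonneg (Real.sqrt_nonneg _),
        Real.norm_of_nonneg (le_max_right _ _)]
      refine (mul_le_of_le_one_left (le_max_right _ _) (hψs x)).trans ?_
      exact (max_sub_le _ _).trans (le_abs_self _)
  have e : ∀ t ∈ Icc T₁ T₂, ∫ x, ψ x * (max (v (t, x) - k) 0 ^ 2 / 2) =
      (eLpNorm (w t) 2 μ).toReal ^ 2 / 2 := fun t ht => by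
    rw [← integral_norm_sq_eq (hwm t ht).1, ← integral_div,
      ← setIntegral_eq_integral_of_forall_compl_eq_zero (s := K)
        (f := fun x => ψ x * (max (v (t, x) - k) 0 ^ 2 / 2)) fun x hx => by
          rw [image_eq_zero_of_notMem_tsupport hx, zero_mul]]
    refine integral_congr_ae (ae_of_all _ fun x => ?_)
    simp only [hw, Real.norm_eq_abs, sq_abs, mul_pow, Real.sq_sqrt (hψ0 x)]
    ring
  rw [e t₀ ht₀]
  have hN : Tendsto (fun t => (eLpNorm (w t) 2 μ).toReal) (𝓝[Icc T₁ T₂] t₀)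
      (𝓝 (eLpNorm (w t₀) 2 μ).toReal) := by
    rw [tendsto_iff_norm_sub_tendsto_zero]
    have h0 := hc K hψ.support_subset hKc t₀ ht₀
    have h1 : Tendsto (fun t => (eLpNorm (fun x => v (t, x) - v (t₀, x)) 2 μ).toReal)
        (𝓝[Icc T₁ T₂] t₀) (𝓝 0) := by
      simpa [Function.comp_def] using (ENNReal.tendsto_toReal (by simp)).comp h0
    refine squeeze_zero' (Eventually.of_forall fun _ => norm_nonneg _) ?_ h1
    filter_upwards [self_mem_nhdsWithin] with t ht
    refine (abs_toReal_eLpNorm_sub_le (hwm t ht) (hwm t₀ ht₀)).trans ?_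
    refine ENNReal.toReal_mono ((hvK t ht).sub (hvK t₀ ht₀)).2.ne (eLpNorm_mono fun x => ?_)
    simp only [hw, Pi.sub_apply]
    rw [← mul_sub, norm_mul, Real.norm_of_nonneg (Real.sqrt_nonneg _)]
    exact (mul_le_of_le_one_left (norm_nonneg _) (hψs x)).trans (abs_max_sub_max_le _ _ _)
  refine ((hN.pow 2).div_const 2).congr' ?_
  filter_upwards [self_mem_nhdsWithin] with t ht
  exact (e t ht).symm

/-- A property valid almost everywhere holds somewhere in every open interval. The approximating
times are taken strictly inside `(s, t)`, so that they avoid `T₁` and `T₂`. -/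
theorem exists_seq_tendsto_of_ae {p : ℝ → Prop} (hp : ∀ᵐ t : ℝ, p t) {s t : ℝ} (hst : s < t) :
    ∃ σ τ : ℕ → ℝ, (∀ n, p (σ n) ∧ p (τ n) ∧ s < σ n ∧ σ n < τ n ∧ τ n < t) ∧
      Tendsto σ atTop (𝓝 s) ∧ Tendsto τ atTop (𝓝 t) := by
  have key : ∀ a b : ℝ, a < b → ∃ x, p x ∧ a < x ∧ x < b := by
    intro a b hab
    by_contra! h
    have h1 : volume (Ioo a b) = 0 := measure_mono_null (fun x hx hpx =>
      (h x hpx hx.1).not_gt hx.2) hp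
    simp [hab.not_ge] at h1
  set c := (s + t) / 2
  have hsc : s < c := by simp only [c]; linarith
  have hct : c < t := by simp only [c]; linarith
  have hpos : ∀ n : ℕ, 0 < 1 / ((n : ℝ) + 1) := fun n => Nat.one_div_pos_of_nat
  choose σ h1 h2 h3 using fun n : ℕ => key s (min c (s + 1 / ((n : ℝ) + 1)))
    (lt_min hsc (by linarith [hpos n]))
  choose τ h4 h5 h6 using fun n : ℕ => key (max c (t - 1 / ((n : ℝ) + 1))) t
    (max_lt hct (by linarith [hpos n]))
  have l0 := tendsto_one_div_add_atTop_nhds_zero_nat (𝕜 := ℝ)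
  refine ⟨σ, τ, fun n => ⟨h1 n, h4 n, h2 n, ((h3 n).trans_le (min_le_left _ _)).trans
    ((le_max_left _ _).trans_lt (h5 n)), h6 n⟩, ?_, ?_⟩
  · refine tendsto_of_tendsto_of_tendsto_of_le_of_le tendsto_const_nhds
      (by simpa using l0.const_add s) (fun n => (h2 n).le) fun n =>
        ((h3 n).trans_le (min_le_right _ _)).le
  · refine tendsto_of_tendsto_of_tendsto_of_le_of_le
      (by simpa using l0.const_sub t) tendsto_const_nhds (fun n =>
        ((le_max_right _ _).trans_lt (h5 n)).le) fun n => (h6 n).le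

theorem tendsto_setIntegral_slab {J : ℝ × Space d → ℝ} {s t : ℝ}
    (hJ : IntegrableOn J (slab d s t)) {σ τ : ℕ → ℝ} (hσ : ∀ n, s < σ n) (hτ : ∀ n, τ n < t)
    (hσl : Tendsto σ atTop (𝓝 s)) (hτl : Tendsto τ atTop (𝓝 t)) :
    Tendsto (fun n => ∫ z in slab d (σ n) (τ n), J z) atTop (𝓝 (∫ z in slab d s t, J z)) := by
  have hsub : ∀ n, slab d (σ n) (τ n) ⊆ slab d s t := fun n z hz =>
    ⟨⟨(hσ n).trans hz.1.1, hz.1.2.trans (hτ n)⟩, mem_univ _⟩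
  have e : ∀ n, ∫ z in slab d (σ n) (τ n), J z =
      ∫ z in slab d s t, (slab d (σ n) (τ n)).indicator J z := fun n => by
    rw [setIntegral_indicator (measurableSet_slab _ _), inter_eq_self_of_subset_right (hsub n)]
  simp_rw [e]
  refine tendsto_integral_of_dominated_convergence (fun z => ‖J z‖)
    (fun n => hJ.1.indicator (measurableSet_slab _ _)) hJ.norm
    (fun n => ae_of_all _ fun z => norm_indicator_le_norm_self _ _) ?_
  filter_upwards [ae_restrict_mem (measurableSet_slab s t)] with z hz
  refine tendsto_const_nhds.congr' ?_
  filter_upwards [hσl.eventually_lt_const hz.1.1, hτl.eventually_const_lt hz.1.2] with n h1 h2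
  exact (indicator_of_mem (show z ∈ slab d (σ n) (τ n) from ⟨⟨h1, h2⟩, mem_univ _⟩) J).symm

/-- Good times approach `s` and `t` from inside. The slice integrals converge by time-continuity of
`v`, and the flux integral by its integrability on the larger slab. -/
theorem energy_inequality_all_times {T₁ T₂ : ℝ} {Ω : Set (Space d)}
    (hΩ : IsOpen Ω) {v f : ℝ × Space d → ℝ} {F G : ℝ × Space d → Space d}
    (hvs : ∀ t ∈ Icc T₁ T₂, MemLp (fun x => v (t, x)) 2 (volume.restrict Ω))
    (hvc : ∀ K ⊆ Ω, IsCompact K → ∀ t₀ ∈ Icc T₁ T₂,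
      Tendsto (fun t => eLpNorm (fun x => v (t, x) - v (t₀, x)) 2 (volume.restrict K))
        (𝓝[Icc T₁ T₂] t₀) (𝓝 0))
    (hv : MemLp ((cylinder T₁ T₂ Ω).indicator v) 2) (hf : MemLp f 2)
    (hF : MemLp F 2) (hG : MemLp G 2)
    (hgrad : ∀ φ, IsTestFunction (cylinder T₁ T₂ Ω) φ →
      ∫ y, (cylinder T₁ T₂ Ω).indicator v y • spaceGrad φ y = -∫ y, φ y • G y)
    (hsub : ∀ φ, IsTestFunction (cylinder T₁ T₂ Ω) φ → (∀ z, 0 ≤ φ z) →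
      divForm ((cylinder T₁ T₂ Ω).indicator v) F f φ ≤ 0)
    (k : ℝ) {ψ : Space d → ℝ}
    (hψ : IsTestFunction Ω ψ) (hψ0 : ∀ x, 0 ≤ ψ x) (hψ1 : ∀ x, ψ x ≤ 1) {s t : ℝ}
    (hs : T₁ ≤ s) (hst : s < t) (ht : t ≤ T₂) :
    (∫ x, ψ x * (max (v (t, x) - k) 0 ^ 2 / 2)) - ∫ x, ψ x * (max (v (s, x) - k) 0 ^ 2 / 2) ≤
      ∫ z in slab d s t, truncatedFlux ((cylinder T₁ T₂ Ω).indicator v) f F G ψ k z := by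
  obtain ⟨κ, hκ⟩ := exists_isGoodMollifier (d := d) (σ := -1) (by simp) hv
  obtain ⟨σ, τ, h, hσ, hτ⟩ := exists_seq_tendsto_of_ae hκ.ae_slice hst
  have hI : ∀ n, σ n ∈ Ioo T₁ T₂ ∧ τ n ∈ Ioo T₁ T₂ := fun n => by
    obtain ⟨-, -, h1, h2, h3⟩ := h n
    exact ⟨⟨by linarith, by linarith⟩, ⟨by linarith, by linarith⟩⟩
  have hslice : ∀ r ∈ Ioo T₁ T₂, (fun x => (cylinder T₁ T₂ Ω).indicator v (r, x)) =
      Ω.indicator fun x => v (r, x) := fun r hr => by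
    funext x
    by_cases hx : x ∈ Ω
    · rw [indicator_of_mem hx, indicator_of_mem (show (r, x) ∈ cylinder T₁ T₂ Ω from ⟨hr, hx⟩)]
    · rw [indicator_of_notMem hx, indicator_of_notMem fun h => hx h.2]
  have hm : ∀ r ∈ Ioo T₁ T₂, MemLp (fun x => (cylinder T₁ T₂ Ω).indicator v (r, x)) 2 volume :=
    fun r hr => by
      rw [hslice r hr]
      exact (memLp_indicator_iff_restrict hΩ.measurableSet).2 (hvs r (Ioo_subset_Icc_self hr))
  have hE : ∀ r ∈ Ioo T₁ T₂,
      ∫ x, ψ x * (max ((cylinder T₁ T₂ Ω).indicator v (r, x) - k) 0 ^ 2 / 2) =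
        ∫ x, ψ x * (max (v (r, x) - k) 0 ^ 2 / 2) := fun r hr => by
    refine integral_congr_ae (ae_of_all _ fun x => ?_)
    by_cases hx : x ∈ tsupport ψ
    · simp only
      rw [indicator_of_mem (show (r, x) ∈ cylinder T₁ T₂ Ω from ⟨hr, hψ.support_subset hx⟩)]
    · simp [image_eq_zero_of_notMem_tsupport hx]
  have hcont : ∀ {r : ℝ} {ρ : ℕ → ℝ}, r ∈ Icc T₁ T₂ → (∀ n, ρ n ∈ Ioo T₁ T₂) →
      Tendsto ρ atTop (𝓝 r) → Tendsto (fun n => ∫ x, ψ x * (max (v (ρ n, x) - k) 0 ^ 2 / 2))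
        atTop (𝓝 (∫ x, ψ x * (max (v (r, x) - k) 0 ^ 2 / 2))) := fun hr hρ hl =>
    (tendsto_integral_mul_truncation_sq hψ hψ0 hψ1 hvs hvc k hr).comp
      (tendsto_nhdsWithin_iff.2 ⟨hl, Eventually.of_forall fun n => Ioo_subset_Icc_self (hρ n)⟩)
  refine le_of_tendsto_of_tendsto' ((hcont ⟨by linarith, ht⟩ (fun n => (hI n).2) hτ).sub
    (hcont ⟨hs, by linarith⟩ (fun n => (hI n).1) hσ))
    (tendsto_setIntegral_slab (integrableOn_truncatedFlux hψ k s t hv hf hF hG hψ0 hψ1)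
      (fun n => (h n).2.2.1) (fun n => (h n).2.2.2.2) hσ hτ) fun n => ?_
  rw [← hE _ (hI n).1, ← hE _ (hI n).2]
  exact energy_inequality_truncation hΩ hκ hv hf hF hG hgrad hsub k hψ hψ0 hψ1 (hI n).1.1.le
    (h n).2.2.2.1 (hI n).2.2 (hm _ (hI n).1) (hm _ (hI n).2) (h n).1 (h n).2.1

end AllTimes

/-! ### Radial cutoff with an almost optimal gradient -/

section RadialCutoff

variable {d : ℕ}

/-- With `δ = R - r`, a radial ramp falls from `1` at radius `r + δ/40` to `0` at `r + 39δ/40` and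
is mollified at radius `δ/80`, which fits in both margins and keeps the Lipschitz constant. That
constant is `20/(19δ)`, and `(20/19)² = 400/361 < 5/4`. -/
theorem exists_radial_cutoff (x₀ : Space d) {r R : ℝ} (hrR : r < R) :
    ∃ η : Space d → ℝ, IsTestFunction (Metric.ball x₀ R) η ∧ (∀ x, 0 ≤ η x) ∧ (∀ x, η x ≤ 1) ∧
      (∀ x ∈ Metric.ball x₀ r, η x = 1) ∧
      ∀ x, ‖gradient η x‖ ^ 2 ≤ 5 / 4 / (R - r) ^ 2 := by
  set δ := R - r with hδ
  have hδ0 : 0 < δ := sub_pos.2 hrR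
  let b : ContDiffBump (0 : Space d) := ⟨δ / 160, δ / 80, by positivity, by linarith⟩
  set κ := b.normed volume with hκ
  have κc : Continuous κ := (b.contDiff_normed (n := 0)).continuous
  have κi : Integrable κ := b.integrable_normed
  have κ1 : ∫ y, κ y = 1 := b.integral_normed
  have κ0 : ∀ y, 0 ≤ κ y := b.nonneg_normed
  have κs : ∀ y, δ / 80 ≤ ‖y‖ → κ y = 0 := fun y hy => by
    by_contra h
    have h1 : y ∈ Function.support (b.normed volume) := h
    rw [b.support_normed_eq, mem_ball_zero_iff] at h1
    exact absurd h1 (not_lt.2 hy)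
  set m : ℝ → ℝ := fun a => max 0 (min 1 a) with hm
  have m0 : ∀ a, 0 ≤ m a := fun a => le_max_left _ _
  have m1 : ∀ a, m a ≤ 1 := fun a => max_le zero_le_one (min_le_left _ _)
  have mL : ∀ a b, |m a - m b| ≤ |a - b| := fun a b => by
    have h1 := abs_max_sub_max_le_abs (min 1 a) (min 1 b) 0
    have h2 := abs_min_sub_min_le_max 1 a 1 b
    simp only [sub_self, abs_zero, max_eq_right (abs_nonneg (a - b))] at h2
    simp only [hm, max_comm (0 : ℝ)]
    exact h1.trans h2
  set c := 20 / (19 * δ) with hc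
  have hc0 : 0 < c := by positivity
  set ℓ : Space d → ℝ := fun x => m (c * (r + δ * (39 / 40) - ‖x - x₀‖)) with hℓ
  have ℓc : Continuous ℓ := by simp only [hℓ, hm]; fun_prop
  have ℓ0 : ∀ x, 0 ≤ ℓ x := fun x => m0 _
  have ℓ1 : ∀ x, ℓ x ≤ 1 := fun x => m1 _
  have ℓL : ∀ x y, |ℓ x - ℓ y| ≤ c * ‖x - y‖ := fun x y => by
    refine (mL _ _).trans ?_
    rw [← mul_sub, abs_mul, abs_of_pos hc0, sub_sub_sub_cancel_left]
    gcongr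
    refine (abs_norm_sub_norm_le _ _).trans ?_
    rw [sub_sub_sub_cancel_right, norm_sub_rev]
  have ℓin : ∀ x, ‖x - x₀‖ ≤ r + δ / 40 → ℓ x = 1 := fun x hx => by
    have : 1 ≤ c * (r + δ * (39 / 40) - ‖x - x₀‖) := by
      have h1 : c * (δ * (19 / 20)) = 1 := by
        rw [hc]
        field_simp
      rw [← h1]
      gcongr
      linarith
    simp [hℓ, hm, min_eq_left this]
  have ℓout : ∀ x, r + δ * (39 / 40) ≤ ‖x - x₀‖ → ℓ x = 0 := fun x hx => by
    refine max_eq_left ((min_le_right _ _).trans ?_)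
    exact mul_nonpos_of_nonneg_of_nonpos hc0.le (sub_nonpos.2 hx)
  have hi : ∀ x, Integrable fun y => κ y • ℓ (x - y) := fun x => by
    refine κi.mono (κc.smul (by fun_prop)).aestronglyMeasurable (ae_of_all _ fun y => ?_)
    rw [norm_smul, Real.norm_of_nonneg (ℓ0 _)]
    exact mul_le_of_le_one_right (norm_nonneg _) (ℓ1 _)
  have smooth : ContDiff ℝ ∞ (mollify volume κ ℓ) :=
    contDiff_mollify b.contDiff_normed b.hasCompactSupport_normed ℓc.locallyIntegrable
  have hdist : ∀ x y : Space d, ‖y‖ ≤ δ / 80 →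
      ‖x - y - x₀‖ ≤ ‖x - x₀‖ + δ / 80 ∧ ‖x - x₀‖ - δ / 80 ≤ ‖x - y - x₀‖ := fun x y hy => by
    have e : x - y - x₀ = (x - x₀) - y := by abel
    rw [e]
    exact ⟨(norm_sub_le _ _).trans (by gcongr),
      (by gcongr : _ ≤ ‖x - x₀‖ - ‖y‖).trans (norm_sub_norm_le _ _)⟩
  have hout : ∀ x, r + δ * (79 / 80) ≤ ‖x - x₀‖ → mollify volume κ ℓ x = 0 := fun x hx => by
    rw [mollify_apply']
    refine integral_eq_zero_of_ae (ae_of_all _ fun y => ?_)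
    rcases le_total (δ / 80) ‖y‖ with h | h
    · simp [κs y h]
    · have := (hdist x y h).2
      simp [ℓout (x - y) (by linarith)]
  have hts : tsupport (mollify volume κ ℓ) ⊆ Metric.closedBall x₀ (r + δ * (79 / 80)) := by
    refine closure_minimal (fun x hx => ?_) Metric.isClosed_closedBall
    rw [mem_closedBall_iff_norm]
    by_contra h
    exact hx (hout x (not_le.1 h).le)
  have lip : LipschitzWith ⟨c, hc0.le⟩ (mollify volume κ ℓ) := by
    refine LipschitzWith.of_dist_le_mul fun x x' => ?_
    rw [dist_eq_norm, dist_eq_norm, mollify_apply', mollify_apply', ← integral_sub (hi x) (hi x')]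
    have := norm_integral_le_of_norm_le (f := fun y => κ y • ℓ (x - y) - κ y • ℓ (x' - y))
      (κi.mul_const (c * ‖x - x'‖)) (ae_of_all _ fun y => by
        rw [← smul_sub, norm_smul, Real.norm_of_nonneg (κ0 y)]
        refine mul_le_mul_of_nonneg_left ((ℓL _ _).trans_eq ?_) (κ0 y)
        rw [sub_sub_sub_cancel_right])
    rwa [integral_mul_const, κ1, one_mul] at this
  refine ⟨mollify volume κ ℓ, ⟨smooth, ?_, hts.trans ?_⟩, fun x => ?_, fun x => ?_, fun x hx => ?_,
    fun x => ?_⟩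
  · exact (isCompact_closedBall _ _).of_isClosed_subset (isClosed_tsupport _) hts
  · exact Metric.closedBall_subset_ball (by linarith)
  · rw [mollify_apply']
    exact integral_nonneg fun y => smul_nonneg (κ0 y) (ℓ0 _)
  · rw [mollify_apply', ← κ1]
    exact integral_mono (hi x) κi fun y => mul_le_of_le_one_right (κ0 y) (ℓ1 _)
  · rw [mollify_apply', ← κ1]
    refine integral_congr_ae (ae_of_all _ fun y => ?_)
    rcases le_total (δ / 80) ‖y‖ with h | h
    · simp [κs y h]
    · have h1 := (hdist x y h).1
      have h2 := mem_ball_iff_norm.1 hx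
      simp [ℓin (x - y) (by linarith)]
  · have h1 : ‖gradient (mollify volume κ ℓ) x‖ ≤ c := by
      rw [gradient, LinearIsometryEquiv.norm_map]
      exact norm_fderiv_le_of_lipschitz ℝ lip
    refine (pow_le_pow_left₀ (norm_nonneg _) h1 2).trans ?_
    rw [hc, div_pow, div_le_div_iff₀ (by positivity) (by positivity)]
    nlinarith [sq_nonneg δ]

end RadialCutoff

/-! ### Pointwise Young estimate, matrix bound and exponents -/

section PointwiseEstimates

variable {d : ℕ}

/-- Young's inequality in the form needed for the energy estimate of `(u - k)₊`. -/
theorem flux_le_of_young {V : Type*} [NormedAddCommGroup V] [InnerProductSpace ℝ V]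
    {a h b e : V} {lam Lam M g w η : ℝ} (hlam : 0 < lam) (hell : lam * ‖h‖ ^ 2 ≤ ⟪a, h⟫)
    (ha : ‖a‖ ≤ M * ‖h‖) (hb : ‖b‖ ≤ Lam) (hw : 0 ≤ w) (hη : 0 ≤ η) :
    -⟪a, w • ((2 * η) • e)⟫ - ⟪a, η ^ 2 • h⟫ + (⟪b, h⟫ + g) * (η ^ 2 * w) ≤
      -(lam / 4) * (η ^ 2 * ‖h‖ ^ 2) +
        (2 * M ^ 2 * ‖e‖ ^ 2 + Lam ^ 2 * η ^ 2) / lam * w ^ 2 + |g| * w * η ^ 2 := by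
  have h1 : -⟪a, e⟫ ≤ M * ‖h‖ * ‖e‖ :=
    ((neg_le_abs _).trans (abs_real_inner_le_norm a e)).trans (by gcongr)
  have h2 : ⟪b, h⟫ ≤ Lam * ‖h‖ := (real_inner_le_norm b h).trans (by gcongr)
  have h3 : g ≤ |g| := le_abs_self g
  simp only [real_inner_smul_right]
  have e1 := mul_le_mul_of_nonneg_left h1 (show 0 ≤ 2 * η * w by positivity)
  have e2 := mul_le_mul_of_nonneg_left h2 (show 0 ≤ η ^ 2 * w by positivity)
  have e3 := mul_le_mul_of_nonneg_left h3 (show 0 ≤ η ^ 2 * w by positivity)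
  have e4 := mul_le_mul_of_nonneg_left hell (sq_nonneg η)
  -- The cross term uses `λ/2` of the coercivity and the drift term `y2` uses `λ/4`, so `λ/4`
  -- remains; doubling it later gives `γ₁ = λ/2`.
  have y1 : 2 * η * w * (M * ‖h‖ * ‖e‖) ≤
      lam / 2 * (η ^ 2 * ‖h‖ ^ 2) + 2 * M ^ 2 * ‖e‖ ^ 2 / lam * w ^ 2 := by
    have := mul_nonneg (show 0 ≤ (2 * lam)⁻¹ by positivity)
      (sq_nonneg (lam * (η * ‖h‖) - 2 * (M * ‖e‖ * w)))
    have e : (2 * lam)⁻¹ * (lam * (η * ‖h‖) - 2 * (M * ‖e‖ * w)) ^ 2 =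
      lam / 2 * (η ^ 2 * ‖h‖ ^ 2) + 2 * M ^ 2 * ‖e‖ ^ 2 / lam * w ^ 2
        - 2 * η * w * (M * ‖h‖ * ‖e‖) := by
      field_simp
      ring
    linarith
  have y2 : η ^ 2 * w * (Lam * ‖h‖) ≤
      lam / 4 * (η ^ 2 * ‖h‖ ^ 2) + Lam ^ 2 * η ^ 2 / lam * w ^ 2 := by
    have := mul_nonneg (show 0 ≤ (4 * lam)⁻¹ * η ^ 2 by positivity)
      (sq_nonneg (lam * ‖h‖ - 2 * (Lam * w)))
    have e : (4 * lam)⁻¹ * η ^ 2 * (lam * ‖h‖ - 2 * (Lam * w)) ^ 2 =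
      lam / 4 * (η ^ 2 * ‖h‖ ^ 2) + Lam ^ 2 * η ^ 2 / lam * w ^ 2
        - η ^ 2 * w * (Lam * ‖h‖) := by
      field_simp
      ring
    linarith
  have e5 : (2 * M ^ 2 * ‖e‖ ^ 2 + Lam ^ 2 * η ^ 2) / lam * w ^ 2 =
    2 * M ^ 2 * ‖e‖ ^ 2 / lam * w ^ 2 + Lam ^ 2 * η ^ 2 / lam * w ^ 2 := by ring
  linarith

/-- Nonnegativity of the form at `L x - T x` reads `0 ≤ L²⟪Tx, x⟫ - 2L‖Tx‖² + ⟪T(Tx), Tx⟫`. The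
upper bound at `x` and at `Tx` then gives `L‖Tx‖² ≤ L³‖x‖²`. -/
theorem norm_apply_le_of_isSymmetric {V : Type*} [NormedAddCommGroup V]
    [InnerProductSpace ℝ V] {T : V →ₗ[ℝ] V} (hT : T.IsSymmetric) {L : ℝ} (hL : 0 < L)
    (h0 : ∀ x, 0 ≤ ⟪T x, x⟫) (h1 : ∀ x, ⟪T x, x⟫ ≤ L * ‖x‖ ^ 2) (x : V) : ‖T x‖ ≤ L * ‖x‖ := by
  have h2 := h0 (L • x - T x)
  have h3 : ⟪T (T x), x⟫ = ‖T x‖ ^ 2 := by rw [hT, real_inner_self_eq_norm_sq]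
  simp only [map_sub, map_smul, inner_sub_left, inner_sub_right, real_inner_smul_left,
    real_inner_smul_right, real_inner_self_eq_norm_sq, h3] at h2
  have h4 := h1 (T x)
  have h5 := h1 x
  have h6 : L * ‖T x‖ ^ 2 ≤ L * (L * ‖x‖) ^ 2 := by
    nlinarith [mul_le_mul_of_nonneg_left h5 (sq_nonneg L)]
  exact le_of_sq_le_sq (le_of_mul_le_mul_left h6 hL) (by positivity)

theorem two_mul_le_diam (hd : 1 ≤ d) {Ω : Set (Space d)} (hΩ : Bornology.IsBounded Ω)
    {x₀ : Space d} {R : ℝ} (hR : 0 ≤ R) (h : Metric.ball x₀ R ⊆ Ω) : 2 * R ≤ Metric.diam Ω := by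
  have : Nonempty (Fin d) := ⟨⟨0, hd⟩⟩
  rw [← Metric.diam_ball_eq x₀ hR]
  exact Metric.diam_mono h hΩ

/-- Hölder's inequality; `2 ≤ q` gives a conjugate exponent at most `2`, so `w` has a finite norm on
a finite measure space. -/
theorem integral_abs_mul_le {α : Type*} [MeasurableSpace α] {μ : Measure α} [IsFiniteMeasure μ]
    {q : ℝ≥0∞} (hq : 2 ≤ q) {g w : α → ℝ} (hg : MemLp g q μ) (hw : MemLp w 2 μ)
    (hw0 : ∀ x, 0 ≤ w x) :
    ∫ x, |g x| * w x ∂μ ≤ (eLpNorm g q μ).toReal *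
      (∫ x, w x ^ q.conjExponent.toReal ∂μ) ^ (1 / q.conjExponent.toReal) := by
  have hq1 : 1 ≤ q := one_le_two.trans hq
  have : q.HolderConjugate q.conjExponent := .conjExponent hq1
  have hp2 : q.conjExponent ≤ 2 := by
    have h1 : (1 : ℝ≥0∞) ≤ q - 1 := by
      rw [← one_add_one_eq_two] at hq
      exact ENNReal.le_sub_of_add_le_left ENNReal.one_ne_top hq
    rw [ENNReal.conjExponent, ← one_add_one_eq_two]
    gcongr
    exact ENNReal.inv_le_one.2 h1
  have hpt : q.conjExponent ≠ ⊤ := ne_top_of_le_ne_top (by norm_num) hp2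
  have hp0 : q.conjExponent ≠ 0 := by simp [ENNReal.conjExponent]
  have hwp : MemLp w q.conjExponent μ := hw.mono_exponent hp2
  have h1 := eLpNorm_smul_le_mul_eLpNorm hw.1 hg.1 (p := q) (q := q.conjExponent) (r := 1)
  have h2 : ∫ x, |g x| * w x ∂μ = (eLpNorm (g • w) 1 μ).toReal := by
    rw [eLpNorm_one_eq_lintegral_enorm, ← integral_norm_eq_lintegral_enorm (hg.1.smul hw.1)]
    refine integral_congr_ae (ae_of_all _ fun x => ?_)
    simp [abs_of_nonneg (hw0 x)]
  have h3 : (∫ x, w x ^ q.conjExponent.toReal ∂μ) ^ (1 / q.conjExponent.toReal) =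
      (eLpNorm w q.conjExponent μ).toReal := by
    rw [hwp.eLpNorm_eq_integral_rpow_norm hp0 hpt, ENNReal.toReal_ofReal (by positivity), one_div]
    simp only [Real.norm_of_nonneg (hw0 _)]
  rw [h2, h3, ← ENNReal.toReal_mul]
  exact ENNReal.toReal_mono (ENNReal.mul_ne_top hg.2.ne hwp.2.ne) h1

theorem conjExponent_ne_top {q : ℝ≥0∞} (hq : 1 < q) : q.conjExponent ≠ ⊤ := by
  rw [ENNReal.conjExponent]
  exact ENNReal.add_ne_top.2 ⟨ENNReal.one_ne_top, ENNReal.inv_ne_top.2 (tsub_pos_of_lt hq).ne'⟩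

theorem one_le_toReal_conjExponent {q : ℝ≥0∞} (hq : 1 < q) : 1 ≤ q.conjExponent.toReal := by
  rw [← ENNReal.toReal_one]
  exact ENNReal.toReal_mono (conjExponent_ne_top hq) le_self_add

/-- The hypothesis says `q - 1 ≥ d/2`, and the conjugate exponent is `1 + 1/(q-1)`, also for `q =
∞`. -/
theorem toReal_conjExponent_le (hd : 1 ≤ d) {q : ℝ≥0∞} (hq : ((d : ℝ≥0∞) + 2) / 2 ≤ q) :
    q.conjExponent.toReal ≤ ((d : ℝ) + 2) / d := by
  have hd0 : (d : ℝ≥0∞) / 2 ≠ 0 := by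
    simpa using Nat.one_le_iff_ne_zero.1 hd
  have hd1 : (d : ℝ) ≠ 0 := by exact_mod_cast Nat.one_le_iff_ne_zero.1 hd
  have h1 : (d : ℝ≥0∞) / 2 ≤ q - 1 := by
    refine ENNReal.le_sub_of_add_le_right ENNReal.one_ne_top ?_
    rwa [ENNReal.add_div, ENNReal.div_self (by norm_num) (by norm_num)] at hq
  have h2 : q.conjExponent ≤ 1 + ((d : ℝ≥0∞) / 2)⁻¹ := by
    rw [ENNReal.conjExponent]
    gcongr
  refine (ENNReal.toReal_mono (ENNReal.add_ne_top.2 ⟨ENNReal.one_ne_top,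
    ENNReal.inv_ne_top.2 hd0⟩) h2).trans_eq ?_
  rw [ENNReal.toReal_add ENNReal.one_ne_top (ENNReal.inv_ne_top.2 hd0)]
  simp
  field_simp

end PointwiseEstimates

/-! ### The De Giorgi inequality on balls -/

section DeGiorgiEnergy

variable {d : ℕ}

theorem gradient_sq {η : Space d → ℝ} {x : Space d} (h : DifferentiableAt ℝ η x) :
    gradient (fun x => η x ^ 2) x = (2 * η x) • gradient η x := by
  have h1 : HasFDerivAt (fun x => η x ^ 2) _ x := h.hasFDerivAt.pow 2
  refine ext_inner_right ℝ fun v => ?_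
  rw [inner_gradient, h1.fderiv, real_inner_smul_left, inner_gradient]
  simp

theorem memLp_truncation {α : Type*} [MeasurableSpace α] {μ : Measure α} [IsFiniteMeasure μ]
    {w : α → ℝ} (hw : MemLp w 2 μ) (k : ℝ) : MemLp (fun x => max (w x - k) 0) 2 μ := by
  refine (hw.norm.add (memLp_const |k|)).mono
    ((show Continuous fun a : ℝ => max (a - k) 0 by fun_prop).comp_aestronglyMeasurable hw.1)
    (ae_of_all _ fun x => ?_)
  rw [Real.norm_of_nonneg (le_max_right _ _)]
  exact (max_sub_le _ _).trans (le_abs_self _)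

theorem setIntegral_le_integral_cutoff_mul {Ω S S' : Set (Space d)}
    (hS : MeasurableSet S) (hSΩ : S' ⊆ Ω)
    {ψ w : Space d → ℝ} (hψ : Continuous ψ) (hψ0 : ∀ x, 0 ≤ ψ x) (hψ1 : ∀ x, ψ x ≤ 1)
    (hψS : ∀ x ∈ S, ψ x = 1) (hψS' : ∀ x ∉ S', ψ x = 0) (hw : MemLp w 2 (volume.restrict Ω)) :
    (∫ x in S, w x ^ 2) ≤ ∫ x, ψ x * w x ^ 2 ∧
      ∫ x, ψ x * w x ^ 2 ≤ ∫ x in S', w x ^ 2 := by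
  have hi : IntegrableOn (fun x => w x ^ 2) Ω := hw.integrable_sq
  have hi' : IntegrableOn (fun x => ψ x * w x ^ 2) Ω := by
    refine hi.mono' (hψ.aestronglyMeasurable.mul hi.1) (ae_of_all _ fun x => ?_)
    rw [Real.norm_of_nonneg (mul_nonneg (hψ0 x) (sq_nonneg _))]
    exact mul_le_of_le_one_left (sq_nonneg _) (hψ1 x)
  have hz : ∀ x ∉ S', ψ x * w x ^ 2 = 0 := fun x hx => by rw [hψS' x hx, zero_mul]
  have hI : Integrable fun x => ψ x * w x ^ 2 := by
    refine (integrableOn_iff_integrable_of_support_subset fun x hx => ?_).1 hi'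
    by_contra h
    exact hx (hz x fun h' => h (hSΩ h'))
  constructor
  · rw [setIntegral_congr_fun (g := fun x => ψ x * w x ^ 2) hS fun x hx => by simp [hψS x hx]]
    exact setIntegral_le_integral hI (ae_of_all _ fun x => mul_nonneg (hψ0 x) (sq_nonneg _))
  · rw [← setIntegral_eq_integral_of_forall_compl_eq_zero hz]
    refine integral_mono (hi'.mono_set hSΩ) (hi.mono_set hSΩ) fun x => ?_
    exact mul_le_of_le_one_left (sq_nonneg _) (hψ1 x)

theorem memLp_indicator_cylinder {T₁ T₂ : ℝ} {Ω : Set (Space d)} (hΩ : IsOpen Ω) {E : Type*}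
    [NormedAddCommGroup E] {w : ℝ × Space d → E} {p : ℝ≥0∞} :
    MemLp ((cylinder T₁ T₂ Ω).indicator w) p ↔ MemLp w p (cylMeasure T₁ T₂ Ω) :=
  memLp_indicator_iff_restrict (measurableSet_cylinder hΩ)

theorem isFiniteMeasure_cylMeasure {T₁ T₂ : ℝ} {Ω : Set (Space d)}
    (hΩ : Bornology.IsBounded Ω) : IsFiniteMeasure (cylMeasure T₁ T₂ Ω) := by
  have : IsFiniteMeasure (volume.restrict Ω) := ⟨by simpa using hΩ.measure_lt_top⟩
  rw [cylMeasure_eq_prod]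
  infer_instance

/-- Outside the large ball the cutoff kills every term, and where `v ≤ k` the truncation and its
gradient vanish. Elsewhere `flux_le_of_young` applies with `w = v - k`, `h = ∇v` and `e = ∇η`, since
`∇(η²) = 2η∇η`. -/
theorem truncatedFlux_le {v g : ℝ × Space d → ℝ} {G B : ℝ × Space d → Space d}
    {A : ℝ × Space d → Matrix (Fin d) (Fin d) ℝ} {Q : Set (ℝ × Space d)} {lam Lam M D r R : ℝ}
    (hlam : 0 < lam) (hrR : r < R) (hr : 0 < r) (hD : 2 * R ≤ D) {x₀ : Space d} {η : Space d → ℝ}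
    (hηd : Differentiable ℝ η) (hη0 : ∀ x, 0 ≤ η x) (hη1 : ∀ x, η x ≤ 1)
    (hηr : ∀ x ∈ Metric.ball x₀ r, η x = 1) (hηR : ∀ x ∉ Metric.ball x₀ R, η x = 0)
    (hηg : ∀ x, ‖gradient η x‖ ^ 2 ≤ 5 / 4 / (R - r) ^ 2) (k : ℝ) {z : ℝ × Space d}
    (hzQ : z.2 ∈ Metric.ball x₀ R → z ∈ Q)
    (hell : z ∈ Q → lam * ‖G z‖ ^ 2 ≤ ⟪(A z).toEuclideanLin (G z), G z⟫)
    (hA : z ∈ Q → ‖(A z).toEuclideanLin (G z)‖ ≤ M * ‖G z‖) (hB : z ∈ Q → ‖B z‖ ≤ Lam) :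
    truncatedFlux (Q.indicator v) (Q.indicator fun z => ⟪B z, G z⟫ + g z)
        (Q.indicator fun z => (A z).toEuclideanLin (G z)) (Q.indicator G) (fun x => η x ^ 2) k z ≤
      {z | z.2 ∈ Metric.ball x₀ R}.indicator (fun z => (5 * M ^ 2 + Lam ^ 2 * D ^ 2) / lam /
        (R - r) ^ 2 / 2 * max (v z - k) 0 ^ 2 + |g z| * max (v z - k) 0) z -
      lam / 4 * {z | z.2 ∈ Metric.ball x₀ r}.indicator
        (fun z => ‖(Ioi k).indicator (1 : ℝ → ℝ) (v z) • G z‖ ^ 2) z := by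
  rw [truncatedFlux, gradient_sq (hηd z.2)]
  by_cases hzR : z.2 ∈ Metric.ball x₀ R
  swap
  · have hzr : z.2 ∉ Metric.ball x₀ r := fun h => hzR (Metric.ball_subset_ball hrR.le h)
    rw [indicator_of_notMem (s := {z : ℝ × Space d | z.2 ∈ Metric.ball x₀ R}) hzR,
      indicator_of_notMem (s := {z : ℝ × Space d | z.2 ∈ Metric.ball x₀ r}) hzr]
    simp [hηR z.2 hzR]
  have hz := hzQ hzR
  rw [indicator_of_mem (s := {z : ℝ × Space d | z.2 ∈ Metric.ball x₀ R}) hzR]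
  simp only [indicator_of_mem hz]
  rcases le_or_gt (v z) k with hk | hk
  · rw [max_eq_right (sub_nonpos.2 hk), indicator_of_notMem (s := Ioi k) (not_lt.2 hk)]
    have : {z : ℝ × Space d | z.2 ∈ Metric.ball x₀ r}.indicator
        (fun z => ‖(Ioi k).indicator (1 : ℝ → ℝ) (v z) • G z‖ ^ 2) z = 0 := by
      refine indicator_apply_eq_zero.2 fun _ => ?_
      rw [indicator_of_notMem (s := Ioi k) (not_lt.2 hk)]
      simp
    rw [this]
    simp
  have hw : 0 ≤ v z - k := (sub_pos.2 hk).le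
  have hind : {z : ℝ × Space d | z.2 ∈ Metric.ball x₀ r}.indicator
      (fun z => ‖(Ioi k).indicator (1 : ℝ → ℝ) (v z) • G z‖ ^ 2) z ≤ η z.2 ^ 2 * ‖G z‖ ^ 2 := by
    by_cases hzr : z.2 ∈ Metric.ball x₀ r
    · rw [indicator_of_mem (s := {z : ℝ × Space d | z.2 ∈ Metric.ball x₀ r}) hzr,
        indicator_of_mem (s := Ioi k) hk, hηr _ hzr]
      simp
    · rw [indicator_of_notMem (s := {z : ℝ × Space d | z.2 ∈ Metric.ball x₀ r}) hzr]
      positivity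
  rw [max_eq_left hw, indicator_of_mem (s := Ioi k) hk, Pi.one_apply, mul_one]
  refine (flux_le_of_young hlam (hell hz) (hA hz) (hB hz) hw (hη0 z.2)
    (e := gradient η z.2)).trans ?_
  have hη2 : η z.2 ^ 2 ≤ 1 := pow_le_one₀ (hη0 _) (hη1 _)
  have c1 : |g z| * (v z - k) * η z.2 ^ 2 ≤ |g z| * (v z - k) :=
    mul_le_of_le_one_right (by positivity) hη2
  have hρ : 0 < R - r := sub_pos.2 hrR
  -- The gradient bound turns `2M²|∇η|²` into half of `5M²/(R-r)²`. The drift term fits because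
  -- `2(R-r) ≤ 2R ≤ D`, hence `1 ≤ D²/(2(R-r)²)`.
  have c2 : (2 * M ^ 2 * ‖gradient η z.2‖ ^ 2 + Lam ^ 2 * η z.2 ^ 2) / lam ≤
      (5 * M ^ 2 + Lam ^ 2 * D ^ 2) / lam / (R - r) ^ 2 / 2 := by
    have e : (5 * M ^ 2 + Lam ^ 2 * D ^ 2) / lam / (R - r) ^ 2 / 2 =
      (2 * M ^ 2 * (5 / 4 / (R - r) ^ 2) + Lam ^ 2 * (D ^ 2 / (2 * (R - r) ^ 2))) / lam := by
      field_simp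
      ring
    rw [e]
    have h1 : (1 : ℝ) ≤ D ^ 2 / (2 * (R - r) ^ 2) := by
      rw [le_div_iff₀ (by positivity)]
      nlinarith
    gcongr
    · exact hηg _
    · exact hη2.trans h1
  have c3 := mul_le_mul_of_nonneg_right c2 (sq_nonneg (v z - k))
  have c4 := mul_le_mul_of_nonneg_left hind (show 0 ≤ lam / 4 by positivity)
  linarith

/-- `energy_inequality_all_times` with cutoff `ψ = η²`, the flux being bounded pointwise by
`truncatedFlux_le` and the source integral by Hölder's inequality. -/
theorem deGiorgi_energy (hd : 1 ≤ d) {T₁ T₂ : ℝ} {Ω : Set (Space d)}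
    (hΩ : IsOpen Ω) (hΩb : Bornology.IsBounded Ω) {lam Lam M : ℝ} {q : ℝ≥0∞} (hq : 2 ≤ q)
    {v g : ℝ × Space d → ℝ} {G B : ℝ × Space d → Space d}
    {A : ℝ × Space d → Matrix (Fin d) (Fin d) ℝ} (hlam : 0 < lam)
    (hell : ∀ᵐ z ∂(cylMeasure T₁ T₂ Ω), ∀ ξ : Space d,
      lam * ‖ξ‖ ^ 2 ≤ ⟪(A z).toEuclideanLin ξ, ξ⟫)
    (hA : ∀ᵐ z ∂(cylMeasure T₁ T₂ Ω), ∀ ξ : Space d, ‖(A z).toEuclideanLin ξ‖ ≤ M * ‖ξ‖)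
    (hB : ∀ᵐ z ∂(cylMeasure T₁ T₂ Ω), ‖B z‖ ≤ Lam)
    (hvs : ∀ t ∈ Icc T₁ T₂, MemLp (fun x => v (t, x)) 2 (volume.restrict Ω))
    (hvc : ∀ K ⊆ Ω, IsCompact K → ∀ t₀ ∈ Icc T₁ T₂,
      Tendsto (fun t => eLpNorm (fun x => v (t, x) - v (t₀, x)) 2 (volume.restrict K))
        (𝓝[Icc T₁ T₂] t₀) (𝓝 0))
    (hv : MemLp v 2 (cylMeasure T₁ T₂ Ω)) (hG : MemLp G 2 (cylMeasure T₁ T₂ Ω))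
    (hg : MemLp g q (cylMeasure T₁ T₂ Ω))
    (hf : MemLp ((cylinder T₁ T₂ Ω).indicator fun z => ⟪B z, G z⟫ + g z) 2)
    (hF : MemLp ((cylinder T₁ T₂ Ω).indicator fun z => (A z).toEuclideanLin (G z)) 2)
    (hgrad : ∀ φ, IsTestFunction (cylinder T₁ T₂ Ω) φ →
      ∫ y, (cylinder T₁ T₂ Ω).indicator v y • spaceGrad φ y =
        -∫ y, φ y • (cylinder T₁ T₂ Ω).indicator G y)
    (hsub : ∀ φ, IsTestFunction (cylinder T₁ T₂ Ω) φ → (∀ z, 0 ≤ φ z) →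
      divForm ((cylinder T₁ T₂ Ω).indicator v)
        ((cylinder T₁ T₂ Ω).indicator fun z => (A z).toEuclideanLin (G z))
        ((cylinder T₁ T₂ Ω).indicator fun z => ⟪B z, G z⟫ + g z) φ ≤ 0)
    {γ₃ : ℝ} (hγ₃ : 2 * (eLpNorm g q (cylMeasure T₁ T₂ Ω)).toReal ≤ γ₃)
    (k : ℝ) {s t : ℝ} (hs : T₁ ≤ s) (hst : s < t) (ht : t ≤ T₂) {r R : ℝ} (hr : 0 < r)
    (hrR : r < R) {x₀ : Space d} (hball : Metric.ball x₀ R ⊆ Ω) :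
    (∫ x in Metric.ball x₀ r, max (v (t, x) - k) 0 ^ 2)
        + lam / 2 * ∫ z in Ioo s t ×ˢ Metric.ball x₀ r,
          ‖(Ioi k).indicator (1 : ℝ → ℝ) (v z) • G z‖ ^ 2
      ≤ (∫ x in Metric.ball x₀ R, max (v (s, x) - k) 0 ^ 2)
        + (5 * M ^ 2 + Lam ^ 2 * Metric.diam Ω ^ 2) / lam / (R - r) ^ 2 *
          (∫ z in Ioo s t ×ˢ Metric.ball x₀ R, max (v z - k) 0 ^ 2)
        + γ₃ * (∫ z in Ioo s t ×ˢ Metric.ball x₀ R,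
          max (v z - k) 0 ^ q.conjExponent.toReal) ^ (1 / q.conjExponent.toReal) := by
  obtain ⟨η, hη, hη0, hη1, hηr, hηg⟩ := exists_radial_cutoff x₀ hrR
  have hηR : ∀ x ∉ Metric.ball x₀ R, η x = 0 := fun x hx =>
    image_eq_zero_of_notMem_tsupport fun h => hx (hη.support_subset h)
  have hηc := hη.smooth.continuous
  have hψ : IsTestFunction Ω fun x => η x ^ 2 := by
    refine ⟨hη.smooth.pow 2, hη.compact.comp_left (g := fun a => a ^ 2) (by simp), ?_⟩
    refine (closure_mono fun x hx => ?_).trans (hη.support_subset.trans hball)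
    contrapose! hx
    simp only [Function.mem_support, not_not] at hx ⊢
    simp [hx]
  have hψ0 : ∀ x, 0 ≤ η x ^ 2 := fun x => sq_nonneg _
  have hψ1 : ∀ x, η x ^ 2 ≤ 1 := fun x => pow_le_one₀ (hη0 x) (hη1 x)
  have hRn : 0 ≤ R := (hr.trans hrR).le
  have hfin : IsFiniteMeasure (cylMeasure T₁ T₂ Ω) := isFiniteMeasure_cylMeasure hΩb
  have hfinΩ : IsFiniteMeasure (volume.restrict Ω) := ⟨by simpa using hΩb.measure_lt_top⟩
  set Q := cylinder T₁ T₂ Ω with hQ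
  have hQm : MeasurableSet Q := measurableSet_cylinder hΩ
  set μ := (volume : Measure (ℝ × Space d)).restrict (Ioo s t ×ˢ Metric.ball x₀ R) with hμ
  have hSQ : Ioo s t ×ˢ Metric.ball x₀ R ⊆ Q :=
    prod_mono (Ioo_subset_Ioo hs ht) hball
  have hμQ : μ ≤ cylMeasure T₁ T₂ Ω := Measure.restrict_mono_set _ hSQ
  have hμfin : IsFiniteMeasure μ := ⟨(hμQ univ).trans_lt (measure_lt_top _ _)⟩
  set C := (5 * M ^ 2 + Lam ^ 2 * Metric.diam Ω ^ 2) / lam / (R - r) ^ 2 with hC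
  set w : ℝ × Space d → ℝ := fun z => max (v z - k) 0 with hw
  have hw0 : ∀ z, 0 ≤ w z := fun z => le_max_right _ _
  have hwμ : MemLp w 2 μ := memLp_truncation (hv.mono_measure hμQ) k
  have hgμ : MemLp g 2 μ := (hg.mono_measure hμQ).mono_exponent hq
  have iw : Integrable (fun z => w z ^ 2) μ := hwμ.integrable_sq
  have ig : Integrable (fun z => |g z| * w z) μ := hgμ.abs.integrable_mul hwμ
  have hvm : AEStronglyMeasurable v (cylMeasure T₁ T₂ Ω) := hv.1
  have hH : MemLp (fun z => (Ioi k).indicator (1 : ℝ → ℝ) (v z) • G z) 2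
      (cylMeasure T₁ T₂ Ω) := by
    refine hG.mono ((((measurable_indicator_Ioi k).comp_aemeasurable
      hvm.aemeasurable).aestronglyMeasurable).smul hG.1) (ae_of_all _ fun z => ?_)
    rw [norm_smul]
    exact mul_le_of_le_one_left (norm_nonneg _) (abs_indicator_Ioi_le k _)
  have hslab : ∀ ρ : ℝ, slab d s t ∩ {z | z.2 ∈ Metric.ball x₀ ρ} =
      Ioo s t ×ˢ Metric.ball x₀ ρ := fun ρ => by
    ext z
    simp [slab]
  have hmb : ∀ ρ : ℝ, MeasurableSet {z : ℝ × Space d | z.2 ∈ Metric.ball x₀ ρ} := fun ρ =>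
    measurable_snd measurableSet_ball
  set P : ℝ × Space d → ℝ := fun z => C / 2 * w z ^ 2 + |g z| * w z with hP
  set N : ℝ × Space d → ℝ := fun z => ‖(Ioi k).indicator (1 : ℝ → ℝ) (v z) • G z‖ ^ 2 with hN
  have iP : Integrable P μ := (iw.const_mul _).add ig
  have iN : IntegrableOn N (Ioo s t ×ˢ Metric.ball x₀ r) := by
    have h1 : Integrable N (cylMeasure T₁ T₂ Ω) := hH.norm.integrable_sq
    exact IntegrableOn.mono_set h1 (prod_mono (Ioo_subset_Ioo hs ht)
      ((Metric.ball_subset_ball hrR.le).trans hball))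
  have jP : IntegrableOn ({z | z.2 ∈ Metric.ball x₀ R}.indicator P) (slab d s t) := by
    rw [IntegrableOn, integrable_indicator_iff (hmb R), IntegrableOn,
      Measure.restrict_restrict (hmb R), inter_comm, hslab]
    exact iP
  have jN : IntegrableOn ({z | z.2 ∈ Metric.ball x₀ r}.indicator N) (slab d s t) := by
    rw [IntegrableOn, integrable_indicator_iff (hmb r), IntegrableOn,
      Measure.restrict_restrict (hmb r), inter_comm, hslab]
    exact iN
  have hv0 : MemLp (Q.indicator v) 2 := (memLp_indicator_cylinder hΩ).2 hv
  have hG0 : MemLp (Q.indicator G) 2 := (memLp_indicator_cylinder hΩ).2 hG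
  have e : ∀ τ, ∫ x, η x ^ 2 * (w (τ, x) ^ 2 / 2) = (∫ x, η x ^ 2 * w (τ, x) ^ 2) / 2 :=
    fun τ => by
      rw [← integral_div]
      simp_rw [mul_div_assoc]
  have key : (∫ x, η x ^ 2 * w (t, x) ^ 2) / 2 - (∫ x, η x ^ 2 * w (s, x) ^ 2) / 2 ≤
      ∫ z in slab d s t, truncatedFlux (Q.indicator v)
        (Q.indicator fun z => ⟪B z, G z⟫ + g z) (Q.indicator fun z => (A z).toEuclideanLin (G z))
        (Q.indicator G) (fun x => η x ^ 2) k z := by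
    rw [← e, ← e]
    exact energy_inequality_all_times hΩ hvs hvc hv0 hf hF hG0 hgrad hsub k hψ
      hψ0 hψ1 hs hst ht
  have bound : ∫ z in slab d s t, truncatedFlux (Q.indicator v)
      (Q.indicator fun z => ⟪B z, G z⟫ + g z) (Q.indicator fun z => (A z).toEuclideanLin (G z))
      (Q.indicator G) (fun x => η x ^ 2) k z ≤
      ∫ z in slab d s t, ({z | z.2 ∈ Metric.ball x₀ R}.indicator P z -
        lam / 4 * {z | z.2 ∈ Metric.ball x₀ r}.indicator N z) := by
    refine integral_mono_ae (integrableOn_truncatedFlux hψ k s t hv0 hf hF hG0 hψ0 hψ1)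
      (jP.sub (jN.const_mul _)) ?_
    filter_upwards [ae_restrict_mem (measurableSet_slab s t),
      ae_restrict_of_ae ((ae_restrict_iff' hQm).1 hell),
      ae_restrict_of_ae ((ae_restrict_iff' hQm).1 hA),
      ae_restrict_of_ae ((ae_restrict_iff' hQm).1 hB)] with z hz h1 h2 h3
    exact truncatedFlux_le hlam hrR hr (two_mul_le_diam hd hΩb hRn hball) hη.differentiable hη0 hη1
      hηr hηR hηg k (fun hzR => hSQ ⟨hz.1, hzR⟩) (fun h => h1 h _) (fun h => h2 h _) h3
  rw [integral_sub jP (jN.const_mul _), integral_const_mul, setIntegral_indicator (hmb R),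
    setIntegral_indicator (hmb r), hslab, hslab, integral_add (iw.const_mul _) ig,
    integral_const_mul] at bound
  have hwt : ∀ τ ∈ Icc T₁ T₂, MemLp (fun x => w (τ, x)) 2 (volume.restrict Ω) := fun τ hτ =>
    memLp_truncation (hvs τ hτ) k
  have E := fun τ hτ => setIntegral_le_integral_cutoff_mul
    (S := Metric.ball x₀ r) (ψ := fun x => η x ^ 2) measurableSet_ball hball (hηc.pow 2) hψ0 hψ1
    (fun x hx => by simp [hηr x hx]) (fun x hx => by simp [hηR x hx]) (hwt τ hτ)
  have Et := (E t ⟨by linarith, ht⟩).1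
  have Es := (E s ⟨hs, by linarith⟩).2
  have hold := integral_abs_mul_le hq (hg.mono_measure hμQ) hwμ hw0
  have hmono : (eLpNorm g q μ).toReal ≤ (eLpNorm g q (cylMeasure T₁ T₂ Ω)).toReal :=
    ENNReal.toReal_mono hg.2.ne (eLpNorm_mono_measure _ hμQ)
  have hpow : 0 ≤ (∫ z, w z ^ q.conjExponent.toReal ∂μ) ^ (1 / q.conjExponent.toReal) :=
    Real.rpow_nonneg (integral_nonneg fun z => Real.rpow_nonneg (hw0 z) _) _
  have hlast : 2 * ∫ z, |g z| * w z ∂μ ≤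
      γ₃ * (∫ z, w z ^ q.conjExponent.toReal ∂μ) ^ (1 / q.conjExponent.toReal) := by
    nlinarith
  -- The energy inequality bounds half of the squares; doubling it produces `λ/2`, `C` and the
  -- factor `2` in `γ₃`.
  change (∫ x in Metric.ball x₀ r, w (t, x) ^ 2)
      + lam / 2 * (∫ z in Ioo s t ×ˢ Metric.ball x₀ r, N z) ≤
    (∫ x in Metric.ball x₀ R, w (s, x) ^ 2) + C * (∫ z, w z ^ 2 ∂μ)
      + γ₃ * (∫ z, w z ^ q.conjExponent.toReal ∂μ) ^ (1 / q.conjExponent.toReal)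
  linarith

end DeGiorgiEnergy

/-! ### From the cylinder to the whole space by extension with zero -/

section CylinderIntegrals

variable {d : ℕ} {T₁ T₂ : ℝ} {Ω : Set (Space d)}

theorem integral_map₂_indicator {E E' E'' : Type*} [Zero E] [NormedAddCommGroup E'']
    [NormedSpace ℝ E''] (hΩ : IsOpen Ω) (c : E → E' → E'') (hc : ∀ y, c 0 y = 0)
    (w : ℝ × Space d → E) (h : ℝ × Space d → E') :
    ∫ z, c ((cylinder T₁ T₂ Ω).indicator w z) (h z) =
      ∫ z, c (w z) (h z) ∂(cylMeasure T₁ T₂ Ω) := by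
  rw [cylMeasure, ← integral_indicator (measurableSet_cylinder hΩ)]
  refine integral_congr_ae (ae_of_all _ fun z => ?_)
  by_cases hz : z ∈ cylinder T₁ T₂ Ω <;> simp [hz, hc]

theorem divForm_indicator (hΩ : IsOpen Ω) (u f : ℝ × Space d → ℝ) (F : ℝ × Space d → Space d)
    (φ : ℝ × Space d → ℝ) :
    divForm ((cylinder T₁ T₂ Ω).indicator u) ((cylinder T₁ T₂ Ω).indicator F)
      ((cylinder T₁ T₂ Ω).indicator f) φ =
      -(∫ z, u z * timeDeriv φ z ∂(cylMeasure T₁ T₂ Ω))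
        + (∫ z, ⟪F z, spaceGrad φ z⟫ ∂(cylMeasure T₁ T₂ Ω))
        - ∫ z, f z * φ z ∂(cylMeasure T₁ T₂ Ω) := by
  rw [divForm, integral_map₂_indicator hΩ (fun a b : ℝ => a * b) (by simp),
    integral_map₂_indicator hΩ (fun a b : Space d => ⟪a, b⟫) (by simp),
    integral_map₂_indicator hΩ (fun a b : ℝ => a * b) (by simp)]

theorem IsWeakSpaceGrad.integral_indicator_eq (hΩ : IsOpen Ω) {w : ℝ × Space d → ℝ}
    {G : ℝ × Space d → Space d} (h : IsWeakSpaceGrad T₁ T₂ Ω w G) {φ : ℝ × Space d → ℝ}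
    (hφ : IsTestFunction (cylinder T₁ T₂ Ω) φ) :
    ∫ y, (cylinder T₁ T₂ Ω).indicator w y • spaceGrad φ y =
      -∫ y, φ y • (cylinder T₁ T₂ Ω).indicator G y := by
  rw [integral_map₂_indicator hΩ (fun (a : ℝ) (b : Space d) => a • b) (by simp),
    integral_map₂_indicator hΩ (fun (a : Space d) (b : ℝ) => b • a) (by simp)]
  exact h.integral_eq φ hφ

theorem IsWeakSpaceGrad.congr {u v : ℝ × Space d → ℝ}
    {G : ℝ × Space d → Space d} (h : IsWeakSpaceGrad T₁ T₂ Ω u G)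
    (huv : v =ᵐ[cylMeasure T₁ T₂ Ω] u) (hv : Integrable v (cylMeasure T₁ T₂ Ω)) :
    IsWeakSpaceGrad T₁ T₂ Ω v G where
  locallyIntegrable := IntegrableOn.locallyIntegrableOn hv
  memLp := h.memLp
  integral_eq φ hφ := by
    rw [← h.integral_eq φ hφ]
    refine integral_congr_ae ?_
    filter_upwards [huv] with z hz
    rw [hz]

theorem InLinftyL2.memLp {u : ℝ × Space d → ℝ} (h : InLinftyL2 T₁ T₂ Ω u) :
    MemLp u 2 (cylMeasure T₁ T₂ Ω) := by
  refine ⟨h.measurable, ?_⟩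
  obtain ⟨C, hC⟩ := h.bounded
  have hm : AEMeasurable (fun z => ‖u z‖ₑ ^ (2 : ℝ))
      ((volume.restrict (Ioo T₁ T₂)).prod (volume.restrict Ω)) := by
    rw [← cylMeasure_eq_prod]
    exact h.measurable.enorm.pow_const _
  have h1 : eLpNorm u 2 (cylMeasure T₁ T₂ Ω) ^ (2 : ℝ) < ⊤ := by
    rw [← lintegral_sq_eq_eLpNorm, cylMeasure_eq_prod, lintegral_prod _ hm]
    calc ∫⁻ t in Ioo T₁ T₂, ∫⁻ x in Ω, ‖u (t, x)‖ₑ ^ (2 : ℝ)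
        ≤ ∫⁻ _ in Ioo T₁ T₂, (C : ℝ≥0∞) ^ (2 : ℝ) := by
          refine lintegral_mono_ae ?_
          filter_upwards [hC] with t ht
          rw [lintegral_sq_eq_eLpNorm (fun x => u (t, x))]
          exact ENNReal.rpow_le_rpow ht zero_le_two
      _ < ⊤ := by
          rw [setLIntegral_const]
          exact ENNReal.mul_lt_top (ENNReal.rpow_lt_top_of_nonneg zero_le_two (by simp)) (by simp)
  exact (ENNReal.rpow_lt_top_iff_of_pos zero_lt_two).1 h1

theorem InLinftyL2.congr {u v : ℝ × Space d → ℝ} (h : InLinftyL2 T₁ T₂ Ω u)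
    (huv : v =ᵐ[cylMeasure T₁ T₂ Ω] u) : InLinftyL2 T₁ T₂ Ω v := by
  refine ⟨h.measurable.congr huv.symm, ?_⟩
  obtain ⟨C, hC⟩ := h.bounded
  refine ⟨C, ?_⟩
  have h1 : ∀ᵐ t ∂(volume.restrict (Ioo T₁ T₂)), ∀ᵐ x ∂(volume.restrict Ω),
      v (t, x) = u (t, x) := by
    have h2 := huv
    rw [cylMeasure_eq_prod] at h2
    exact Measure.ae_ae_of_ae_prod h2
  filter_upwards [hC, h1] with t ht ht1
  rwa [eLpNorm_congr_ae ht1]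

/-- The vector identity is checked against each direction `ξ`, which is the scalar form provided by
`weak_chain_rule_truncation`. -/
theorem isWeakSpaceGrad_truncation (hΩ : IsOpen Ω) (hΩb : Bornology.IsBounded Ω)
    {v : ℝ × Space d → ℝ} {G : ℝ × Space d → Space d} (hv : MemLp v 2 (cylMeasure T₁ T₂ Ω))
    (h : IsWeakSpaceGrad T₁ T₂ Ω v G) (k : ℝ) :
    IsWeakSpaceGrad T₁ T₂ Ω (fun z => max (v z - k) 0)
      (fun z => (Ioi k).indicator (1 : ℝ → ℝ) (v z) • G z) := by
  have hfin : IsFiniteMeasure (cylMeasure T₁ T₂ Ω) := isFiniteMeasure_cylMeasure hΩb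
  have hw := memLp_truncation hv k
  have hvm : AEStronglyMeasurable v (cylMeasure T₁ T₂ Ω) := hv.1
  have hH : MemLp (fun z => (Ioi k).indicator (1 : ℝ → ℝ) (v z) • G z) 2
      (cylMeasure T₁ T₂ Ω) := by
    refine h.memLp.mono ((((measurable_indicator_Ioi k).comp_aemeasurable
      hvm.aemeasurable).aestronglyMeasurable).smul h.memLp.1) (ae_of_all _ fun z => ?_)
    rw [norm_smul]
    exact mul_le_of_le_one_left (norm_nonneg _) (abs_indicator_Ioi_le k _)
  refine ⟨IntegrableOn.locallyIntegrableOn (hw.integrable one_le_two), hH, fun φ hφ => ?_⟩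
  have hg2 : MemLp (spaceGrad φ) 2 (cylMeasure T₁ T₂ Ω) := (hφ.memLp_spaceGrad 2).restrict _
  have hφ2 : MemLp φ 2 (cylMeasure T₁ T₂ Ω) := (hφ.memLp_volume 2).restrict _
  have i1 : Integrable (fun z => max (v z - k) 0 • spaceGrad φ z) (cylMeasure T₁ T₂ Ω) :=
    memLp_one_iff_integrable.1 (hg2.smul (r := 1) hw)
  have i2 : Integrable (fun z => φ z • (Ioi k).indicator (1 : ℝ → ℝ) (v z) • G z)
      (cylMeasure T₁ T₂ Ω) := memLp_one_iff_integrable.1 (hH.smul (r := 1) hφ2)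
  have key := weak_chain_rule_truncation hΩ ((memLp_indicator_cylinder hΩ).2 hv)
    ((memLp_indicator_cylinder hΩ).2 h.memLp) (fun φ hφ => h.integral_indicator_eq hΩ hφ) k hφ
  have hz : ∀ z ∉ cylinder T₁ T₂ Ω, z ∉ tsupport φ := fun z hz h => hz (hφ.support_subset h)
  refine ext_inner_right ℝ fun ξ => ?_
  rw [real_inner_comm, inner_neg_left, real_inner_comm ξ (∫ z, φ z • _ ∂_), ← integral_inner i1,
    ← integral_inner i2]
  have e1 : ∫ z, ⟪ξ, max (v z - k) 0 • spaceGrad φ z⟫ ∂(cylMeasure T₁ T₂ Ω) =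
      ∫ z, ⟪max ((cylinder T₁ T₂ Ω).indicator v z - k) 0 • ξ, spaceGrad φ z⟫ := by
    refine (setIntegral_congr_fun (measurableSet_cylinder hΩ) fun z hz => ?_).trans
      (setIntegral_eq_integral_of_forall_compl_eq_zero fun z h => ?_)
    · rw [indicator_of_mem hz, real_inner_smul_left, real_inner_smul_right]
    · rw [spaceGrad_eq_zero_of_notMem_tsupport hφ.differentiable (hz z h), inner_zero_right]
  have e2 : ∫ z, ⟪ξ, φ z • (Ioi k).indicator (1 : ℝ → ℝ) (v z) • G z⟫ ∂(cylMeasure T₁ T₂ Ω) =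
      ∫ z, ⟪φ z • ξ, (Ioi k).indicator (1 : ℝ → ℝ) ((cylinder T₁ T₂ Ω).indicator v z) •
        (cylinder T₁ T₂ Ω).indicator G z⟫ := by
    refine (setIntegral_congr_fun (measurableSet_cylinder hΩ) fun z hz => ?_).trans
      (setIntegral_eq_integral_of_forall_compl_eq_zero fun z h => ?_)
    · rw [indicator_of_mem hz, indicator_of_mem hz, real_inner_smul_left, real_inner_smul_right]
    · rw [image_eq_zero_of_notMem_tsupport (hz z h), zero_smul, inner_zero_left]
  rw [e1, e2]
  exact key ξ

/-- Uses only the regularity of `u`: the representation of `∂ₜu` is itself an equation in divergence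
form with flux `-b` and source `a`. In positive dimension a bounded `Ω` has nonempty complement,
which the distance weight requires. -/
theorem exists_timeContinuousRep_of_weak_derivatives (hd : 1 ≤ d) (hT : T₁ < T₂) (hΩ : IsOpen Ω)
    (hΩb : Bornology.IsBounded Ω) {u : ℝ × Space d → ℝ} {G : ℝ × Space d → Space d}
    (huL : InLinftyL2 T₁ T₂ Ω u) (hut : TimeDerivInL2HMinusOne T₁ T₂ Ω u)
    (hG : IsWeakSpaceGrad T₁ T₂ Ω u G) : ∃ v, IsTimeContinuousRep T₁ T₂ Ω u v := by
  have : Nonempty (Fin d) := ⟨⟨0, hd⟩⟩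
  have hne : Ωᶜ.Nonempty := by
    rw [nonempty_compl]
    rintro rfl
    exact NormedSpace.unbounded_univ ℝ (Space d) hΩb
  obtain ⟨a, b, ha, hb, h⟩ := hut.exists_repr huL.memLp
  refine exists_isTimeContinuousRep hT hΩ hΩb hne huL ((memLp_indicator_cylinder hΩ).2 huL.memLp)
    ((memLp_indicator_cylinder hΩ).2 ha) ((memLp_indicator_cylinder hΩ).2 hb.neg)
    ((memLp_indicator_cylinder hΩ).2 hG.memLp) (fun φ hφ => hG.integral_indicator_eq hΩ hφ)
    fun φ hφ => ?_
  rw [divForm_indicator hΩ, h φ hφ]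
  simp only [Pi.neg_apply, inner_neg_left, integral_neg]
  ring

end CylinderIntegrals

/-! ### Subsolutions belong to the De Giorgi class -/

section Subsolutions

variable {d : ℕ} {T₁ T₂ : ℝ} {Ω : Set (Space d)} {lam Lam M : ℝ} {q : ℝ≥0∞}
  {A : ℝ × Space d → Matrix (Fin d) (Fin d) ℝ} {B : ℝ × Space d → Space d} {g : ℝ × Space d → ℝ}

theorem aestronglyMeasurable_toEuclideanLin {α : Type*} [MeasurableSpace α] {μ : Measure α}
    {A : α → Matrix (Fin d) (Fin d) ℝ} {G : α → Space d}
    (hA : ∀ i j, AEStronglyMeasurable (fun z => A z i j) μ) (hG : AEStronglyMeasurable G μ) :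
    AEStronglyMeasurable (fun z => (A z).toEuclideanLin (G z)) μ := by
  have h1 : ∀ j, AEStronglyMeasurable (fun z => G z j) μ := fun j =>
    (EuclideanSpace.proj j : Space d →L[ℝ] ℝ).continuous.comp_aestronglyMeasurable hG
  have h2 : (fun z => (A z).toEuclideanLin (G z)) =
      fun z => ∑ i, (∑ j, A z i j * G z j) • EuclideanSpace.single i (1 : ℝ) := by
    funext z
    ext i
    simp [Matrix.toLpLin_apply, Matrix.mulVec, dotProduct, Pi.single_apply]
  rw [h2]
  refine Finset.aestronglyMeasurable_fun_sum _ fun i _ => ?_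
  exact (Finset.aestronglyMeasurable_fun_sum _ fun j _ => (hA i j).mul (h1 j)).smul_const _

theorem AdmissibleCoefficients.norm_apply_le
    (h : AdmissibleCoefficients T₁ T₂ Ω lam Lam q A B g) (hM : IsMatrixBound T₁ T₂ Ω Lam A M) :
    ∀ᵐ z ∂(cylMeasure T₁ T₂ Ω), ∀ ξ : Space d, ‖(A z).toEuclideanLin ξ‖ ≤ M * ‖ξ‖ := by
  rcases hM with hM | ⟨hs, rfl⟩
  · exact hM
  · filter_upwards [hs, h.elliptic] with z hz he
    have hT : (A z).toEuclideanLin.IsSymmetric := by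
      rw [Matrix.isSymmetric_toEuclideanLin_iff, Matrix.IsHermitian,
        Matrix.conjTranspose_eq_transpose_of_trivial]
      exact hz
    exact norm_apply_le_of_isSymmetric hT h.Lam_pos (fun x => le_trans
      (mul_nonneg h.lam_pos.le (sq_nonneg _)) (he x).1) fun x => (he x).2

/-- Stated for every time-continuous representative, so that for a solution the same one can be used
on both sides. -/
theorem IsTimeContinuousRep.inDGPlus (hd : 1 ≤ d) (hΩ : IsOpen Ω)
    (hΩb : Bornology.IsBounded Ω) (hΩne : Ω.Nonempty)
    (hq : max 2 (((d : ℝ≥0∞) + 2) / 2) < q)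
    (hcoef : AdmissibleCoefficients T₁ T₂ Ω lam Lam q A B g) (hM : IsMatrixBound T₁ T₂ Ω Lam A M)
    {γ₃ : ℝ} (hγ₃_pos : 0 < γ₃) (hγ₃ : 2 * (eLpNorm g q (cylMeasure T₁ T₂ Ω)).toReal ≤ γ₃)
    {u v : ℝ × Space d → ℝ} (hu : IsWeakSubsolution T₁ T₂ Ω A B g u)
    (hv : IsTimeContinuousRep T₁ T₂ Ω u v) :
    InDGPlus T₁ T₂ Ω (lam / 2) ((5 * M ^ 2 + Lam ^ 2 * Metric.diam Ω ^ 2) / lam) γ₃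
      q.conjExponent.toReal v := by
  obtain ⟨huL, -, G, hG, hsub⟩ := hu
  have hfin : IsFiniteMeasure (cylMeasure T₁ T₂ Ω) := isFiniteMeasure_cylMeasure hΩb
  have hq2 : 2 ≤ q := (le_max_left _ _).trans hq.le
  have hq1 : 1 < q := ENNReal.one_lt_two.trans_le hq2
  have hvL := huL.congr hv.ae_eq
  have hv2 := hvL.memLp
  have hlam := hcoef.lam_pos
  have hLam := hcoef.Lam_pos
  have hGv : IsWeakSpaceGrad T₁ T₂ Ω v G := hG.congr hv.ae_eq (hv2.integrable one_le_two)
  have hA := hcoef.norm_apply_le hM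
  have hg2 : MemLp g 2 (cylMeasure T₁ T₂ Ω) := hcoef.memLp_g.mono_exponent hq2
  have hBG : MemLp (fun z => ⟪B z, G z⟫) 2 (cylMeasure T₁ T₂ Ω) := by
    refine MemLp.of_le_mul (c := Lam) hG.memLp (hcoef.measurable_B.inner hG.memLp.1) ?_
    filter_upwards [hcoef.bound_B] with z hz
    exact (norm_inner_le_norm _ _).trans (by gcongr)
  have hAG : MemLp (fun z => (A z).toEuclideanLin (G z)) 2 (cylMeasure T₁ T₂ Ω) := by
    refine MemLp.of_le_mul (c := M) hG.memLp
      (aestronglyMeasurable_toEuclideanLin hcoef.measurable_A hG.memLp.1) ?_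
    filter_upwards [hA] with z hz using hz _
  have hdiv : ∀ φ, IsTestFunction (cylinder T₁ T₂ Ω) φ → (∀ z, 0 ≤ φ z) →
      divForm ((cylinder T₁ T₂ Ω).indicator v)
        ((cylinder T₁ T₂ Ω).indicator fun z => (A z).toEuclideanLin (G z))
        ((cylinder T₁ T₂ Ω).indicator fun z => ⟪B z, G z⟫ + g z) φ ≤ 0 := fun φ hφ hφ0 => by
    have h1 := hsub φ hφ hφ0
    have hφ2 : MemLp φ 2 (cylMeasure T₁ T₂ Ω) := (hφ.memLp_volume 2).restrict _
    have e1 : ∫ z, v z * timeDeriv φ z ∂(cylMeasure T₁ T₂ Ω) =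
        ∫ z, u z * timeDeriv φ z ∂(cylMeasure T₁ T₂ Ω) := by
      refine integral_congr_ae ?_
      filter_upwards [hv.ae_eq] with z hz
      rw [hz]
    have e2 : ∫ z, (⟪B z, G z⟫ + g z) * φ z ∂(cylMeasure T₁ T₂ Ω) =
        (∫ z, ⟪B z, G z⟫ * φ z ∂(cylMeasure T₁ T₂ Ω)) +
          ∫ z, g z * φ z ∂(cylMeasure T₁ T₂ Ω) := by
      simp only [add_mul]
      exact integral_add (hBG.integrable_mul hφ2) (hg2.integrable_mul hφ2)
    rw [divForm_indicator hΩ, e1, e2]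
    rw [weakForm] at h1
    linarith
  -- A ball inside `Ω` makes the diameter positive, and the drift part alone then makes `γ₂`
  -- positive.
  obtain ⟨y, hy⟩ := hΩne
  obtain ⟨ρ, hρ, hball⟩ := Metric.isOpen_iff.1 hΩ y hy
  have hdiam : 0 < Metric.diam Ω := by
    linarith [two_mul_le_diam hd hΩb hρ.le hball]
  refine ⟨by positivity, by positivity, hγ₃_pos, one_le_toReal_conjExponent hq1,
    toReal_conjExponent_le hd ((le_max_right _ _).trans hq.le), hvL, hv.slice_memLp, ⟨G, hGv⟩,
    fun k => ⟨_, isWeakSpaceGrad_truncation hΩ hΩb hv2 hGv k, ?_⟩⟩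
  intro s t hs hst ht r R hr hrR x₀ _ hball
  exact deGiorgi_energy hd hΩ hΩb hq2 hlam
    (hcoef.elliptic.mono fun z hz ξ => (hz ξ).1) hA hcoef.bound_B hv.slice_memLp hv.continuous
    hv2 hG.memLp hcoef.memLp_g ((memLp_indicator_cylinder hΩ).2 (hBG.add hg2))
    ((memLp_indicator_cylinder hΩ).2 hAG) (fun φ hφ => hGv.integral_indicator_eq hΩ hφ) hdiv hγ₃
    k hs hst ht hr hrR hball

end Subsolutions

/-! ### Reflection from subsolutions to supersolutions -/

section Reflection

variable {d : ℕ} {T₁ T₂ : ℝ} {Ω : Set (Space d)} {lam Lam : ℝ} {q : ℝ≥0∞}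
  {A : ℝ × Space d → Matrix (Fin d) (Fin d) ℝ} {B : ℝ × Space d → Space d}
  {g u v : ℝ × Space d → ℝ} {G : ℝ × Space d → Space d}

theorem InLinftyL2.neg (h : InLinftyL2 T₁ T₂ Ω u) : InLinftyL2 T₁ T₂ Ω (-u) := by
  refine ⟨h.measurable.neg, ?_⟩
  obtain ⟨C, hC⟩ := h.bounded
  refine ⟨C, hC.mono fun t ht => ?_⟩
  have e : (fun x => (-u) (t, x)) = -fun x => u (t, x) := rfl
  rwa [e, eLpNorm_neg]

theorem IsWeakSpaceGrad.neg (h : IsWeakSpaceGrad T₁ T₂ Ω u G) :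
    IsWeakSpaceGrad T₁ T₂ Ω (-u) (-G) := by
  refine ⟨h.locallyIntegrable.neg, h.memLp.neg, fun φ hφ => ?_⟩
  simp only [Pi.neg_apply, neg_smul, smul_neg, integral_neg, h.integral_eq φ hφ]

theorem memLp_neg_dual {α : Type*} [MeasurableSpace α] {μ : Measure α} {E : Type*}
    [NormedAddCommGroup E] [NormedSpace ℝ E] {f : α → StrongDual ℝ E} {p : ℝ≥0∞}
    (hf : MemLp f p μ) : MemLp (fun t => -f t) p μ :=
  hf.neg

theorem TimeDerivInL2HMinusOne.neg (h : TimeDerivInL2HMinusOne T₁ T₂ Ω u) :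
    TimeDerivInL2HMinusOne T₁ T₂ Ω (-u) := by
  obtain ⟨f, hf, h⟩ := h
  refine ⟨fun t => -f t, memLp_neg_dual hf, fun φ hφ => ?_⟩
  simp only [Pi.neg_apply, neg_mul, neg_apply, integral_neg, ← h φ hφ]

theorem weakForm_neg (φ : ℝ × Space d → ℝ) :
    weakForm T₁ T₂ Ω A B (-g) (-u) (-G) φ = -weakForm T₁ T₂ Ω A B g u G φ := by
  simp only [weakForm, Pi.neg_apply, neg_mul, map_neg, inner_neg_left, inner_neg_right,
    integral_neg]
  ring

theorem IsWeakSupersolution.neg (h : IsWeakSupersolution T₁ T₂ Ω A B g u) :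
    IsWeakSubsolution T₁ T₂ Ω A B (-g) (-u) := by
  obtain ⟨h1, h2, G, h3, h4⟩ := h
  refine ⟨h1.neg, h2.neg, -G, h3.neg, fun φ hφ hφ0 => ?_⟩
  rw [weakForm_neg]
  exact neg_nonpos.2 (h4 φ hφ hφ0)

theorem AdmissibleCoefficients.neg (h : AdmissibleCoefficients T₁ T₂ Ω lam Lam q A B g) :
    AdmissibleCoefficients T₁ T₂ Ω lam Lam q A B (-g) :=
  { h with memLp_g := h.memLp_g.neg }

theorem IsTimeContinuousRep.neg (h : IsTimeContinuousRep T₁ T₂ Ω u v) :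
    IsTimeContinuousRep T₁ T₂ Ω (-u) (-v) := by
  refine ⟨h.ae_eq.mono fun z hz => by simp [hz], fun t ht => (h.slice_memLp t ht).neg,
    fun K hK hKc t₀ ht₀ => (h.continuous K hK hKc t₀ ht₀).congr fun t => ?_⟩
  rw [← eLpNorm_neg]
  congr 1
  funext x
  simp only [Pi.neg_apply]
  ring

/-- The level `k` for `v` corresponds to the level `-k` for `-v`, since `(-v) - (-k) = -(v - k)`. -/
theorem InDGPlus.neg {γ₁ γ₂ γ₃ p : ℝ} (h : InDGPlus T₁ T₂ Ω γ₁ γ₂ γ₃ p (-v)) :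
    InDGMinus T₁ T₂ Ω γ₁ γ₂ γ₃ p v := by
  refine ⟨h.γ₁_pos, h.γ₂_pos, h.γ₃_pos, h.one_le_p, h.p_le, neg_neg v ▸ h.inLinftyL2.neg,
    fun t ht => ?_, ?_, fun k => ?_⟩
  · have := (h.slice_memLp t ht).neg
    simpa [Pi.neg_def] using this
  · obtain ⟨G, hG⟩ := h.hasGrad
    exact ⟨-G, neg_neg v ▸ hG.neg⟩
  · have e : ∀ z, (-v) z - -k = -(v z - k) := fun z => by
      simp only [Pi.neg_apply]
      ring
    have := h.energy (-k)
    simp only [e] at this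
    exact this

theorem IsWeakSolution.isWeakSubsolution (h : IsWeakSolution T₁ T₂ Ω A B g u) :
    IsWeakSubsolution T₁ T₂ Ω A B g u := by
  obtain ⟨h1, h2, G, h3, h4⟩ := h
  exact ⟨h1, h2, G, h3, fun φ hφ _ => (h4 φ hφ).le⟩

theorem IsWeakSolution.isWeakSupersolution (h : IsWeakSolution T₁ T₂ Ω A B g u) :
    IsWeakSupersolution T₁ T₂ Ω A B g u := by
  obtain ⟨h1, h2, G, h3, h4⟩ := h
  exact ⟨h1, h2, G, h3, fun φ hφ _ => (h4 φ hφ).ge⟩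

end Reflection

end ParabolicDG

/-! ### The De Giorgi class theorem -/

theorem proposition2p4 {d : ℕ} (hd : 1 ≤ d) (T₁ T₂ : ℝ) (hT : T₁ < T₂)
    (Ω : Set (ParabolicDG.Space d)) (hΩ_open : IsOpen Ω) (hΩ_bdd : Bornology.IsBounded Ω)
    (hΩ_ne : Ω.Nonempty)
    (lam Lam : ℝ) (q : ℝ≥0∞) (hq : max 2 (((d : ℝ≥0∞) + 2) / 2) < q)
    (A : ℝ × ParabolicDG.Space d → Matrix (Fin d) (Fin d) ℝ)
    (B : ℝ × ParabolicDG.Space d → ParabolicDG.Space d)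
    (g : ℝ × ParabolicDG.Space d → ℝ)
    (hcoef : ParabolicDG.AdmissibleCoefficients T₁ T₂ Ω lam Lam q A B g)
    (M : ℝ) (hM : ParabolicDG.IsMatrixBound T₁ T₂ Ω Lam A M)
    (γ₂ : ℝ) (hγ₂ : γ₂ = (5 * M ^ 2 + Lam ^ 2 * Metric.diam Ω ^ 2) / lam)
    (γ₃ : ℝ) (hγ₃_pos : 0 < γ₃)
    (hγ₃ : 2 * (eLpNorm g q (ParabolicDG.cylMeasure T₁ T₂ Ω)).toReal ≤ γ₃)
    (u : ℝ × ParabolicDG.Space d → ℝ) :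
    (ParabolicDG.IsWeakSubsolution T₁ T₂ Ω A B g u →
      ∃ v, ParabolicDG.IsTimeContinuousRep T₁ T₂ Ω u v ∧
        ParabolicDG.InDGPlus T₁ T₂ Ω (lam / 2) γ₂ γ₃ q.conjExponent.toReal v) ∧
    (ParabolicDG.IsWeakSupersolution T₁ T₂ Ω A B g u →
      ∃ v, ParabolicDG.IsTimeContinuousRep T₁ T₂ Ω u v ∧
        ParabolicDG.InDGMinus T₁ T₂ Ω (lam / 2) γ₂ γ₃ q.conjExponent.toReal v) ∧
    (ParabolicDG.IsWeakSolution T₁ T₂ Ω A B g u →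
      ∃ v, ParabolicDG.IsTimeContinuousRep T₁ T₂ Ω u v ∧
        ParabolicDG.InDGPlus T₁ T₂ Ω (lam / 2) γ₂ γ₃ q.conjExponent.toReal v ∧
        ParabolicDG.InDGMinus T₁ T₂ Ω (lam / 2) γ₂ γ₃ q.conjExponent.toReal v) := by
  subst hγ₂
  -- The sign of the weak inequality plays no role for the representative; only the regularity part
  -- of either notion is used.
  have rep : ∀ w : ℝ × ParabolicDG.Space d → ℝ,
      ParabolicDG.IsWeakSubsolution T₁ T₂ Ω A B g w ∨
        ParabolicDG.IsWeakSupersolution T₁ T₂ Ω A B g w →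
      ∃ v, ParabolicDG.IsTimeContinuousRep T₁ T₂ Ω w v := by
    rintro w (⟨h1, h2, G, h3, -⟩ | ⟨h1, h2, G, h3, -⟩) <;>
    exact ParabolicDG.exists_timeContinuousRep_of_weak_derivatives hd hT hΩ_open hΩ_bdd h1 h2 h3
  have plus : ∀ v, ParabolicDG.IsWeakSubsolution T₁ T₂ Ω A B g u →
      ParabolicDG.IsTimeContinuousRep T₁ T₂ Ω u v →
      ParabolicDG.InDGPlus T₁ T₂ Ω (lam / 2)
        ((5 * M ^ 2 + Lam ^ 2 * Metric.diam Ω ^ 2) / lam) γ₃ q.conjExponent.toReal v :=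
    fun v h hv => hv.inDGPlus hd hΩ_open hΩ_bdd hΩ_ne hq hcoef hM hγ₃_pos hγ₃ h
  have minus : ∀ v, ParabolicDG.IsWeakSupersolution T₁ T₂ Ω A B g u →
      ParabolicDG.IsTimeContinuousRep T₁ T₂ Ω u v →
      ParabolicDG.InDGMinus T₁ T₂ Ω (lam / 2)
        ((5 * M ^ 2 + Lam ^ 2 * Metric.diam Ω ^ 2) / lam) γ₃ q.conjExponent.toReal v :=
    fun v h hv => (hv.neg.inDGPlus hd hΩ_open hΩ_bdd hΩ_ne hq hcoef.neg hM hγ₃_pos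
      (by rwa [eLpNorm_neg]) h.neg).neg
  refine ⟨fun h => ?_, fun h => ?_, fun h => ?_⟩
  · obtain ⟨v, hv⟩ := rep u (Or.inl h)
    exact ⟨v, hv, plus v h hv⟩
  · obtain ⟨v, hv⟩ := rep u (Or.inr h)
    exact ⟨v, hv, minus v h hv⟩
  · obtain ⟨v, hv⟩ := rep u (Or.inl h.isWeakSubsolution)
    exact ⟨v, hv, plus v h.isWeakSubsolution hv, minus v h.isWeakSupersolution hv⟩
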